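/- Let $d\ge 1$ and let $\Omega\subset\mathbb R^d$ be a bounded Lipschitz domain (open, connected, nonempty). Let $\Gamma^D,\Gamma^N$ be disjoint measurable parts of $\partial\Omega$ with $\overline{\Gamma^D\cup\Gamma^N}=\partial\Omega$ and $\Gamma^D$ of positive $(d-1)$-dimensional Hausdorff measure. Let $H^1_D(\Omega)=\{u\in H^1(\Omega): u|_{\Gamma^D}=0\}$ in the sense of traces. Let $\lambda>0$, $z_a\in\mathbb Z$, $p\in[1,\infty]$ with $p>d/2$. Let $S_a<\infty$ and let $F_a:\mathbb R\to(0,S_a)$ be a $C^1$-diffeomorphism with $0<F_a'(\eta)\le F_a(\eta)\le e^{\eta}$ for all $\eta\in\mathbb R$. Let $0<M_a<|\Omega|\,S_a$. Then there is a constant $K>0$, depending only on $\Omega$, $\Gamma^D$, $p$, $\lambda$, $F_a$, $M_a$ and $|z_a|$, such that for every $\psi^D\in H^1(\Omega)\cap L^\infty(\Omega)$, every $f\in L^p(\Omega)$ and every $\sigma\in[0,1]$ there is exactly one pair $(v_a,\psi)\in\mathbb R\times H^1(\Omega)$ with $\psi-\sigma\psi^D\in H^1_D(\Omega)$ that is a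 weak solution of $$-\lambda^2\Delta\psi=\sigma\bigl(f+z_aF_a(v_a-z_a\psi)\bigr)\ \text{in }\Omega,\qquad \psi=\sigma\psi^D\ \text{on }\Gamma^D,\qquad \nabla\psi\cdot\nu=0\ \text{on }\Gamma^N,$$ with the mass constraint $\int_\Omega F_a(v_a-z_a\psi)\,dx=M_a$, that is, such that this constraint holds and for all $\phi\in H^1_D(\Omega)$ $$\lambda^2\int_\Omega\nabla\psi\cdot\nabla\phi\,dx=\sigma\int_\Omega\bigl(f+z_aF_a(v_a-z_a\psi)\bigr)\phi\,dx .$$ Moreover this solution satisfies $$\sigma|v_a|+\|\psi\|_{H^1(\Omega)}^2\le\sigma K\bigl(1+\|\psi^D\|_{H^1(\Omega)}^2+\|f\|_{L^p(\Omega)}^2\bigr).$$ -/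

import Mathlib

open MeasureTheory Filter Set
open scoped ENNReal NNReal Topology ContDiff

/-- `IsLipschitzBoundary Ω`: near every boundary point, in suitable orthonormal coordinates, `Ω` is
the set strictly above the graph of a Lipschitz function. The vertical direction is the unit
vector `e`, the horizontal part of `y` is `y - ⟪e, y⟫ e`, and `γ` is evaluated on horizontal
vectors only. -/
def IsLipschitzBoundary {d : ℕ} (Ω : Set (EuclideanSpace ℝ (Fin d))) : Prop :=
  ∀ x ∈ frontier Ω, ∃ e : EuclideanSpace ℝ (Fin d), ‖e‖ = 1 ∧
    ∃ (L : ℝ≥0) (γ : EuclideanSpace ℝ (Fin d) → ℝ), LipschitzWith L γ ∧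
      ∃ r > 0, ∀ y ∈ Metric.ball x r,
        (y ∈ Ω ↔ γ (y - inner ℝ e y • e) < inner ℝ e y)

/-- Bounded Lipschitz domain: nonempty, open, connected, bounded, with Lipschitz boundary. -/
structure IsBoundedLipschitzDomain {d : ℕ} (Ω : Set (EuclideanSpace ℝ (Fin d))) : Prop where
  isOpen : IsOpen Ω
  isConnected : IsConnected Ω
  isBounded : Bornology.IsBounded Ω
  lipschitz : IsLipschitzBoundary Ω

/-- The `(d-1)`-dimensional Hausdorff measure on `ℝᵈ` (used for `d ≥ 1`). -/
noncomputable def surfaceMeasure (d : ℕ) : Measure (EuclideanSpace ℝ (Fin d)) :=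
  Measure.hausdorffMeasure ((d : ℝ) - 1)

/-- Partition of the boundary of `Ω` into a Dirichlet part `ΓD` of positive surface measure
and a Neumann part `ΓN`. -/
structure IsBoundarySplitting {d : ℕ} (Ω ΓD ΓN : Set (EuclideanSpace ℝ (Fin d))) : Prop where
  measurableSet_dirichlet : MeasurableSet ΓD
  measurableSet_neumann : MeasurableSet ΓN
  disjoint : Disjoint ΓD ΓN
  closure_union : closure (ΓD ∪ ΓN) = frontier Ω
  dirichlet_pos : 0 < surfaceMeasure d ΓD

/-- `F : ℝ → (0, S)` is a `C¹`-diffeomorphism with `0 < F' ≤ F ≤ exp`. (Since `F' > 0`, the inverse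
of a `C¹` bijection is automatically `C¹`.) In particular `S = sup F` is finite. -/
structure IsIonStatistics (F : ℝ → ℝ) (S : ℝ) : Prop where
  contDiff : ContDiff ℝ 1 F
  bijOn : BijOn F univ (Ioo 0 S)
  deriv_pos : ∀ η, 0 < deriv F η
  deriv_le : ∀ η, deriv F η ≤ F η
  le_exp : ∀ η, F η ≤ Real.exp η

/-- `G` is the weak gradient of `u` on the open set `Ω`: for every test function
`φ ∈ C_c^∞(Ω)` and every direction `e`, `∫_Ω u ∂_e φ = - ∫_Ω (G · e) φ`. -/
def IsWeakGradient {d : ℕ} (Ω : Set (EuclideanSpace ℝ (Fin d)))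
    (u : EuclideanSpace ℝ (Fin d) → ℝ)
    (G : EuclideanSpace ℝ (Fin d) → EuclideanSpace ℝ (Fin d)) : Prop :=
  ∀ φ : EuclideanSpace ℝ (Fin d) → ℝ, ContDiff ℝ ∞ φ → HasCompactSupport φ → tsupport φ ⊆ Ω →
    ∀ e : EuclideanSpace ℝ (Fin d),
      ∫ x in Ω, u x * fderiv ℝ φ x e = - ∫ x in Ω, inner ℝ (G x) e * φ x

/-- The Sobolev space `H¹(Ω)`: square integrable functions on `Ω` with a square integrable weak
gradient. The values of `u` outside `Ω` are irrelevant. -/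
def MemH1 {d : ℕ} (Ω : Set (EuclideanSpace ℝ (Fin d))) (u : EuclideanSpace ℝ (Fin d) → ℝ) : Prop :=
  MemLp u 2 (volume.restrict Ω) ∧
    ∃ G : EuclideanSpace ℝ (Fin d) → EuclideanSpace ℝ (Fin d),
      MemLp G 2 (volume.restrict Ω) ∧ IsWeakGradient Ω u G

open Classical in
/-- The weak gradient of `u ∈ H¹(Ω)` (unique up to almost everywhere equality on `Ω`). -/
noncomputable def weakGrad {d : ℕ} (Ω : Set (EuclideanSpace ℝ (Fin d)))
    (u : EuclideanSpace ℝ (Fin d) → ℝ) : EuclideanSpace ℝ (Fin d) → EuclideanSpace ℝ (Fin d) :=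
  if h : MemH1 Ω u then h.2.choose else 0

/-- The norm `‖u‖_{H¹(Ω)} = (‖u‖²_{L²(Ω)} + ‖∇u‖²_{L²(Ω)})^{1/2}`. -/
noncomputable def h1Norm {d : ℕ} (Ω : Set (EuclideanSpace ℝ (Fin d)))
    (u : EuclideanSpace ℝ (Fin d) → ℝ) : ℝ :=
  Real.sqrt ((eLpNorm u 2 (volume.restrict Ω)).toReal ^ 2 +
    (eLpNorm (weakGrad Ω u) 2 (volume.restrict Ω)).toReal ^ 2)

/-- `g` is the trace of `u ∈ H¹(Ω)` on the part `Γ` of the boundary. The trace operator is the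
continuous extension to `H¹(Ω)` of the restriction `s ↦ s|_Γ` of functions `s` that are smooth up to
the boundary: `g` is the limit in `L²(Γ)`, for the surface measure, of the boundary values of smooth
functions that converge to `u` in `H¹(Ω)`. -/
def HasTrace {d : ℕ} (Ω Γ : Set (EuclideanSpace ℝ (Fin d)))
    (u g : EuclideanSpace ℝ (Fin d) → ℝ) : Prop :=
  ∃ s : ℕ → EuclideanSpace ℝ (Fin d) → ℝ, (∀ n, ContDiff ℝ ∞ (s n)) ∧
    Tendsto (fun n => eLpNorm (fun x => s n x - u x) 2 (volume.restrict Ω)) atTop (𝓝 0) ∧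
    Tendsto (fun n => eLpNorm (fun x => gradient (s n) x - weakGrad Ω u x) 2 (volume.restrict Ω))
      atTop (𝓝 0) ∧
    Tendsto (fun n => eLpNorm (fun x => s n x - g x) 2 ((surfaceMeasure d).restrict Γ))
      atTop (𝓝 0)

/-- The space `H¹_D(Ω)` of functions in `H¹(Ω)` whose trace on `ΓD` vanishes. -/
def MemH1D {d : ℕ} (Ω ΓD : Set (EuclideanSpace ℝ (Fin d)))
    (u : EuclideanSpace ℝ (Fin d) → ℝ) : Prop :=
  MemH1 Ω u ∧ HasTrace Ω ΓD u 0

/-- `(v, ψ)` is a weak solution of `-lam² Δψ = σ (f + z F(v - z ψ))` in `Ω`, `ψ = σ ψD` on `ΓD` (and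
the homogeneous Neumann condition on the rest of the boundary), with the mass constraint
`∫_Ω F(v - z ψ) = M`. -/
structure IsPoissonWeakSolution {d : ℕ} (Ω ΓD : Set (EuclideanSpace ℝ (Fin d))) (lam : ℝ) (z : ℤ)
    (F : ℝ → ℝ) (M σ : ℝ) (ψD f : EuclideanSpace ℝ (Fin d) → ℝ)
    (v : ℝ) (ψ : EuclideanSpace ℝ (Fin d) → ℝ) : Prop where
  memH1 : MemH1 Ω ψ
  boundary : MemH1D Ω ΓD (fun x => ψ x - σ * ψD x)
  integrable : ∀ φ, MemH1D Ω ΓD φ →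
    Integrable (fun x => (f x + z * F (v - z * ψ x)) * φ x) (volume.restrict Ω)
  equation : ∀ φ, MemH1D Ω ΓD φ →
    lam ^ 2 * ∫ x in Ω, inner ℝ (weakGrad Ω ψ x) (weakGrad Ω φ x) =
      σ * ∫ x in Ω, (f x + z * F (v - z * ψ x)) * φ x
  mass : ∫ x in Ω, F (v - z * ψ x) = M

/-!
Given two measures, bound the mean square oscillation of a smooth function between them by its
Dirichlet energy. The Lebesgue measures of two subsets of a convex set satisfy such an estimate by
integrating along segments, and by the triangle inequality it propagates along chains of balls,
through cones with their apex at a boundary point, and along Lipschitz graphs to the surface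
measure. Comparing a boundary piece on which the trace vanishes with the whole domain gives the
Friedrichs inequality on `H¹_D(Ω)`. The same cones bound a function at almost every point of the
domain by a Riesz potential of its gradient, so that `f ∈ L^p` with `p > d / 2` acts as a bounded
functional on `H¹`.

The constrained problem is the Euler–Lagrange system of the energy
`λ² / 2 ‖∇ψ‖² - σ ∫ f ψ + σ (∫ Ψ (v - z ψ) - M v)` with `Ψ' = F`, in which the Lagrange multiplier
`v` is an additional variable. The energy is convex, and it is coercive in `v` because the slope
`|Ω| F` of `∫ Ψ (v)` exceeds `M` for large `v` and is below `M` for small `v`; a minimizer therefore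
exists. Uniqueness follows from the strict monotonicity of `F`. Testing the equation with
`ψ - σ ψD` bounds `ψ` in `H¹` independently of `v`, since `0 < F < S`, and `|v|` is then read off
the coercivity.
-/

section Hoelder

variable {α : Type*} [MeasurableSpace α] {μ : Measure α} {p q : ℝ≥0∞} [p.HolderConjugate q]

theorem integrable_fun_mul {a b : α → ℝ} (ha : MemLp a p μ) (hb : MemLp b q μ) :
    Integrable (fun x => a x * b x) μ :=
  ha.integrable_mul hb

theorem enorm_integral_mul_le_eLpNorm_mul_eLpNorm {a b : α → ℝ} (ha : AEStronglyMeasurable a μ)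
    (hb : AEStronglyMeasurable b μ) : ‖∫ x, a x * b x ∂μ‖ₑ ≤ eLpNorm a p μ * eLpNorm b q μ := by
  refine (enorm_integral_le_lintegral_enorm _).trans ?_
  have hölder := eLpNorm_smul_le_mul_eLpNorm (p := p) (q := q) (r := 1) hb ha
  rwa [eLpNorm_one_eq_lintegral_enorm] at hölder

theorem tendsto_integral_mul_of_tendsto_eLpNorm {ι : Type*} {l : Filter ι} {s : ι → α → ℝ}
    {u b : α → ℝ} (hs : ∀ n, MemLp (s n) p μ) (hu : MemLp u p μ) (hb : MemLp b q μ)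
    (hsu : Tendsto (fun n => eLpNorm (fun x => s n x - u x) p μ) l (𝓝 0)) :
    Tendsto (fun n => ∫ x, s n x * b x ∂μ) l (𝓝 (∫ x, u x * b x ∂μ)) := by
  rw [← tendsto_sub_nhds_zero_iff, tendsto_zero_iff_enorm_tendsto_zero]
  have bound : Tendsto (fun n => eLpNorm (fun x => s n x - u x) p μ * eLpNorm b q μ) l (𝓝 0) := by
    simpa only [zero_mul] using ENNReal.Tendsto.mul_const hsu (Or.inr hb.2.ne)
  refine tendsto_of_tendsto_of_tendsto_of_le_of_le tendsto_const_nhds bound (fun _ => zero_le)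
    fun n => ?_
  rw [← integral_sub (integrable_fun_mul (hs n) hb) (integrable_fun_mul hu hb)]
  simp_rw [← sub_mul]
  exact enorm_integral_mul_le_eLpNorm_mul_eLpNorm ((hs n).sub hu).1 hb.1

end Hoelder

section WeakGradient

theorem memLp_restrict_of_continuous_of_isBounded {X E : Type*} [PseudoMetricSpace X]
    [ProperSpace X] [MeasurableSpace X] [OpensMeasurableSpace X] {μ : Measure X}
    [IsFiniteMeasureOnCompacts μ] [NormedAddCommGroup E] [SecondCountableTopologyEither X E]
    {t : Set X} {s : X → E}
    (hs : Continuous s) (ht : Bornology.IsBounded t) (p : ℝ≥0∞) : MemLp s p (μ.restrict t) := by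
  have hK : IsCompact (closure t) := ht.isCompact_closure
  have : IsFiniteMeasure (μ.restrict (closure t)) := ⟨by simpa using hK.measure_lt_top⟩
  obtain ⟨C, hC⟩ := hK.exists_bound_of_continuousOn hs.continuousOn
  have memLp_closure : MemLp s p (μ.restrict (closure t)) :=
    MemLp.of_bound hs.aestronglyMeasurable C
      ((ae_restrict_iff' isClosed_closure.measurableSet).2 (Eventually.of_forall hC))
  exact memLp_closure.mono_measure (Measure.restrict_mono subset_closure le_rfl)

theorem continuous_gradient_of_contDiff {E : Type*} [NormedAddCommGroup E] [InnerProductSpace ℝ E]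
    [CompleteSpace E] {s : E → ℝ} {n : WithTop ℕ∞} (hs : ContDiff ℝ n s) (hn : n ≠ 0) :
    Continuous (gradient s) :=
  (InnerProductSpace.toDual ℝ E).symm.continuous.comp (hs.continuous_fderiv hn)

variable {d : ℕ} {Ω : Set (EuclideanSpace ℝ (Fin d))} {φ s u u' : EuclideanSpace ℝ (Fin d) → ℝ}
  {G G' : EuclideanSpace ℝ (Fin d) → EuclideanSpace ℝ (Fin d)}

theorem memLp_testFunction (hφ : ContDiff ℝ ∞ φ) (hc : HasCompactSupport φ) (p : ℝ≥0∞) :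
    MemLp φ p (volume.restrict Ω) :=
  (hφ.continuous.memLp_of_hasCompactSupport hc).restrict Ω

theorem memLp_fderiv_testFunction (hφ : ContDiff ℝ ∞ φ) (hc : HasCompactSupport φ) (p : ℝ≥0∞)
    (e : EuclideanSpace ℝ (Fin d)) : MemLp (fun x => fderiv ℝ φ x e) p (volume.restrict Ω) :=
  (((hφ.continuous_fderiv (by simp)).clm_apply continuous_const).memLp_of_hasCompactSupport
    (hc.fderiv_apply ℝ e)).restrict Ω

theorem isWeakGradient_gradient (hs : ContDiff ℝ ∞ s) : IsWeakGradient Ω s (gradient s) := by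
  intro φ hφ hc hsub e
  have continuous_fderiv_apply {w : EuclideanSpace ℝ (Fin d) → ℝ} (hw : ContDiff ℝ ∞ w) :
      Continuous fun x => fderiv ℝ w x e :=
    (hw.continuous_fderiv (by simp)).clm_apply continuous_const
  have integral_by_parts : ∫ x, s x * fderiv ℝ φ x e = -∫ x, fderiv ℝ s x e * φ x :=
    integral_mul_fderiv_eq_neg_fderiv_mul_of_integrable
      (((continuous_fderiv_apply hs).mul hφ.continuous).integrable_of_hasCompactSupport hc.mul_left)
      ((hs.continuous.mul (continuous_fderiv_apply hφ)).integrable_of_hasCompactSupport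
        (hc.fderiv_apply ℝ e).mul_left)
      ((hs.continuous.mul hφ.continuous).integrable_of_hasCompactSupport hc.mul_left)
      (fun x _ => hs.differentiable (by simp) x) (fun x _ => hφ.differentiable (by simp) x)
  have hφ_zero : ∀ x ∉ Ω, φ x = 0 := fun x hx =>
    image_eq_zero_of_notMem_tsupport fun h => hx (hsub h)
  have hφ'_zero : ∀ x ∉ Ω, fderiv ℝ φ x e = 0 := fun x hx =>
    image_eq_zero_of_notMem_tsupport (f := fun x => fderiv ℝ φ x e)
      fun h => hx (hsub (tsupport_fderiv_apply_subset ℝ e h))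
  rw [setIntegral_eq_integral_of_forall_compl_eq_zero fun x hx => by rw [hφ'_zero x hx, mul_zero],
    setIntegral_eq_integral_of_forall_compl_eq_zero fun x hx => by rw [hφ_zero x hx, mul_zero],
    integral_by_parts]
  simp_rw [inner_gradient_left]

namespace IsWeakGradient

theorem linear_comb (h : IsWeakGradient Ω u G) (h' : IsWeakGradient Ω u' G')
    (hu : MemLp u 2 (volume.restrict Ω)) (hu' : MemLp u' 2 (volume.restrict Ω))
    (hG : MemLp G 2 (volume.restrict Ω)) (hG' : MemLp G' 2 (volume.restrict Ω)) (a b : ℝ) :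
    IsWeakGradient Ω (fun x => a * u x + b * u' x) (fun x => a • G x + b • G' x) := by
  intro φ hφ hc hsub e
  have mφ : MemLp φ 2 (volume.restrict Ω) := memLp_testFunction hφ hc 2
  have mφ' : MemLp (fun x => fderiv ℝ φ x e) 2 (volume.restrict Ω) :=
    memLp_fderiv_testFunction hφ hc 2 e
  calc ∫ x in Ω, (a * u x + b * u' x) * fderiv ℝ φ x e
      = ∫ x in Ω, (a * (u x * fderiv ℝ φ x e) + b * (u' x * fderiv ℝ φ x e)) := by
        congr 1; ext x; ring
    _ = a * -(∫ x in Ω, inner ℝ (G x) e * φ x) + b * -(∫ x in Ω, inner ℝ (G' x) e * φ x) := by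
        rw [integral_add ((integrable_fun_mul hu mφ').const_mul a)
          ((integrable_fun_mul hu' mφ').const_mul b),
          integral_const_mul, integral_const_mul, h φ hφ hc hsub e, h' φ hφ hc hsub e]
    _ = -∫ x in Ω, (a * (inner ℝ (G x) e * φ x) + b * (inner ℝ (G' x) e * φ x)) := by
        rw [integral_add ((integrable_fun_mul (hG.inner_const e) mφ).const_mul a)
          ((integrable_fun_mul (hG'.inner_const e) mφ).const_mul b),
          integral_const_mul, integral_const_mul]
        ring
    _ = -∫ x in Ω, inner ℝ (a • G x + b • G' x) e * φ x := by
        simp_rw [inner_add_left, real_inner_smul_left, add_mul, mul_assoc]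

theorem ae_unique (hΩ : IsOpen Ω) (h : IsWeakGradient Ω u G) (h' : IsWeakGradient Ω u G')
    (hG : MemLp G 2 (volume.restrict Ω)) (hG' : MemLp G' 2 (volume.restrict Ω)) :
    G =ᵐ[volume.restrict Ω] G' := by
  have inner_ae_eq (e : EuclideanSpace ℝ (Fin d)) :
      ∀ᵐ x, x ∈ Ω → inner ℝ (G x) e - inner ℝ (G' x) e = 0 := by
    have memLp_inner_sub : MemLp (fun x => inner ℝ (G x) e - inner ℝ (G' x) e) 2
        (volume.restrict Ω) := (hG.inner_const e).sub (hG'.inner_const e)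
    refine hΩ.ae_eq_zero_of_integral_contDiff_smul_eq_zero
      (locallyIntegrableOn_of_locallyIntegrable_restrict
        (memLp_inner_sub.locallyIntegrable one_le_two)) fun φ hφ hc hsub => ?_
    have hφ_zero : ∀ x ∉ Ω, φ x = 0 := fun x hx =>
      image_eq_zero_of_notMem_tsupport fun h => hx (hsub h)
    have mφ : MemLp φ 2 (volume.restrict Ω) := memLp_testFunction hφ hc 2
    rw [← setIntegral_eq_integral_of_forall_compl_eq_zero (s := Ω)
      fun x hx => by rw [hφ_zero x hx, zero_smul]]
    simp_rw [smul_eq_mul, mul_comm (φ _), sub_mul]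
    rw [integral_sub (integrable_fun_mul (hG.inner_const e) mφ)
      (integrable_fun_mul (hG'.inner_const e) mφ)]
    linarith [h φ hφ hc hsub e, h' φ hφ hc hsub e]
  have coord_ae_eq (i : Fin d) : ∀ᵐ x ∂volume.restrict Ω, G x i = G' x i := by
    filter_upwards [(ae_restrict_iff' hΩ.measurableSet).2
      (inner_ae_eq (EuclideanSpace.single i 1))] with x hx
    simpa [EuclideanSpace.inner_single_right, sub_eq_zero] using hx
  filter_upwards [ae_all_iff.2 coord_ae_eq] with x hx
  ext i
  exact hx i

theorem of_tendsto {ι : Type*} {l : Filter ι} [l.NeBot] {s : ι → EuclideanSpace ℝ (Fin d) → ℝ}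
    {g : ι → EuclideanSpace ℝ (Fin d) → EuclideanSpace ℝ (Fin d)}
    (h : ∀ n, IsWeakGradient Ω (s n) (g n))
    (hu : MemLp u 2 (volume.restrict Ω)) (hG : MemLp G 2 (volume.restrict Ω))
    (hs : ∀ n, MemLp (s n) 2 (volume.restrict Ω)) (hg : ∀ n, MemLp (g n) 2 (volume.restrict Ω))
    (hsu : Tendsto (fun n => eLpNorm (fun x => s n x - u x) 2 (volume.restrict Ω)) l (𝓝 0))
    (hgG : Tendsto (fun n => eLpNorm (fun x => g n x - G x) 2 (volume.restrict Ω)) l (𝓝 0)) :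
    IsWeakGradient Ω u G := by
  intro φ hφ hc hsub e
  have eLpNorm_inner_le (n : ι) :
      eLpNorm (fun x => inner ℝ (g n x) e - inner ℝ (G x) e) 2 (volume.restrict Ω) ≤
        ENNReal.ofReal ‖e‖ * eLpNorm (fun x => g n x - G x) 2 (volume.restrict Ω) := by
    refine eLpNorm_le_mul_eLpNorm_of_ae_le_mul (Eventually.of_forall fun x => ?_) 2
    rw [← inner_sub_left, mul_comm]
    exact norm_inner_le_norm _ _
  have inner_tendsto : Tendsto
      (fun n => eLpNorm (fun x => inner ℝ (g n x) e - inner ℝ (G x) e) 2 (volume.restrict Ω))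
      l (𝓝 0) := by
    refine tendsto_of_tendsto_of_tendsto_of_le_of_le tendsto_const_nhds ?_ (fun _ => zero_le)
      eLpNorm_inner_le
    simpa only [mul_zero] using ENNReal.Tendsto.const_mul hgG (Or.inr ENNReal.ofReal_ne_top)
  refine tendsto_nhds_unique (tendsto_integral_mul_of_tendsto_eLpNorm hs hu
    (memLp_fderiv_testFunction hφ hc 2 e) hsu) ?_
  simp_rw [fun n => h n φ hφ hc hsub e]
  exact (tendsto_integral_mul_of_tendsto_eLpNorm (fun n => (hg n).inner_const e) (hG.inner_const e)
    (memLp_testFunction hφ hc 2) inner_tendsto).neg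

theorem weakGrad_ae_eq (hΩ : IsOpen Ω) (h : IsWeakGradient Ω u G)
    (hu : MemLp u 2 (volume.restrict Ω)) (hG : MemLp G 2 (volume.restrict Ω)) :
    weakGrad Ω u =ᵐ[volume.restrict Ω] G := by
  have hu1 : MemH1 Ω u := ⟨hu, G, hG, h⟩
  rw [weakGrad, dif_pos hu1]
  exact ae_unique hΩ hu1.2.choose_spec.2 h hu1.2.choose_spec.1 hG

end IsWeakGradient

namespace MemH1

theorem memLp_weakGrad (h : MemH1 Ω u) : MemLp (weakGrad Ω u) 2 (volume.restrict Ω) := by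
  rw [weakGrad, dif_pos h]
  exact h.2.choose_spec.1

theorem isWeakGradient_weakGrad (h : MemH1 Ω u) : IsWeakGradient Ω u (weakGrad Ω u) := by
  rw [weakGrad, dif_pos h]
  exact h.2.choose_spec.2

theorem isWeakGradient_linear_comb (h : MemH1 Ω u) (h' : MemH1 Ω u') (a b : ℝ) :
    IsWeakGradient Ω (fun x => a * u x + b * u' x)
      (fun x => a • weakGrad Ω u x + b • weakGrad Ω u' x) :=
  h.isWeakGradient_weakGrad.linear_comb h'.isWeakGradient_weakGrad h.1 h'.1 h.memLp_weakGrad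
    h'.memLp_weakGrad a b

theorem linear_comb (h : MemH1 Ω u) (h' : MemH1 Ω u') (a b : ℝ) :
    MemH1 Ω (fun x => a * u x + b * u' x) :=
  ⟨(h.1.const_mul a).add (h'.1.const_mul b), _,
    (h.memLp_weakGrad.const_smul a).add (h'.memLp_weakGrad.const_smul b),
    h.isWeakGradient_linear_comb h' a b⟩

theorem weakGrad_linear_comb (hΩ : IsOpen Ω) (h : MemH1 Ω u) (h' : MemH1 Ω u') (a b : ℝ) :
    weakGrad Ω (fun x => a * u x + b * u' x) =ᵐ[volume.restrict Ω]
      fun x => a • weakGrad Ω u x + b • weakGrad Ω u' x :=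
  (h.isWeakGradient_linear_comb h' a b).weakGrad_ae_eq hΩ (h.linear_comb h' a b).1
    ((h.memLp_weakGrad.const_smul a).add (h'.memLp_weakGrad.const_smul b))

end MemH1

end WeakGradient

section Segments

theorem sq_lintegral_le {α : Type*} [MeasurableSpace α] {μ : Measure α} {g : α → ℝ≥0∞}
    (hg : AEMeasurable g μ) : (∫⁻ x, g x ∂μ) ^ 2 ≤ μ univ * ∫⁻ x, g x ^ 2 ∂μ := by
  have hölder := ENNReal.lintegral_mul_le_Lp_mul_Lq μ Real.HolderConjugate.two_two
    aemeasurable_const (f := fun _ => 1) hg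
  have sq_rpow_half (a : ℝ≥0∞) : (a ^ (1 / 2 : ℝ)) ^ 2 = a := by
    rw [← ENNReal.rpow_natCast, ← ENNReal.rpow_mul]
    norm_num
  simp only [Pi.mul_apply, one_mul, ENNReal.rpow_ofNat, one_pow, lintegral_one] at hölder
  calc (∫⁻ x, g x ∂μ) ^ 2
      ≤ (μ univ ^ (1 / 2 : ℝ) * (∫⁻ x, g x ^ 2 ∂μ) ^ (1 / 2 : ℝ)) ^ 2 := by gcongr
    _ = μ univ * ∫⁻ x, g x ^ 2 ∂μ := by rw [mul_pow, sq_rpow_half, sq_rpow_half]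

variable {E : Type*} [NormedAddCommGroup E] [InnerProductSpace ℝ E]

section Gradient

variable [CompleteSpace E] {s : E → ℝ} {n : WithTop ℕ∞}

theorem enorm_add_smul_sub_le_lintegral_gradient (hs : ContDiff ℝ n s) (hn : n ≠ 0) (x w : E)
    {T : ℝ} (hT : 0 ≤ T) :
    ‖s (x + T • w) - s x‖ₑ ≤ ∫⁻ t in Ioc 0 T, ‖gradient s (x + t • w)‖ₑ * ‖w‖ₑ := by
  have hasDerivAt_along_ray (t : ℝ) :
      HasDerivAt (fun t : ℝ => s (x + t • w)) (fderiv ℝ s (x + t • w) w) t := by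
    have hray : HasDerivAt (fun t : ℝ => x + t • w) w t := by
      simpa using ((hasDerivAt_id t).smul_const w).const_add x
    exact ((hs.differentiable hn) _).hasFDerivAt.comp_hasDerivAt t hray
  have hcont : Continuous fun t : ℝ => fderiv ℝ s (x + t • w) w :=
    ((hs.continuous_fderiv hn).comp (by fun_prop)).clm_apply continuous_const
  have ftc := intervalIntegral.integral_eq_sub_of_hasDerivAt
    (fun t _ => hasDerivAt_along_ray t) (hcont.intervalIntegrable 0 T)
  rw [zero_smul, add_zero, intervalIntegral.integral_of_le hT] at ftc
  rw [← ftc]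
  refine (enorm_integral_le_lintegral_enorm _).trans (lintegral_mono fun t => ?_)
  rw [← inner_gradient_left]
  simpa only [enorm, ← ENNReal.coe_mul, ENNReal.coe_le_coe] using
    nnnorm_inner_le_nnnorm (𝕜 := ℝ) (gradient s (x + t • w)) w

theorem enorm_add_smul_sub_sq_le_lintegral_gradient (hs : ContDiff ℝ n s) (hn : n ≠ 0) (x w : E)
    {T : ℝ} (hT : 0 ≤ T) :
    ‖s (x + T • w) - s x‖ₑ ^ 2 ≤
      ENNReal.ofReal T * ‖w‖ₑ ^ 2 * ∫⁻ t in Ioc 0 T, ‖gradient s (x + t • w)‖ₑ ^ 2 := by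
  have hmeas : Measurable fun t : ℝ => ‖gradient s (x + t • w)‖ₑ :=
    ((continuous_gradient_of_contDiff hs hn).comp (by fun_prop)).enorm.measurable
  calc ‖s (x + T • w) - s x‖ₑ ^ 2
      ≤ (∫⁻ t in Ioc 0 T, ‖gradient s (x + t • w)‖ₑ * ‖w‖ₑ) ^ 2 := by
        gcongr
        exact enorm_add_smul_sub_le_lintegral_gradient hs hn x w hT
    _ ≤ volume.restrict (Ioc 0 T) univ *
          ∫⁻ t in Ioc 0 T, (‖gradient s (x + t • w)‖ₑ * ‖w‖ₑ) ^ 2 :=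
        sq_lintegral_le (hmeas.mul_const _).aemeasurable
    _ = ENNReal.ofReal T * ‖w‖ₑ ^ 2 * ∫⁻ t in Ioc 0 T, ‖gradient s (x + t • w)‖ₑ ^ 2 := by
        simp_rw [mul_pow]
        rw [lintegral_mul_const _ (hmeas.pow_const 2), Measure.restrict_apply_univ,
          Real.volume_Ioc, sub_zero]
        ring

end Gradient

variable [FiniteDimensional ℝ E] [MeasurableSpace E] [BorelSpace E] {g : E → ℝ≥0∞}

theorem lintegral_comp_add_smul (hg : Measurable g) (a : E) {t : ℝ} (ht : 0 < t) :
    ∫⁻ y, g (a + t • y) = ENNReal.ofReal (t ^ Module.finrank ℝ E)⁻¹ * ∫⁻ y, g y := by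
  have comp_eq_map : ∫⁻ y, g (a + t • y) = ∫⁻ y, g (a + y) ∂(Measure.map (t • ·) volume) := by
    rw [lintegral_map (by fun_prop) (by fun_prop)]
  rw [comp_eq_map, Measure.map_addHaar_smul _ ht.ne', lintegral_smul_measure,
    lintegral_add_left_eq_self, abs_of_nonneg (by positivity), smul_eq_mul]

theorem lintegral_comp_add_smul_le (hg : Measurable g) (a : E) {t : ℝ} (ht : 1 / 2 ≤ t) :
    ∫⁻ y, g (a + t • y) ≤ 2 ^ Module.finrank ℝ E * ∫⁻ y, g y := by
  rw [lintegral_comp_add_smul hg a (by linarith)]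
  gcongr
  rw [← inv_pow, ENNReal.ofReal_pow (inv_nonneg.2 (by linarith))]
  gcongr
  rw [← ENNReal.ofReal_ofNat 2]
  exact ENNReal.ofReal_le_ofReal (by rw [inv_le_comm₀ (by linarith) two_pos]; linarith)

theorem lintegral_lintegral_comp_segment_le (hg : Measurable g) (X Y : Set E) (t : ℝ) :
    ∫⁻ x in X, ∫⁻ y in Y, g (x + t • (y - x)) ≤
      2 ^ Module.finrank ℝ E * (volume X + volume Y) * ∫⁻ y, g y := by
  have hmeas : Measurable fun q : E × E => g (q.1 + t • (q.2 - q.1)) := hg.comp (by fun_prop)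
  rcases le_total (1 / 2) t with ht | ht
  · calc ∫⁻ x in X, ∫⁻ y in Y, g (x + t • (y - x))
        ≤ ∫⁻ x in X, 2 ^ Module.finrank ℝ E * ∫⁻ y, g y := by
          refine lintegral_mono fun x => (setLIntegral_le_lintegral _ _).trans ?_
          simpa only [smul_sub, add_sub, add_sub_right_comm] using
            lintegral_comp_add_smul_le hg (x - t • x) ht
      _ = 2 ^ Module.finrank ℝ E * volume X * ∫⁻ y, g y := by
          rw [setLIntegral_const]
          ring
      _ ≤ _ := by
          gcongr
          exact le_self_add
  · calc ∫⁻ x in X, ∫⁻ y in Y, g (x + t • (y - x))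
        = ∫⁻ y in Y, ∫⁻ x in X, g (x + t • (y - x)) :=
          lintegral_lintegral_swap hmeas.aemeasurable
      _ ≤ ∫⁻ y in Y, 2 ^ Module.finrank ℝ E * ∫⁻ y, g y := by
          refine lintegral_mono fun y => (setLIntegral_le_lintegral _ _).trans ?_
          have swap_endpoints (x : E) : x + t • (y - x) = t • y + (1 - t) • x := by module
          simp_rw [swap_endpoints]
          exact lintegral_comp_add_smul_le hg (t • y) (by linarith)
      _ = 2 ^ Module.finrank ℝ E * volume Y * ∫⁻ y, g y := by
          rw [setLIntegral_const]
          ring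
      _ ≤ _ := by
          gcongr
          exact le_add_self

theorem lintegral_lintegral_lintegral_segment_le (hg : Measurable g) (X Y : Set E) :
    ∫⁻ x in X, ∫⁻ y in Y, ∫⁻ t in Ioc (0 : ℝ) 1, g (x + t • (y - x)) ≤
      2 ^ Module.finrank ℝ E * (volume X + volume Y) * ∫⁻ y, g y := by
  have hmeas : Measurable fun q : (E × ℝ) × E => g (q.1.1 + q.1.2 • (q.2 - q.1.1)) :=
    hg.comp (by fun_prop)
  calc ∫⁻ x in X, ∫⁻ y in Y, ∫⁻ t in Ioc (0 : ℝ) 1, g (x + t • (y - x))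
      = ∫⁻ x in X, ∫⁻ t in Ioc (0 : ℝ) 1, ∫⁻ y in Y, g (x + t • (y - x)) :=
        lintegral_congr fun x => lintegral_lintegral_swap (hg.comp (by fun_prop)).aemeasurable
    _ = ∫⁻ t in Ioc (0 : ℝ) 1, ∫⁻ x in X, ∫⁻ y in Y, g (x + t • (y - x)) :=
        lintegral_lintegral_swap hmeas.lintegral_prod_right'.aemeasurable
    _ ≤ ∫⁻ _ in Ioc (0 : ℝ) 1, 2 ^ Module.finrank ℝ E * (volume X + volume Y) * ∫⁻ y, g y :=
        lintegral_mono fun t => lintegral_lintegral_comp_segment_le hg X Y t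
    _ = 2 ^ Module.finrank ℝ E * (volume X + volume Y) * ∫⁻ y, g y := by simp

end Segments

section PoincarePair

theorem enorm_sub_sq_le {F : Type*} [SeminormedAddCommGroup F] (a b c : F) :
    ‖a - c‖ₑ ^ 2 ≤ 2 * ‖a - b‖ₑ ^ 2 + 2 * ‖b - c‖ₑ ^ 2 := by
  simp only [enorm]
  norm_cast
  calc ‖a - c‖₊ ^ 2 ≤ (‖a - b‖₊ + ‖b - c‖₊) ^ 2 := by
        gcongr
        simpa only [nndist_eq_nnnorm] using nndist_triangle a b c
    _ ≤ 2 * ‖a - b‖₊ ^ 2 + 2 * ‖b - c‖₊ ^ 2 := by rw [← mul_add]; exact add_sq_le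

theorem mul_lintegral_lintegral_enorm_sub_sq_le {α F : Type*} [MeasurableSpace α]
    [NormedAddCommGroup F] [MeasurableSpace F] [BorelSpace F] [SecondCountableTopology F]
    {s : α → F} (hs : Measurable s)
    (μ ν κ : Measure α) [SFinite μ] [SFinite ν] [SFinite κ] :
    ν univ * ∫⁻ x, ∫⁻ z, ‖s x - s z‖ₑ ^ 2 ∂κ ∂μ ≤
      2 * κ univ * ∫⁻ x, ∫⁻ y, ‖s x - s y‖ₑ ^ 2 ∂ν ∂μ +
        2 * μ univ * ∫⁻ y, ∫⁻ z, ‖s y - s z‖ₑ ^ 2 ∂κ ∂ν := by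
  have hmeas : Measurable fun q : α × α => ‖s q.1 - s q.2‖ₑ ^ 2 := by fun_prop
  have meas_left (y : α) : Measurable fun x => ‖s x - s y‖ₑ ^ 2 := by fun_prop
  have meas_right (y : α) : Measurable fun z => ‖s y - s z‖ₑ ^ 2 := by fun_prop
  calc ν univ * ∫⁻ x, ∫⁻ z, ‖s x - s z‖ₑ ^ 2 ∂κ ∂μ
      = ∫⁻ _, ∫⁻ x, ∫⁻ z, ‖s x - s z‖ₑ ^ 2 ∂κ ∂μ ∂ν := by rw [lintegral_const, mul_comm]
    _ ≤ ∫⁻ y, ∫⁻ x, ∫⁻ z, (2 * ‖s x - s y‖ₑ ^ 2 + 2 * ‖s y - s z‖ₑ ^ 2) ∂κ ∂μ ∂ν :=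
        lintegral_mono fun y => lintegral_mono fun x => lintegral_mono fun z =>
          enorm_sub_sq_le _ _ _
    _ = ∫⁻ y, (2 * κ univ * (∫⁻ x, ‖s x - s y‖ₑ ^ 2 ∂μ) +
          2 * μ univ * ∫⁻ z, ‖s y - s z‖ₑ ^ 2 ∂κ) ∂ν := by
        refine lintegral_congr fun y => ?_
        simp_rw [lintegral_add_left measurable_const, lintegral_const,
          lintegral_const_mul _ (meas_right y)]
        rw [lintegral_add_right _ measurable_const, lintegral_const,
          lintegral_mul_const _ ((meas_left y).const_mul 2), lintegral_const_mul _ (meas_left y)]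
        ring
    _ = 2 * κ univ * (∫⁻ y, ∫⁻ x, ‖s x - s y‖ₑ ^ 2 ∂μ ∂ν) +
          2 * μ univ * ∫⁻ y, ∫⁻ z, ‖s y - s z‖ₑ ^ 2 ∂κ ∂ν := by
        rw [lintegral_add_left (hmeas.lintegral_prod_left'.const_mul _),
          lintegral_const_mul _ hmeas.lintegral_prod_left',
          lintegral_const_mul _ hmeas.lintegral_prod_right']
    _ = _ := by rw [← lintegral_lintegral_swap hmeas.aemeasurable]

theorem restrict_biUnion_finset_le_sum {α ι : Type*} [MeasurableSpace α] {μ : Measure α}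
    (t : Finset ι) (N : ι → Set α) : μ.restrict (⋃ i ∈ t, N i) ≤ ∑ i ∈ t, μ.restrict (N i) := by
  refine (Measure.restrict_biUnion_le t.countable_toSet).trans_eq ?_
  rw [← Measure.sum_coe_finset]
  rfl

variable {E : Type*} [NormedAddCommGroup E] [InnerProductSpace ℝ E] [FiniteDimensional ℝ E]
  [MeasurableSpace E] [BorelSpace E] {Ω : Set E} {μ ν κ μ' ν' : Measure E}

/-- A Poincaré pair for `Ω`: the mean square oscillation of smooth functions between `μ` and `ν` is
controlled by their Dirichlet energy on `Ω`. The measures need not be carried by `Ω`, so this covers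
the Poincaré inequality (`μ = ν` the volume on `Ω`), chains of balls, and trace inequalities (`ν`
a surface measure). -/
def IsPoincarePair (Ω : Set E) (μ ν : Measure E) : Prop :=
  ∃ C ≠ (⊤ : ℝ≥0∞), ∀ s : E → ℝ, ContDiff ℝ ∞ s →
    ∫⁻ x, ∫⁻ y, ‖s x - s y‖ₑ ^ 2 ∂ν ∂μ ≤ C * ∫⁻ x in Ω, ‖gradient s x‖ₑ ^ 2

namespace IsPoincarePair

theorem symm [SFinite μ] [SFinite ν] (h : IsPoincarePair Ω μ ν) : IsPoincarePair Ω ν μ := by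
  obtain ⟨C, hC, hμν⟩ := h
  refine ⟨C, hC, fun s hs => le_trans (le_of_eq ?_) (hμν s hs)⟩
  have hmeas : Measurable fun q : E × E => ‖s q.1 - s q.2‖ₑ ^ 2 := by
    have := hs.continuous.measurable
    fun_prop
  rw [lintegral_lintegral_swap hmeas.aemeasurable]
  exact lintegral_congr fun x => lintegral_congr fun y => by rw [enorm_sub_rev]

theorem mono (h : IsPoincarePair Ω μ ν) (hμ : μ' ≤ μ) (hν : ν' ≤ ν) : IsPoincarePair Ω μ' ν' := by
  obtain ⟨C, hC, hμν⟩ := h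
  exact ⟨C, hC, fun s hs =>
    (lintegral_mono' hμ fun x => lintegral_mono' hν le_rfl).trans (hμν s hs)⟩

theorem trans [IsFiniteMeasure μ] [IsFiniteMeasure ν] [IsFiniteMeasure κ] (hν : ν ≠ 0)
    (hμν : IsPoincarePair Ω μ ν) (hνκ : IsPoincarePair Ω ν κ) : IsPoincarePair Ω μ κ := by
  obtain ⟨C, hC, hμν⟩ := hμν
  obtain ⟨C', hC', hνκ⟩ := hνκ
  have hν0 : ν univ ≠ 0 := Measure.measure_univ_ne_zero.2 hν
  refine ⟨(ν univ)⁻¹ * (2 * κ univ * C + 2 * μ univ * C'), by finiteness, fun s hs => ?_⟩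
  rw [mul_assoc, ← ENNReal.mul_le_iff_le_inv hν0 (by finiteness)]
  calc ν univ * ∫⁻ x, ∫⁻ z, ‖s x - s z‖ₑ ^ 2 ∂κ ∂μ
      ≤ 2 * κ univ * ∫⁻ x, ∫⁻ y, ‖s x - s y‖ₑ ^ 2 ∂ν ∂μ +
          2 * μ univ * ∫⁻ y, ∫⁻ z, ‖s y - s z‖ₑ ^ 2 ∂κ ∂ν :=
        mul_lintegral_lintegral_enorm_sub_sq_le hs.continuous.measurable μ ν κ
    _ ≤ 2 * κ univ * (C * ∫⁻ x in Ω, ‖gradient s x‖ₑ ^ 2) +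
          2 * μ univ * (C' * ∫⁻ x in Ω, ‖gradient s x‖ₑ ^ 2) := by
        gcongr
        exacts [hμν s hs, hνκ s hs]
    _ = _ := by ring

theorem finset_sum_left {ι : Type*} {t : Finset ι} {μ : ι → Measure E}
    (h : ∀ i ∈ t, IsPoincarePair Ω (μ i) ν) : IsPoincarePair Ω (∑ i ∈ t, μ i) ν := by
  choose! C hC hμν using h
  refine ⟨∑ i ∈ t, C i, ENNReal.sum_ne_top.2 hC, fun s hs => ?_⟩
  rw [lintegral_finsetSum_measure, Finset.sum_mul]
  exact Finset.sum_le_sum fun i hi => hμν i hi s hs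

theorem of_openSegment_subset (hΩ : MeasurableSet Ω) {X Y : Set E} (hX : MeasurableSet X)
    (hY : MeasurableSet Y) (hXb : Bornology.IsBounded X) (hYb : Bornology.IsBounded Y)
    (h : ∀ x ∈ X, ∀ y ∈ Y, openSegment ℝ x y ⊆ Ω) :
    IsPoincarePair Ω (volume.restrict X) (volume.restrict Y) := by
  obtain ⟨R, hR⟩ := (hXb.union hYb).exists_norm_le
  have hXfin : volume X ≠ ⊤ := hXb.measure_lt_top.ne
  have hYfin : volume Y ≠ ⊤ := hYb.measure_lt_top.ne
  refine ⟨ENNReal.ofReal (2 * R) ^ 2 * (2 ^ Module.finrank ℝ E * (volume X + volume Y)),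
    by finiteness, fun s hs => ?_⟩
  set g : E → ℝ≥0∞ := Ω.indicator fun x => ‖gradient s x‖ₑ ^ 2 with hg_def
  have hg : Measurable g :=
    ((continuous_gradient_of_contDiff hs (by simp)).enorm.measurable.pow_const 2).indicator hΩ
  have enorm_sub_sq_le_segment : ∀ x ∈ X, ∀ y ∈ Y, ‖s x - s y‖ₑ ^ 2 ≤
      ENNReal.ofReal (2 * R) ^ 2 * ∫⁻ t in Ioc (0 : ℝ) 1, g (x + t • (y - x)) := by
    intro x hx y hy
    have ray := enorm_add_smul_sub_sq_le_lintegral_gradient hs (by simp) x (y - x) zero_le_one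
    rw [one_smul, add_sub_cancel, enorm_sub_rev, ENNReal.ofReal_one, one_mul] at ray
    refine ray.trans (mul_le_mul' ?_ ?_)
    · rw [← ofReal_norm]
      gcongr
      exact (norm_sub_le _ _).trans (by linarith [hR x (Or.inl hx), hR y (Or.inr hy)])
    · rw [← setLIntegral_congr Ioo_ae_eq_Ioc, ← setLIntegral_congr Ioo_ae_eq_Ioc]
      refine setLIntegral_mono' measurableSet_Ioo fun t ht => ?_
      have hmem : x + t • (y - x) ∈ Ω := h x hx y hy (openSegment_eq_image' ℝ x y ▸ ⟨t, ht, rfl⟩)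
      rw [hg_def, indicator_of_mem hmem]
  calc ∫⁻ x in X, ∫⁻ y in Y, ‖s x - s y‖ₑ ^ 2
      ≤ ∫⁻ x in X, ∫⁻ y in Y, ENNReal.ofReal (2 * R) ^ 2 *
          ∫⁻ t in Ioc (0 : ℝ) 1, g (x + t • (y - x)) :=
        setLIntegral_mono' hX fun x hx => setLIntegral_mono' hY (enorm_sub_sq_le_segment x hx)
    _ = ENNReal.ofReal (2 * R) ^ 2 *
          ∫⁻ x in X, ∫⁻ y in Y, ∫⁻ t in Ioc (0 : ℝ) 1, g (x + t • (y - x)) := by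
        simp_rw [lintegral_const_mul' (ENNReal.ofReal (2 * R) ^ 2) _ (by finiteness)]
    _ ≤ ENNReal.ofReal (2 * R) ^ 2 *
          (2 ^ Module.finrank ℝ E * (volume X + volume Y) * ∫⁻ y, g y) := by
        gcongr
        exact lintegral_lintegral_lintegral_segment_le hg X Y
    _ = _ := by rw [hg_def, lintegral_indicator hΩ, ← mul_assoc]

end IsPoincarePair

end PoincarePair

section ConeProperty

theorem add_smul_mem_ball {E : Type*} [SeminormedAddCommGroup E] [NormedSpace ℝ E] {x z w : E}
    {t a b : ℝ} (hz : z ∈ Metric.ball x a) (hw : ‖w‖ ≤ b) (ht : t ∈ Ioc (0 : ℝ) 1) :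
    z + t • w ∈ Metric.ball x (a + b) := by
  rw [mem_ball_iff_norm] at hz ⊢
  calc ‖z + t • w - x‖ = ‖(z - x) + t • w‖ := by congr 1; abel
    _ ≤ ‖z - x‖ + t * ‖w‖ := (norm_add_le _ _).trans_eq (by rw [norm_smul_of_nonneg ht.1.le])
    _ < a + b := add_lt_add_of_lt_of_le hz ((mul_le_of_le_one_left (norm_nonneg w) ht.2).trans hw)

variable {E : Type*} [NormedAddCommGroup E] [InnerProductSpace ℝ E] {Ω : Set E}

theorem norm_sub_inner_smul_le {e : E} (he : ‖e‖ = 1) (v : E) :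
    ‖v - inner ℝ e v • e‖ ≤ ‖v‖ := by
  refine le_of_sq_le_sq ?_ (norm_nonneg v)
  rw [norm_sub_sq_real, inner_smul_right, norm_smul, he, real_inner_comm, mul_one, Real.norm_eq_abs,
    sq_abs]
  nlinarith [sq_nonneg (inner ℝ e v : ℝ)]

theorem graph_le_inner_of_mem_closure {e : E} {γ : E → ℝ} (hγ : Continuous γ) {x : E} {r : ℝ}
    (hr : ∀ y ∈ Metric.ball x r, (y ∈ Ω ↔ γ (y - inner ℝ e y • e) < inner ℝ e y))
    {z : E} (hz : z ∈ closure Ω) (hzr : z ∈ Metric.ball x r) :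
    γ (z - inner ℝ e z • e) ≤ inner ℝ e z := by
  by_contra! hbelow
  have isOpen_below : IsOpen {y : E | inner ℝ e y < γ (y - inner ℝ e y • e)} :=
    isOpen_lt (by fun_prop) (by fun_prop)
  obtain ⟨y, ⟨hy, hyr⟩, hyΩ⟩ :=
    mem_closure_iff.1 hz _ (isOpen_below.inter Metric.isOpen_ball) ⟨hbelow, hzr⟩
  exact ((hr y hyr).1 hyΩ).not_gt hy

theorem graph_lt_inner_add_smul {e : E} {γ : E → ℝ} {L : ℝ≥0} (hγ : LipschitzWith L γ) {z w : E}
    (hz : γ (z - inner ℝ e z • e) ≤ inner ℝ e z)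
    (hw : L * ‖w - inner ℝ e w • e‖ < inner ℝ e w) {t : ℝ} (ht : 0 < t) :
    γ (z + t • w - inner ℝ e (z + t • w) • e) < inner ℝ e (z + t • w) := by
  have hinner : inner ℝ e (z + t • w) = inner ℝ e z + t * inner ℝ e w := by
    rw [inner_add_right, inner_smul_right]
  have hhorizontal : z + t • w - inner ℝ e (z + t • w) • e =
      z - inner ℝ e z • e + t • (w - inner ℝ e w • e) := by
    rw [hinner]
    module
  have hlip := hγ.le_add_mul (z - inner ℝ e z • e + t • (w - inner ℝ e w • e))
    (z - inner ℝ e z • e)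
  rw [dist_self_add_left, norm_smul_of_nonneg ht.le] at hlip
  rw [hhorizontal, hinner]
  nlinarith [mul_lt_mul_of_pos_left hw ht]

/-- The cone property of `Ω` at `x`: one fixed truncated open cone, generated by a ball of
directions, can be translated to all points of `closure Ω` near `x` so that it stays in `Ω`. -/
def HasConePropertyAt (Ω : Set E) (x : E) : Prop :=
  ∃ N ∈ 𝓝 x, ∃ c : E, ∃ ρ > 0,
    ∀ z ∈ N ∩ closure Ω, ∀ w ∈ Metric.ball c ρ, ∀ t ∈ Ioc (0 : ℝ) 1, z + t • w ∈ Ω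

/-- The cone property of `Ω` at all points of its closure. -/
def HasConeProperty (Ω : Set E) : Prop :=
  ∀ x ∈ closure Ω, HasConePropertyAt Ω x

theorem hasConePropertyAt_of_mem_of_isOpen (hΩ : IsOpen Ω) {x : E} (hx : x ∈ Ω) :
    HasConePropertyAt Ω x := by
  obtain ⟨r, hr, hball⟩ := Metric.isOpen_iff.1 hΩ x hx
  refine ⟨Metric.ball x (r / 2), Metric.ball_mem_nhds _ (half_pos hr), 0, r / 2, half_pos hr,
    fun z hz w hw t ht => hball ?_⟩
  simpa only [add_halves] using add_smul_mem_ball hz.1 (mem_ball_zero_iff.1 hw).le ht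

theorem hasConePropertyAt_of_graph {e : E} (he : ‖e‖ = 1) {γ : E → ℝ} {L : ℝ≥0}
    (hγ : LipschitzWith L γ) {x : E} {r : ℝ} (hr : 0 < r)
    (hgraph : ∀ y ∈ Metric.ball x r, (y ∈ Ω ↔ γ (y - inner ℝ e y • e) < inner ℝ e y)) :
    HasConePropertyAt Ω x := by
  set ρ : ℝ := r / 4 / (L + 1) with hρ_def
  have hρ : 0 < ρ := by positivity
  have hLρ : (L + 1) * ρ = r / 4 := by rw [hρ_def]; field_simp
  have hρr : ρ ≤ r / 4 := by nlinarith [L.2]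
  refine ⟨Metric.ball x (r / 2), Metric.ball_mem_nhds _ (half_pos hr), (r / 4) • e, ρ, hρ,
    fun z hz w hw t ht => ?_⟩
  obtain ⟨v, rfl⟩ : ∃ v, w = (r / 4) • e + v := ⟨w - (r / 4) • e, by abel⟩
  have hv : ‖v‖ < ρ := by simpa using hw
  have hw_inner : inner ℝ e ((r / 4) • e + v) = r / 4 + inner ℝ e v := by
    rw [inner_add_right, inner_smul_right, real_inner_self_eq_norm_sq, he, one_pow, mul_one]
  have hw_norm : ‖(r / 4) • e + v‖ ≤ r / 2 := by
    refine (norm_add_le _ _).trans ?_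
    rw [norm_smul_of_nonneg (by positivity), he]
    linarith
  have hw_cone : L * ‖(r / 4) • e + v - inner ℝ e ((r / 4) • e + v) • e‖ <
      inner ℝ e ((r / 4) • e + v) := by
    have hhorizontal : (r / 4) • e + v - inner ℝ e ((r / 4) • e + v) • e = v - inner ℝ e v • e := by
      rw [hw_inner]
      module
    have hv_inner : -‖v‖ ≤ inner ℝ e v := by
      simpa [he] using neg_le_of_abs_le (abs_real_inner_le_norm e v)
    have hLv : (L : ℝ) * ‖v - inner ℝ e v • e‖ ≤ L * ρ := by
      gcongr
      exact (norm_sub_inner_smul_le he v).trans hv.le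
    rw [hhorizontal, hw_inner]
    linarith
  have hmem := add_smul_mem_ball hz.1 hw_norm ht
  rw [add_halves] at hmem
  have hzr : z ∈ Metric.ball x r := Metric.ball_subset_ball (by linarith) hz.1
  exact (hgraph _ hmem).2 (graph_lt_inner_add_smul hγ
    (graph_le_inner_of_mem_closure hγ.continuous hgraph hz.2 hzr) hw_cone ht.1)

theorem IsBoundedLipschitzDomain.hasConeProperty {d : ℕ} {Ω : Set (EuclideanSpace ℝ (Fin d))}
    (hΩ : IsBoundedLipschitzDomain Ω) : HasConeProperty Ω := by
  intro x hx
  by_cases hxΩ : x ∈ Ω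
  · exact hasConePropertyAt_of_mem_of_isOpen hΩ.isOpen hxΩ
  · have hfrontier : x ∈ frontier Ω := hΩ.isOpen.frontier_eq ▸ ⟨hx, hxΩ⟩
    obtain ⟨e, he, L, γ, hγ, r, hr, hgraph⟩ := hΩ.lipschitz x hfrontier
    exact hasConePropertyAt_of_graph he hγ hr hgraph

end ConeProperty

section PoincareInequality

variable {E : Type*} [NormedAddCommGroup E] [InnerProductSpace ℝ E] [FiniteDimensional ℝ E]
  [MeasurableSpace E] [BorelSpace E] {Ω : Set E}

theorem isPoincarePair_ball_of_subset (hΩ : MeasurableSet Ω) {x y : E} {r ρ : ℝ}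
    (hr : Metric.ball x r ⊆ Ω) (hρ : Metric.ball y ρ ⊆ Metric.ball x r) :
    IsPoincarePair Ω (volume.restrict (Metric.ball x r)) (volume.restrict (Metric.ball y ρ)) :=
  .of_openSegment_subset hΩ measurableSet_ball measurableSet_ball Metric.isBounded_ball
    Metric.isBounded_ball fun _ ha _ hb =>
      ((convex_ball x r).openSegment_subset ha (hρ hb)).trans hr

theorem volume_restrict_ball_ne_zero (x : E) {r : ℝ} (hr : 0 < r) :
    volume.restrict (Metric.ball x r) ≠ 0 :=
  Measure.restrict_eq_zero.not.2 (Metric.measure_ball_pos volume x hr).ne'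

theorem isFiniteMeasure_restrict_of_isBounded (hΩ : Bornology.IsBounded Ω) :
    IsFiniteMeasure (volume.restrict Ω) :=
  isFiniteMeasure_restrict.2 hΩ.measure_lt_top.ne

theorem isPoincarePair_ball_ball (hΩ : IsOpen Ω) (hconn : IsPreconnected Ω) {x₀ x : E} {r₀ r : ℝ}
    (hr₀ : 0 < r₀) (hr : 0 < r) (hball₀ : Metric.ball x₀ r₀ ⊆ Ω) (hball : Metric.ball x r ⊆ Ω) :
    IsPoincarePair Ω (volume.restrict (Metric.ball x r))
      (volume.restrict (Metric.ball x₀ r₀)) := by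
  have hfin (y : E) (ρ : ℝ) : IsFiniteMeasure (volume.restrict (Metric.ball y ρ)) :=
    isFiniteMeasure_restrict_of_isBounded Metric.isBounded_ball
  set A : Set E := {y | ∃ ρ > 0, Metric.ball y ρ ⊆ Ω ∧
    IsPoincarePair Ω (volume.restrict (Metric.ball y ρ)) (volume.restrict (Metric.ball x₀ r₀))}
  have ball_of_mem_closure : ∀ y ∈ closure A, ∀ ρ > 0, Metric.ball y ρ ⊆ Ω →
      IsPoincarePair Ω (volume.restrict (Metric.ball y ρ))
        (volume.restrict (Metric.ball x₀ r₀)) := by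
    intro y hy ρ hρ hyρ
    obtain ⟨z, hz, δ, hδ, -, hpair⟩ :=
      mem_closure_iff.1 hy _ Metric.isOpen_ball (Metric.mem_ball_self hρ)
    obtain ⟨δ', hδ', hzδ'⟩ := Metric.isOpen_iff.1 Metric.isOpen_ball z hz
    have hsub : Metric.ball z (min δ δ') ⊆ Metric.ball y ρ :=
      (Metric.ball_subset_ball (min_le_right _ _)).trans hzδ'
    exact (isPoincarePair_ball_of_subset hΩ.measurableSet hyρ hsub).trans
      (volume_restrict_ball_ne_zero z (lt_min hδ hδ'))
      (hpair.mono (Measure.restrict_mono (Metric.ball_subset_ball (min_le_left _ _)) le_rfl) le_rfl)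
  have isOpen_A : IsOpen A := by
    refine Metric.isOpen_iff.2 fun y ⟨ρ, hρ, hyρ, hpair⟩ => ⟨ρ, hρ, fun z hz => ?_⟩
    obtain ⟨δ, hδ, hzδ⟩ := Metric.isOpen_iff.1 Metric.isOpen_ball z hz
    exact ⟨δ, hδ, hzδ.trans hyρ, hpair.mono (Measure.restrict_mono hzδ le_rfl) le_rfl⟩
  have mem_A : x₀ ∈ A :=
    ⟨r₀, hr₀, hball₀, isPoincarePair_ball_of_subset hΩ.measurableSet hball₀ le_rfl⟩
  have subset_A : Ω ⊆ A := by
    refine hconn.subset_of_closure_inter_subset isOpen_A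
      ⟨x₀, hball₀ (Metric.mem_ball_self hr₀), mem_A⟩ ?_
    rintro y ⟨hy, hyΩ⟩
    obtain ⟨ρ, hρ, hyρ⟩ := Metric.isOpen_iff.1 hΩ y hyΩ
    exact ⟨ρ, hρ, hyρ, ball_of_mem_closure y hy ρ hρ hyρ⟩
  exact ball_of_mem_closure x (subset_closure (subset_A (hball (Metric.mem_ball_self hr)))) r hr
    hball

theorem HasConeProperty.exists_mem_nhds_isPoincarePair_ball (hcone : HasConeProperty Ω)
    (hΩ : IsOpen Ω) (hΩb : Bornology.IsBounded Ω) {x : E} (hx : x ∈ closure Ω) :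
    ∃ N ∈ 𝓝 x, ∃ y, ∃ ρ > 0, Metric.ball y ρ ⊆ Ω ∧
      IsPoincarePair Ω (volume.restrict (N ∩ Ω)) (volume.restrict (Metric.ball y ρ)) := by
  obtain ⟨N, hN, c, ρ, hρ, hcone⟩ := hcone x hx
  obtain ⟨δ, hδ, hδN⟩ := Metric.mem_nhds_iff.1 hN
  set η := min δ (ρ / 2)
  have hη : 0 < η := lt_min hδ (half_pos hρ)
  have segment_mem : ∀ z ∈ Metric.ball x η ∩ closure Ω, ∀ y ∈ Metric.ball (x + c) (ρ / 2),
      ∀ t ∈ Ioc (0 : ℝ) 1, z + t • (y - z) ∈ Ω := by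
    intro z hz y hy t ht
    refine hcone z ⟨hδN (Metric.ball_subset_ball (min_le_left _ _) hz.1), hz.2⟩ _ ?_ t ht
    have hzx : ‖z - x‖ < ρ / 2 :=
      mem_ball_iff_norm.1 (Metric.ball_subset_ball (min_le_right _ _) hz.1)
    have hyx : ‖y - (x + c)‖ < ρ / 2 := mem_ball_iff_norm.1 hy
    rw [mem_ball_iff_norm]
    calc ‖y - z - c‖ = ‖(y - (x + c)) - (z - x)‖ := by congr 1; abel
      _ ≤ ‖y - (x + c)‖ + ‖z - x‖ := norm_sub_le _ _
      _ < ρ := by linarith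
  refine ⟨Metric.ball x η, Metric.ball_mem_nhds _ hη, x + c, ρ / 2, half_pos hρ, fun y hy => ?_,
    .of_openSegment_subset hΩ.measurableSet (measurableSet_ball.inter hΩ.measurableSet)
      measurableSet_ball (hΩb.subset inter_subset_right) Metric.isBounded_ball ?_⟩
  · simpa using segment_mem x ⟨Metric.mem_ball_self hη, hx⟩ y hy 1 ⟨one_pos, le_rfl⟩
  · intro z hz y hy
    rw [openSegment_eq_image']
    rintro _ ⟨t, ht, rfl⟩
    exact segment_mem z ⟨hz.1, subset_closure hz.2⟩ y hy t ⟨ht.1, ht.2.le⟩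

theorem HasConeProperty.isPoincarePair (hcone : HasConeProperty Ω) (hΩ : IsOpen Ω)
    (hconn : IsConnected Ω) (hΩb : Bornology.IsBounded Ω) :
    IsPoincarePair Ω (volume.restrict Ω) (volume.restrict Ω) := by
  have hfin {X : Set E} (hX : Bornology.IsBounded X) : IsFiniteMeasure (volume.restrict X) :=
    isFiniteMeasure_restrict_of_isBounded hX
  have := hfin hΩb
  have (x : E) (r : ℝ) := hfin (Metric.isBounded_ball (x := x) (r := r))
  obtain ⟨x₀, hx₀⟩ := hconn.nonempty
  obtain ⟨r₀, hr₀, hball₀⟩ := Metric.isOpen_iff.1 hΩ x₀ hx₀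
  have pair_near : ∀ x ∈ closure Ω, ∃ N ∈ 𝓝 x,
      IsPoincarePair Ω (volume.restrict (N ∩ Ω)) (volume.restrict (Metric.ball x₀ r₀)) := by
    intro x hx
    obtain ⟨N, hN, y, ρ, hρ, hball, hpair⟩ :=
      hcone.exists_mem_nhds_isPoincarePair_ball hΩ hΩb hx
    have := hfin (hΩb.subset (inter_subset_right (s := N)))
    exact ⟨N, hN, hpair.trans (volume_restrict_ball_ne_zero y hρ)
      (isPoincarePair_ball_ball hΩ hconn.isPreconnected hr₀ hρ hball₀ hball)⟩
  choose! N hN hpair using pair_near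
  obtain ⟨t, ht, hcover⟩ := hΩb.isCompact_closure.elim_nhds_subcover N hN
  have volume_le : volume.restrict Ω ≤ ∑ x ∈ t, volume.restrict (N x ∩ Ω) := by
    refine (Measure.restrict_mono (fun y hy => ?_) le_rfl).trans
      (restrict_biUnion_finset_le_sum t fun x => N x ∩ Ω)
    obtain ⟨x, hx, hyx⟩ := mem_iUnion₂.1 (hcover (subset_closure hy))
    exact mem_iUnion₂.2 ⟨x, hx, hyx, hy⟩
  have pair_ball : IsPoincarePair Ω (volume.restrict Ω) (volume.restrict (Metric.ball x₀ r₀)) :=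
    (IsPoincarePair.finset_sum_left fun x hx => hpair x (ht x hx)).mono volume_le le_rfl
  exact pair_ball.trans (volume_restrict_ball_ne_zero x₀ hr₀) pair_ball.symm

end PoincareInequality

section LipschitzGraph

open scoped MeasureTheory.Measure

variable {E : Type*} [NormedAddCommGroup E] [InnerProductSpace ℝ E] {e : E} {γ : E → ℝ} {L : ℝ≥0}

theorem inner_coe_orthogonal_span (p : (ℝ ∙ e)ᗮ) : inner ℝ e (p : E) = 0 :=
  Submodule.mem_orthogonal_singleton_iff_inner_right.1 p.2

theorem sub_inner_smul_mem_orthogonal_span (he : ‖e‖ = 1) (y : E) :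
    y - inner ℝ e y • e ∈ (ℝ ∙ e)ᗮ := by
  rw [Submodule.mem_orthogonal_singleton_iff_inner_right, inner_sub_right, inner_smul_right,
    real_inner_self_eq_norm_sq, he, one_pow, mul_one, sub_self]

/-- The parametrization of the graph of `γ` over the hyperplane normal to `e`. -/
def graphMap (e : E) (γ : E → ℝ) (p : (ℝ ∙ e)ᗮ) : E :=
  p + γ p • e

theorem lipschitzWith_graphMap (he : ‖e‖ = 1) (hγ : LipschitzWith L γ) :
    LipschitzWith (1 + L) (graphMap e γ) := by
  have hcoe : LipschitzWith 1 ((↑) : (ℝ ∙ e)ᗮ → E) := .subtype_val _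
  have hsmul : LipschitzWith 1 fun a : ℝ => a • e :=
    .of_dist_le_mul fun a b => by simp [dist_eq_norm, ← sub_smul, norm_smul, he]
  have hsum := hcoe.add (hsmul.comp (hγ.comp hcoe))
  rw [one_mul, mul_one] at hsum
  exact hsum

theorem norm_le_norm_graphMap (p : (ℝ ∙ e)ᗮ) : ‖p‖ ≤ ‖graphMap e γ p‖ := by
  refine le_of_sq_le_sq ?_ (norm_nonneg _)
  rw [graphMap, norm_add_sq_real, inner_smul_right, real_inner_comm, inner_coe_orthogonal_span,
    Submodule.coe_norm]
  nlinarith [sq_nonneg ‖γ p • e‖]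

theorem exists_graphMap_eq (he : ‖e‖ = 1) {y : E} (hy : γ (y - inner ℝ e y • e) = inner ℝ e y) :
    ∃ p, graphMap e γ p = y :=
  ⟨⟨_, sub_inner_smul_mem_orthogonal_span he y⟩, by simp [graphMap, hy]⟩

theorem finrank_sub_one_eq_finrank_orthogonal_span [FiniteDimensional ℝ E]
    (he : ‖e‖ = 1) :
    (Module.finrank ℝ E : ℝ) - 1 = Module.finrank ℝ (ℝ ∙ e)ᗮ := by
  have he0 : e ≠ 0 := fun h => by simp [h] at he
  rw [← Submodule.finrank_add_finrank_orthogonal (ℝ ∙ e), finrank_span_singleton he0, Nat.cast_add,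
    Nat.cast_one, add_sub_cancel_left]

variable [MeasurableSpace E] [BorelSpace E]

theorem hausdorffMeasure_le_mul_preimage_graphMap (he : ‖e‖ = 1) (hγ : LipschitzWith L γ)
    {s : ℝ} (hs : 0 ≤ s) {A : Set E} (hA : ∀ y ∈ A, γ (y - inner ℝ e y • e) = inner ℝ e y) :
    μH[s] A ≤ ((1 + L : ℝ≥0) : ℝ≥0∞) ^ s * μH[s] (graphMap e γ ⁻¹' A) := by
  have hsubset : A ⊆ graphMap e γ '' (graphMap e γ ⁻¹' A) := by
    intro y hy
    obtain ⟨p, rfl⟩ := exists_graphMap_eq he (hA y hy)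
    exact mem_image_of_mem _ hy
  exact (measure_mono hsubset).trans ((lipschitzWith_graphMap he hγ).hausdorffMeasure_image_le hs _)

variable [FiniteDimensional ℝ E]

theorem isAddHaarMeasure_hausdorffMeasure_orthogonal_span (he : ‖e‖ = 1) :
    (μH[(Module.finrank ℝ E : ℝ) - 1] : Measure (ℝ ∙ e)ᗮ).IsAddHaarMeasure := by
  rw [finrank_sub_one_eq_finrank_orthogonal_span he]
  exact isAddHaarMeasure_hausdorffMeasure

theorem exists_map_hausdorffMeasure_prod_eq_smul_volume (he : ‖e‖ = 1) :
    ∃ c : ℝ≥0, Measure.map (fun q : (ℝ ∙ e)ᗮ × ℝ => (q.1 : E) + q.2 • e)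
      (μH[(Module.finrank ℝ E : ℝ) - 1].prod volume) = c • volume := by
  have := isAddHaarMeasure_hausdorffMeasure_orthogonal_span he
  have he0 : e ≠ 0 := fun h => by simp [h] at he
  let Φ : ((ℝ ∙ e)ᗮ × ℝ) ≃L[ℝ] E :=
    ((LinearEquiv.prodCongr (.refl ℝ _) (LinearEquiv.toSpanNonzeroSingleton ℝ E e he0)).trans
      (Submodule.prodEquivOfIsCompl _ _
        (Submodule.isCompl_orthogonal (ℝ ∙ e)).symm)
      ).toContinuousLinearEquiv
  have hΦ : ⇑Φ = fun q : (ℝ ∙ e)ᗮ × ℝ => (q.1 : E) + q.2 • e := by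
    ext q
    simp [Φ]
  rw [← hΦ]
  have := Φ.isAddHaarMeasure_map (μH[(Module.finrank ℝ E : ℝ) - 1].prod volume)
  exact ⟨_, Measure.isAddLeftInvariant_eq_smul _ volume⟩

theorem hausdorffMeasure_graph_lt_top (he : ‖e‖ = 1) (hγ : LipschitzWith L γ)
    {A : Set E} (hAb : Bornology.IsBounded A)
    (hA : ∀ y ∈ A, γ (y - inner ℝ e y • e) = inner ℝ e y) :
    μH[(Module.finrank ℝ E : ℝ) - 1] A < ⊤ := by
  have := isAddHaarMeasure_hausdorffMeasure_orthogonal_span he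
  have hpos : (0 : ℝ) ≤ Module.finrank ℝ E - 1 := by
    rw [finrank_sub_one_eq_finrank_orthogonal_span he]
    positivity
  obtain ⟨R, hR⟩ := hAb.exists_norm_le
  have preimage_subset : graphMap e γ ⁻¹' A ⊆ Metric.closedBall 0 R := fun p hp =>
    mem_closedBall_zero_iff.2 ((norm_le_norm_graphMap p).trans (hR _ hp))
  refine (hausdorffMeasure_le_mul_preimage_graphMap he hγ hpos hA).trans_lt
    (ENNReal.mul_lt_top (by finiteness) ?_)
  exact (measure_mono preimage_subset).trans_lt (isCompact_closedBall _ _).measure_lt_top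

theorem exists_lintegral_graph_le_mul_lintegral (he : ‖e‖ = 1) (hγ : LipschitzWith L γ)
    {A : Set E} (hA : ∀ y ∈ A, γ (y - inner ℝ e y • e) = inner ℝ e y) :
    ∃ C ≠ (⊤ : ℝ≥0∞), ∀ g : E → ℝ≥0∞, Measurable g →
      ∫⁻ y in A, ∫⁻ t : ℝ, g (y + t • e) ∂volume ∂μH[(Module.finrank ℝ E : ℝ) - 1] ≤
        C * ∫⁻ y, g y := by
  have := isAddHaarMeasure_hausdorffMeasure_orthogonal_span he
  have hpos : (0 : ℝ) ≤ Module.finrank ℝ E - 1 := by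
    rw [finrank_sub_one_eq_finrank_orthogonal_span he]
    positivity
  obtain ⟨c, hc⟩ := exists_map_hausdorffMeasure_prod_eq_smul_volume he
  set m : Measure (ℝ ∙ e)ᗮ := μH[(Module.finrank ℝ E : ℝ) - 1]
  set K : ℝ≥0∞ := ((1 + L : ℝ≥0) : ℝ≥0∞) ^ ((Module.finrank ℝ E : ℝ) - 1)
  have hgraphMap : Measurable (graphMap e γ) := (lipschitzWith_graphMap he hγ).continuous.measurable
  have restrict_le : μH[(Module.finrank ℝ E : ℝ) - 1].restrict A ≤ K • m.map (graphMap e γ) := by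
    refine Measure.le_iff.2 fun B hB => ?_
    rw [Measure.restrict_apply hB, Measure.smul_apply, Measure.map_apply hgraphMap hB]
    refine (hausdorffMeasure_le_mul_preimage_graphMap he hγ hpos fun y hy => hA y hy.2).trans ?_
    rw [smul_eq_mul]
    gcongr
    exact inter_subset_left
  refine ⟨K * c, by finiteness, fun g hg => ?_⟩
  have hmeas : Measurable fun q : E × ℝ => g (q.1 + q.2 • e) := hg.comp (by fun_prop)
  calc ∫⁻ y in A, ∫⁻ t : ℝ, g (y + t • e) ∂volume ∂μH[(Module.finrank ℝ E : ℝ) - 1]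
      ≤ ∫⁻ y, ∫⁻ t : ℝ, g (y + t • e) ∂volume ∂(K • m.map (graphMap e γ)) :=
        lintegral_mono' restrict_le le_rfl
    _ = K * ∫⁻ p, ∫⁻ t : ℝ, g (graphMap e γ p + t • e) ∂volume ∂m := by
        rw [lintegral_smul_measure, lintegral_map hmeas.lintegral_prod_right' hgraphMap,
          smul_eq_mul]
    _ = K * ∫⁻ p : (ℝ ∙ e)ᗮ, ∫⁻ t : ℝ, g (p + t • e) ∂volume ∂m := by
        congr! 3 with p
        rw [← lintegral_add_left_eq_self (fun t : ℝ => g (p + t • e)) (γ p)]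
        simp only [graphMap, add_smul, add_assoc]
    _ = K * ∫⁻ q : (ℝ ∙ e)ᗮ × ℝ, g (q.1 + q.2 • e) ∂(m.prod volume) := by
        rw [lintegral_prod _ (by fun_prop)]
    _ = K * ∫⁻ y, g y ∂(c • volume) := by rw [← hc, lintegral_map hg (by fun_prop)]
    _ = K * c * ∫⁻ y, g y := by
        rw [lintegral_smul_measure, mul_assoc, ENNReal.smul_def, smul_eq_mul]

end LipschitzGraph

section Trace

variable {E : Type*} [NormedAddCommGroup E] [InnerProductSpace ℝ E] [FiniteDimensional ℝ E]
  [MeasurableSpace E] [BorelSpace E] {Ω : Set E} {μ ν κ : Measure E}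

theorem ofReal_mul_lintegral_enorm_sub_sq_le {s : E → ℝ} {n : WithTop ℕ∞} (hs : ContDiff ℝ n s)
    (hn : n ≠ 0) (κ : Measure E) [SFinite κ] (y e : E) (h : ℝ) :
    ENNReal.ofReal h * ∫⁻ x, ‖s y - s x‖ₑ ^ 2 ∂κ ≤
      2 * κ univ * (ENNReal.ofReal h ^ 2 * ‖e‖ₑ ^ 2 *
          ∫⁻ t in Ioc 0 h, ‖gradient s (y + t • e)‖ₑ ^ 2) +
        2 * ∫⁻ t in Ioc 0 h, ∫⁻ x, ‖s (y + t • e) - s x‖ₑ ^ 2 ∂κ := by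
  have hs_meas : Measurable s := hs.continuous.measurable
  have hmeas : Measurable fun q : E × E => ‖s q.1 - s q.2‖ₑ ^ 2 := by fun_prop
  have hray : Measurable fun t : ℝ => y + t • e := by fun_prop
  have triangle := mul_lintegral_lintegral_enorm_sub_sq_le hs_meas (Measure.dirac y)
    ((volume.restrict (Ioc 0 h)).map fun t => y + t • e) κ
  rw [lintegral_dirac, lintegral_dirac, lintegral_map hmeas.lintegral_prod_right' hray,
    lintegral_map (by fun_prop) hray, Measure.map_apply hray .univ, preimage_univ,
    Measure.restrict_apply_univ, Real.volume_Ioc, sub_zero, Measure.dirac_apply_of_mem (mem_univ y),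
    mul_one] at triangle
  refine triangle.trans ?_
  gcongr
  calc ∫⁻ t in Ioc 0 h, ‖s y - s (y + t • e)‖ₑ ^ 2
      ≤ ∫⁻ _ in Ioc 0 h, ENNReal.ofReal h * ‖e‖ₑ ^ 2 *
          ∫⁻ τ in Ioc 0 h, ‖gradient s (y + τ • e)‖ₑ ^ 2 := by
        refine setLIntegral_mono' measurableSet_Ioc fun t ht => ?_
        rw [enorm_sub_rev]
        refine (enorm_add_smul_sub_sq_le_lintegral_gradient hs hn y e ht.1.le).trans ?_
        gcongr
        exacts [ht.2, ht.2]
    _ = _ := by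
        rw [setLIntegral_const, Real.volume_Ioc, sub_zero]
        ring

theorem lintegral_lintegral_shift_le (hΩ : MeasurableSet Ω) {e : E} {T : Set ℝ}
    (hT : MeasurableSet T) (hshift : ∀ᵐ y ∂μ, ∀ t ∈ T, y + t • e ∈ Ω) {C : ℝ≥0∞}
    (hμ : ∀ g : E → ℝ≥0∞, Measurable g →
      ∫⁻ y, ∫⁻ t : ℝ, g (y + t • e) ∂volume ∂μ ≤ C * ∫⁻ y, g y)
    {g : E → ℝ≥0∞} (hg : Measurable g) :
    ∫⁻ y, ∫⁻ t in T, g (y + t • e) ∂volume ∂μ ≤ C * ∫⁻ y in Ω, g y := by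
  rw [← lintegral_indicator hΩ]
  refine (lintegral_mono_ae (hshift.mono fun y hy => ?_)).trans (hμ _ (hg.indicator hΩ))
  exact (setLIntegral_mono' hT fun t ht => (indicator_of_mem (hy t ht) g).ge).trans
    (setLIntegral_le_lintegral _ _)

theorem IsPoincarePair.of_shift (hΩ : MeasurableSet Ω) [IsFiniteMeasure κ]
    (hκ : IsPoincarePair Ω (volume.restrict Ω) κ) {e : E} {h : ℝ} (hh : 0 < h)
    (hshift : ∀ᵐ y ∂μ, ∀ t ∈ Ioc 0 h, y + t • e ∈ Ω) {C : ℝ≥0∞} (hC : C ≠ ⊤)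
    (hμ : ∀ g : E → ℝ≥0∞, Measurable g →
      ∫⁻ y, ∫⁻ t : ℝ, g (y + t • e) ∂volume ∂μ ≤ C * ∫⁻ y, g y) :
    IsPoincarePair Ω μ κ := by
  obtain ⟨P, hP, hκ⟩ := hκ
  set r := ENNReal.ofReal h
  have hr : r ≠ 0 := (ENNReal.ofReal_pos.2 hh).ne'
  refine ⟨r⁻¹ * (2 * κ univ * (r ^ 2 * ‖e‖ₑ ^ 2 * C) + 2 * (C * P)), by finiteness,
    fun s hs => ?_⟩
  have hs_meas : Measurable s := hs.continuous.measurable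
  have shift_le {g : E → ℝ≥0∞} (hg : Measurable g) :=
    lintegral_lintegral_shift_le hΩ measurableSet_Ioc hshift hμ hg
  have measurable_shift {g : E → ℝ≥0∞} (hg : Measurable g) :
      Measurable fun y => ∫⁻ t in Ioc 0 h, g (y + t • e) :=
    (hg.comp (by fun_prop : Measurable fun q : E × ℝ => q.1 + q.2 • e)).lintegral_prod_right'
  set D : E → ℝ≥0∞ := fun y => ‖gradient s y‖ₑ ^ 2
  set H : E → ℝ≥0∞ := fun y => ∫⁻ x, ‖s y - s x‖ₑ ^ 2 ∂κ
  have hD : Measurable D :=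
    (continuous_gradient_of_contDiff hs (by simp)).enorm.measurable.pow_const 2
  have hH : Measurable H :=
    (by fun_prop : Measurable fun q : E × E => ‖s q.1 - s q.2‖ₑ ^ 2).lintegral_prod_right'
  rw [mul_assoc, ← ENNReal.mul_le_iff_le_inv hr ENNReal.ofReal_ne_top]
  calc r * ∫⁻ y, H y ∂μ = ∫⁻ y, r * H y ∂μ := (lintegral_const_mul _ hH).symm
    _ ≤ ∫⁻ y, (2 * κ univ * (r ^ 2 * ‖e‖ₑ ^ 2 * ∫⁻ t in Ioc 0 h, D (y + t • e)) +
          2 * ∫⁻ t in Ioc 0 h, H (y + t • e)) ∂μ := lintegral_mono fun y =>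
        ofReal_mul_lintegral_enorm_sub_sq_le hs (by simp) κ y e h
    _ = 2 * κ univ * (r ^ 2 * ‖e‖ₑ ^ 2 * ∫⁻ y, ∫⁻ t in Ioc 0 h, D (y + t • e) ∂volume ∂μ) +
          2 * ∫⁻ y, ∫⁻ t in Ioc 0 h, H (y + t • e) ∂volume ∂μ := by
        have hD_shift := measurable_shift hD
        rw [lintegral_add_left (by fun_prop), lintegral_const_mul _ (by fun_prop),
          lintegral_const_mul _ hD_shift, lintegral_const_mul _ (measurable_shift hH)]
    _ ≤ 2 * κ univ * (r ^ 2 * ‖e‖ₑ ^ 2 * (C * ∫⁻ y in Ω, D y)) +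
          2 * (C * (P * ∫⁻ y in Ω, D y)) := by
        gcongr
        exacts [shift_le hD, (shift_le hH).trans (by gcongr; exact hκ s hs)]
    _ = _ := by ring

theorem IsPoincarePair.exists_lintegral_enorm_sq_le [IsFiniteMeasure μ] [IsFiniteMeasure ν]
    (hμ : μ ≠ 0) (hμν : IsPoincarePair Ω μ ν) :
    ∃ C ≠ (⊤ : ℝ≥0∞), ∀ s : E → ℝ, ContDiff ℝ ∞ s →
      ∫⁻ x, ‖s x‖ₑ ^ 2 ∂ν ≤
        C * ((∫⁻ x in Ω, ‖gradient s x‖ₑ ^ 2) + ∫⁻ x, ‖s x‖ₑ ^ 2 ∂μ) := by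
  obtain ⟨P, hP, hμν⟩ := hμν
  refine ⟨(μ univ)⁻¹ * (2 * P + 2 * ν univ), by
    have := Measure.measure_univ_ne_zero.2 hμ; finiteness, fun s hs => ?_⟩
  have hs_meas : Measurable s := hs.continuous.measurable
  set D := ∫⁻ x in Ω, ‖gradient s x‖ₑ ^ 2
  set B := ∫⁻ x, ‖s x‖ₑ ^ 2 ∂μ
  have enorm_sq_le (x y : E) : ‖s x‖ₑ ^ 2 ≤ 2 * ‖s y - s x‖ₑ ^ 2 + 2 * ‖s y‖ₑ ^ 2 := by
    simpa [enorm_sub_rev] using enorm_sub_sq_le (s x) (s y) 0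
  rw [mul_assoc, ← ENNReal.mul_le_iff_le_inv (Measure.measure_univ_ne_zero.2 hμ) (by finiteness)]
  calc μ univ * ∫⁻ x, ‖s x‖ₑ ^ 2 ∂ν
      = ∫⁻ _, ∫⁻ x, ‖s x‖ₑ ^ 2 ∂ν ∂μ := by rw [lintegral_const, mul_comm]
    _ ≤ ∫⁻ y, ∫⁻ x, (2 * ‖s y - s x‖ₑ ^ 2 + 2 * ‖s y‖ₑ ^ 2) ∂ν ∂μ :=
        lintegral_mono fun y => lintegral_mono fun x => enorm_sq_le x y
    _ = 2 * (∫⁻ y, ∫⁻ x, ‖s y - s x‖ₑ ^ 2 ∂ν ∂μ) + 2 * ν univ * B := by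
        have hsub (y : E) : Measurable fun x => ‖s y - s x‖ₑ ^ 2 := by fun_prop
        simp_rw [lintegral_add_right _ measurable_const, lintegral_const,
          lintegral_const_mul _ (hsub _)]
        rw [lintegral_add_right _ (by fun_prop), lintegral_const_mul' _ _ (by simp),
          lintegral_mul_const _ (by fun_prop), lintegral_const_mul _ (by fun_prop)]
        ring
    _ ≤ 2 * (P * (D + B)) + 2 * ν univ * (D + B) := by
        gcongr
        exacts [(hμν s hs).trans (by gcongr; exact le_self_add), le_add_self]
    _ = _ := by ring

end Trace

section PoincareFriedrichs

variable {d : ℕ} {Ω Γ : Set (EuclideanSpace ℝ (Fin d))}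

theorem IsBoundedLipschitzDomain.isPoincarePair (hΩ : IsBoundedLipschitzDomain Ω) :
    IsPoincarePair Ω (volume.restrict Ω) (volume.restrict Ω) :=
  hΩ.hasConeProperty.isPoincarePair hΩ.isOpen hΩ.isConnected hΩ.isBounded

theorem IsBoundedLipschitzDomain.exists_isPoincarePair_surfaceMeasure
    (hΩ : IsBoundedLipschitzDomain Ω) (hΓ : Γ ⊆ frontier Ω) (hΓpos : surfaceMeasure d Γ ≠ 0) :
    ∃ A ⊆ Γ, surfaceMeasure d A ≠ 0 ∧ surfaceMeasure d A ≠ ⊤ ∧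
      IsPoincarePair Ω ((surfaceMeasure d).restrict A) (volume.restrict Ω) := by
  have := isFiniteMeasure_restrict_of_isBounded hΩ.isBounded
  obtain ⟨x, hx, hpos⟩ := exists_mem_forall_mem_nhdsWithin_pos_measure hΓpos
  obtain ⟨e, he, L, γ, hγ, r, hr, hgraph⟩ := hΩ.lipschitz x (hΓ hx)
  set U := frontier Ω ∩ Metric.ball x (r / 2)
  have ball_subset : Metric.ball x (r / 2) ⊆ Metric.ball x r :=
    Metric.ball_subset_ball (by linarith)
  have graph_eq : ∀ y ∈ U, γ (y - inner ℝ e y • e) = inner ℝ e y := fun y hy => by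
    obtain ⟨hy_closure, hy_notMem⟩ := hΩ.isOpen.frontier_eq ▸ hy.1
    exact (graph_le_inner_of_mem_closure hγ.continuous hgraph hy_closure
      (ball_subset hy.2)).antisymm (not_lt.1 (hy_notMem ∘ (hgraph y (ball_subset hy.2)).2))
  have shift_mem : ∀ y ∈ U, ∀ t ∈ Ioc 0 (r / 2), y + t • e ∈ Ω := fun y hy t ht => by
    have hball : y + t • e ∈ Metric.ball x r := by
      have := add_smul_mem_ball hy.2 (w := t • e) (b := r / 2)
        (by rw [norm_smul, he, mul_one, Real.norm_of_nonneg ht.1.le]; exact ht.2)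
        (right_mem_Ioc.2 one_pos)
      rwa [one_smul, add_halves] at this
    refine (hgraph _ hball).2 (graph_lt_inner_add_smul hγ (graph_eq y hy).le ?_ ht.1)
    simp [he]
  have hA : Γ ∩ Metric.ball x (r / 2) ⊆ U := inter_subset_inter_left _ hΓ
  refine ⟨Γ ∩ Metric.ball x (r / 2), inter_subset_left, ?_, ?_, ?_⟩
  · exact (hpos _ (inter_mem_nhdsWithin Γ (Metric.ball_mem_nhds x (by positivity)))).ne'
  · have := hausdorffMeasure_graph_lt_top he hγ (Metric.isBounded_ball.subset inter_subset_right)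
      fun y hy => graph_eq y (hA hy)
    rw [finrank_euclideanSpace_fin] at this
    exact this.ne
  · obtain ⟨C, hC, hC_bound⟩ :=
      exists_lintegral_graph_le_mul_lintegral he hγ fun y hy => graph_eq y (hA hy)
    rw [finrank_euclideanSpace_fin] at hC_bound
    refine hΩ.isPoincarePair.of_shift hΩ.isOpen.measurableSet (half_pos hr) ?_ hC hC_bound
    have hU : MeasurableSet U := isClosed_frontier.measurableSet.inter measurableSet_ball
    exact ae_restrict_of_ae_restrict_of_subset hA ((ae_restrict_mem hU).mono shift_mem)

theorem IsBoundedLipschitzDomain.exists_lintegral_enorm_sq_le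
    (hΩ : IsBoundedLipschitzDomain Ω) (hΓ : Γ ⊆ frontier Ω) (hΓpos : surfaceMeasure d Γ ≠ 0) :
    ∃ C ≠ (⊤ : ℝ≥0∞), ∀ s : EuclideanSpace ℝ (Fin d) → ℝ, ContDiff ℝ ∞ s →
      ∫⁻ x in Ω, ‖s x‖ₑ ^ 2 ≤ C * ((∫⁻ x in Ω, ‖gradient s x‖ₑ ^ 2) +
        ∫⁻ x in Γ, ‖s x‖ₑ ^ 2 ∂(surfaceMeasure d)) := by
  obtain ⟨A, hA, hA0, hA_top, hA_pair⟩ := hΩ.exists_isPoincarePair_surfaceMeasure hΓ hΓpos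
  have := isFiniteMeasure_restrict_of_isBounded hΩ.isBounded
  have : IsFiniteMeasure ((surfaceMeasure d).restrict A) := isFiniteMeasure_restrict.2 hA_top
  obtain ⟨C, hC, hC_bound⟩ :=
    hA_pair.exists_lintegral_enorm_sq_le (Measure.restrict_eq_zero.not.2 hA0)
  exact ⟨C, hC, fun s hs => (hC_bound s hs).trans (by gcongr)⟩

end PoincareFriedrichs

section ConeAverages

theorem lintegral_mul_le_rpow_mul_of_sq_le {α : Type*} [MeasurableSpace α] {μ : Measure α}
    {f g : α → ℝ≥0∞} (hf : AEMeasurable f μ) (hg : AEMeasurable g μ) {q : ℝ} (hq1 : 1 ≤ q)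
    (hq2 : q ≤ 2) {M : ℝ≥0∞} (hM : ∀ x, g x ^ 2 ≤ M) :
    ∫⁻ x, f x * g x ∂μ ≤
      M ^ (1 / q - 1 / 2) * ((∫⁻ x, f x ^ q ∂μ) ^ (1 / q) * (∫⁻ x, g x ^ 2 ∂μ) ^ (1 - 1 / q)) := by
  have hq0 : 0 < q := by linarith
  have hq_inv : 1 / q ≤ 1 := by rw [div_le_one hq0]; exact hq1
  have hq_inv' : 1 / 2 ≤ 1 / q := one_div_le_one_div_of_le hq0 hq2
  have le_interpolated (x : α) : g x ≤ M ^ (1 / q - 1 / 2) * (g x ^ 2) ^ (1 - 1 / q) := by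
    calc g x = (g x ^ 2) ^ (1 / q - 1 / 2) * (g x ^ 2) ^ (1 - 1 / q) := by
          rw [← ENNReal.rpow_add_of_nonneg _ _ (by linarith) (by linarith), ← ENNReal.rpow_natCast,
            ← ENNReal.rpow_mul]
          ring_nf
          rw [ENNReal.rpow_one]
      _ ≤ _ := by
          gcongr
          exact hM x
  have rpow_rpow (a : ℝ≥0∞) : (a ^ q) ^ (1 / q) = a := by
    rw [← ENNReal.rpow_mul, mul_one_div_cancel hq0.ne', ENNReal.rpow_one]
  have hölder := ENNReal.lintegral_mul_norm_pow_le (hf.pow_const q) (hg.pow_const 2)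
    (p := 1 / q) (q := 1 - 1 / q) (by positivity) (by linarith) (by ring)
  simp only [rpow_rpow] at hölder
  calc ∫⁻ x, f x * g x ∂μ
      ≤ ∫⁻ x, M ^ (1 / q - 1 / 2) * (f x * (g x ^ 2) ^ (1 - 1 / q)) ∂μ := by
        refine lintegral_mono fun x => ?_
        rw [mul_left_comm]
        gcongr
        exact le_interpolated x
    _ = M ^ (1 / q - 1 / 2) * ∫⁻ x, f x * (g x ^ 2) ^ (1 - 1 / q) ∂μ :=
        lintegral_const_mul'' _ (by fun_prop)
    _ ≤ _ := by gcongr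

variable {E : Type*} [NormedAddCommGroup E] [InnerProductSpace ℝ E] [FiniteDimensional ℝ E]
  [MeasurableSpace E] [BorelSpace E]

section Average

variable {g : E → ℝ≥0∞}

theorem measurable_setLIntegral_comp_add_smul (hg : Measurable g) (B : Set E) :
    Measurable fun q : E × ℝ => ∫⁻ w in B, g (q.1 + q.2 • w) :=
  (hg.comp (by fun_prop :
    Measurable fun q : (E × ℝ) × E => q.1.1 + q.1.2 • q.2)).lintegral_prod_right'

theorem sq_setLIntegral_comp_add_smul_le (hg : Measurable g) (B : Set E) (y : E) {t : ℝ}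
    (ht : 0 < t) :
    (∫⁻ w in B, g (y + t • w)) ^ 2 ≤
      volume B * (ENNReal.ofReal (t ^ Module.finrank ℝ E)⁻¹ * ∫⁻ y, g y ^ 2) := by
  have hmeas : Measurable fun w => g (y + t • w) := by fun_prop
  rw [← lintegral_comp_add_smul (hg.pow_const 2) y ht]
  refine (sq_lintegral_le hmeas.aemeasurable).trans ?_
  rw [Measure.restrict_apply_univ]
  exact mul_le_mul_right (setLIntegral_le_lintegral _ _) _

theorem lintegral_sq_setLIntegral_comp_add_smul_le (hg : Measurable g) (B : Set E) (t : ℝ) :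
    ∫⁻ y, (∫⁻ w in B, g (y + t • w)) ^ 2 ≤ volume B ^ 2 * ∫⁻ y, g y ^ 2 := by
  have hmeas : Measurable fun q : E × E => g (q.1 + t • q.2) ^ 2 := by fun_prop
  calc ∫⁻ y, (∫⁻ w in B, g (y + t • w)) ^ 2
      ≤ ∫⁻ y, volume B * ∫⁻ w in B, g (y + t • w) ^ 2 := by
        refine lintegral_mono fun y => ?_
        have hy : Measurable fun w => g (y + t • w) := by fun_prop
        simpa only [Measure.restrict_apply_univ] using
          sq_lintegral_le (μ := volume.restrict B) hy.aemeasurable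
    _ = volume B * ∫⁻ w in B, ∫⁻ y, g (y + t • w) ^ 2 := by
        rw [lintegral_const_mul _ hmeas.lintegral_prod_right',
          lintegral_lintegral_swap hmeas.aemeasurable]
    _ = volume B * ∫⁻ _ in B, ∫⁻ y, g y ^ 2 := by
        simp_rw [lintegral_add_right_eq_self fun y => g y ^ 2]
    _ = _ := by rw [setLIntegral_const]; ring

theorem lintegral_mul_setLIntegral_comp_add_smul_le {f : E → ℝ≥0∞} {A : Set E}
    (hf : AEMeasurable f (volume.restrict A)) (hg : Measurable g) (B : Set E) {q : ℝ}
    (hq1 : 1 ≤ q) (hq2 : q ≤ 2) {t : ℝ} (ht : 0 < t) :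
    ∫⁻ y in A, f y * ∫⁻ w in B, g (y + t • w) ≤
      volume B ^ (1 / q - 1 / 2) * (volume B ^ 2) ^ (1 - 1 / q) *
        ENNReal.ofReal (t ^ Module.finrank ℝ E)⁻¹ ^ (1 / q - 1 / 2) *
        ((∫⁻ y in A, f y ^ q) ^ (1 / q) * (∫⁻ y, g y ^ 2) ^ (1 / 2 : ℝ)) := by
  have hq0 : 0 < q := by linarith
  have hq_inv : 0 ≤ 1 - 1 / q := by rw [sub_nonneg, div_le_one hq0]; exact hq1
  have hq_inv' : 0 ≤ 1 / q - 1 / 2 := sub_nonneg.2 (one_div_le_one_div_of_le hq0 hq2)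
  have hmeas : Measurable fun y => ∫⁻ w in B, g (y + t • w) :=
    (measurable_setLIntegral_comp_add_smul hg B).comp (measurable_id.prodMk measurable_const)
  refine (lintegral_mul_le_rpow_mul_of_sq_le hf hmeas.aemeasurable hq1 hq2 fun y =>
    sq_setLIntegral_comp_add_smul_le hg B y ht).trans ?_
  set J := ∫⁻ y, g y ^ 2
  set T := ENNReal.ofReal (t ^ Module.finrank ℝ E)⁻¹
  set I := (∫⁻ y in A, f y ^ q) ^ (1 / q)
  have hJ : J ^ (1 / 2 : ℝ) = J ^ (1 / q - 1 / 2) * J ^ (1 - 1 / q) := by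
    rw [← ENNReal.rpow_add_of_nonneg _ _ hq_inv' hq_inv]
    ring_nf
  calc (volume B * (T * J)) ^ (1 / q - 1 / 2) * (I * (∫⁻ y in A, _) ^ (1 - 1 / q))
      ≤ (volume B * (T * J)) ^ (1 / q - 1 / 2) * (I * (volume B ^ 2 * J) ^ (1 - 1 / q)) := by
        gcongr
        exact (setLIntegral_le_lintegral _ _).trans
          (lintegral_sq_setLIntegral_comp_add_smul_le hg B t)
    _ = _ := by
        rw [hJ]
        simp only [ENNReal.mul_rpow_of_nonneg _ _ hq_inv', ENNReal.mul_rpow_of_nonneg _ _ hq_inv]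
        ring

end Average

theorem lintegral_ofReal_inv_pow_rpow_lt_top {n : ℕ} {a : ℝ} (ha : n * a < 1) :
    ∫⁻ t in Ioc (0 : ℝ) 1, ENNReal.ofReal (t ^ n)⁻¹ ^ a < ⊤ := by
  have hint : IntervalIntegrable (fun t : ℝ => t ^ (-(n * a))) volume 0 1 :=
    intervalIntegral.intervalIntegrable_rpow' (by linarith)
  rw [intervalIntegrable_iff_integrableOn_Ioc_of_le zero_le_one] at hint
  refine (setLIntegral_congr_fun measurableSet_Ioc fun t ht => ?_).trans_lt hint.2
  have ht0 : 0 < t := ht.1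
  beta_reduce
  rw [ENNReal.ofReal_rpow_of_pos (by positivity), ← ofReal_norm,
    Real.norm_of_nonneg (by positivity), Real.rpow_neg ht0.le, Real.rpow_mul ht0.le,
    Real.rpow_natCast, Real.inv_rpow (by positivity)]

variable {Ω : Set E}

theorem volume_mul_enorm_le_of_cone (hΩ : MeasurableSet Ω) {s : E → ℝ} {n : WithTop ℕ∞}
    (hs : ContDiff ℝ n s) (hn : n ≠ 0) {B : Set E} (hB : MeasurableSet B) {R : ℝ≥0∞}
    (hR : ∀ w ∈ B, ‖w‖ₑ ≤ R) {y : E} (hy : ∀ w ∈ B, ∀ t ∈ Ioc (0 : ℝ) 1, y + t • w ∈ Ω) :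
    volume B * ‖s y‖ₑ ≤ (∫⁻ w in B, Ω.indicator (‖s ·‖ₑ) (y + (1 : ℝ) • w)) +
      R * ∫⁻ t in Ioc (0 : ℝ) 1, ∫⁻ w in B, Ω.indicator (‖gradient s ·‖ₑ) (y + t • w) := by
  have hs_meas : Measurable s := hs.continuous.measurable
  have hDs : Measurable (Ω.indicator (‖gradient s ·‖ₑ)) :=
    (continuous_gradient_of_contDiff hs hn).enorm.measurable.indicator hΩ
  have hDs_ray : Measurable fun q : ℝ × E => Ω.indicator (‖gradient s ·‖ₑ) (y + q.1 • q.2) :=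
    hDs.comp (by fun_prop)
  have pointwise : ∀ w ∈ B, ‖s y‖ₑ ≤ Ω.indicator (‖s ·‖ₑ) (y + (1 : ℝ) • w) +
      R * ∫⁻ t in Ioc (0 : ℝ) 1, Ω.indicator (‖gradient s ·‖ₑ) (y + t • w) := fun w hw => by
    rw [indicator_of_mem (hy w hw 1 (right_mem_Ioc.2 one_pos)),
      setLIntegral_congr_fun measurableSet_Ioc fun t ht => indicator_of_mem (hy w hw t ht) _]
    calc ‖s y‖ₑ ≤ ‖s (y + (1 : ℝ) • w)‖ₑ + ‖s (y + (1 : ℝ) • w) - s y‖ₑ := by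
          simpa using enorm_sub_le (a := s (y + (1 : ℝ) • w)) (b := s (y + (1 : ℝ) • w) - s y)
      _ ≤ _ := by
          gcongr
          refine (enorm_add_smul_sub_le_lintegral_gradient hs hn y w zero_le_one).trans ?_
          have := (continuous_gradient_of_contDiff hs hn).measurable
          rw [lintegral_mul_const _ (by fun_prop), mul_comm]
          gcongr
          exact hR w hw
  calc volume B * ‖s y‖ₑ = ∫⁻ _ in B, ‖s y‖ₑ := by rw [setLIntegral_const, mul_comm]
    _ ≤ ∫⁻ w in B, (Ω.indicator (‖s ·‖ₑ) (y + (1 : ℝ) • w) +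
          R * ∫⁻ t in Ioc (0 : ℝ) 1, Ω.indicator (‖gradient s ·‖ₑ) (y + t • w)) :=
        setLIntegral_mono' hB pointwise
    _ = _ := by
        have : Measurable (Ω.indicator (‖s ·‖ₑ)) := hs_meas.enorm.indicator hΩ
        rw [lintegral_add_left (by fun_prop),
          lintegral_const_mul _ hDs_ray.lintegral_prod_left',
          lintegral_lintegral_swap (f := fun w t => Ω.indicator (‖gradient s ·‖ₑ) (y + t • w))
            (hDs_ray.comp measurable_swap).aemeasurable]

theorem lintegral_indicator_pow (hΩ : MeasurableSet Ω) (g : E → ℝ≥0∞) {n : ℕ} (hn : n ≠ 0) :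
    ∫⁻ y, Ω.indicator g y ^ n = ∫⁻ y in Ω, g y ^ n := by
  rw [← lintegral_indicator hΩ]
  refine lintegral_congr fun y => ?_
  by_cases hy : y ∈ Ω <;> simp [hy, hn]

theorem volume_mul_lintegral_mul_enorm_le_of_cone (hΩ : MeasurableSet Ω) {A : Set E}
    (hA : MeasurableSet A) {s : E → ℝ} {n : WithTop ℕ∞} (hs : ContDiff ℝ n s) (hn : n ≠ 0)
    {B : Set E} (hB : MeasurableSet B) (hB_top : volume B ≠ (⊤ : ℝ≥0∞)) {R : ℝ≥0∞} (hR_top : R ≠ ⊤)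
    (hR : ∀ w ∈ B, ‖w‖ₑ ≤ R) (hcone : ∀ y ∈ A, ∀ w ∈ B, ∀ t ∈ Ioc (0 : ℝ) 1, y + t • w ∈ Ω)
    {f : E → ℝ≥0∞} (hf : AEMeasurable f (volume.restrict A)) :
    volume B * ∫⁻ y in A, f y * ‖s y‖ₑ ≤
      (∫⁻ y in A, f y * ∫⁻ w in B, Ω.indicator (‖s ·‖ₑ) (y + (1 : ℝ) • w)) +
      R * ∫⁻ t in Ioc (0 : ℝ) 1, ∫⁻ y in A,
        f y * ∫⁻ w in B, Ω.indicator (‖gradient s ·‖ₑ) (y + t • w) := by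
  set u : E × ℝ → ℝ≥0∞ := fun z => ∫⁻ w in B, Ω.indicator (‖s ·‖ₑ) (z.1 + z.2 • w)
  set v : E × ℝ → ℝ≥0∞ := fun z => ∫⁻ w in B, Ω.indicator (‖gradient s ·‖ₑ) (z.1 + z.2 • w)
  have hu : Measurable u :=
    measurable_setLIntegral_comp_add_smul (hs.continuous.enorm.measurable.indicator hΩ) B
  have hu_one : Measurable fun y => u (y, 1) := hu.comp (measurable_id.prodMk measurable_const)
  have hv : Measurable v := measurable_setLIntegral_comp_add_smul
    ((continuous_gradient_of_contDiff hs hn).enorm.measurable.indicator hΩ) B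
  have hv_left (y : E) : Measurable fun t => v (y, t) := hv.comp measurable_prodMk_left
  have hfv : AEMeasurable (Function.uncurry fun y t => f y * v (y, t))
      ((volume.restrict A).prod (volume.restrict (Ioc (0 : ℝ) 1))) :=
    hf.comp_fst.mul hv.aemeasurable
  calc volume B * ∫⁻ y in A, f y * ‖s y‖ₑ
      = ∫⁻ y in A, f y * (volume B * ‖s y‖ₑ) := by
        simp_rw [mul_left_comm (f _), lintegral_const_mul' _ _ hB_top]
    _ ≤ ∫⁻ y in A, f y * (u (y, 1) + R * ∫⁻ t in Ioc (0 : ℝ) 1, v (y, t)) := by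
        refine setLIntegral_mono' hA fun y hy => ?_
        gcongr
        exact volume_mul_enorm_le_of_cone hΩ hs hn hB hR (hcone y hy)
    _ = (∫⁻ y in A, f y * u (y, 1)) +
          R * ∫⁻ y in A, ∫⁻ t in Ioc (0 : ℝ) 1, f y * v (y, t) := by
        simp_rw [mul_add, mul_left_comm (f _)]
        rw [lintegral_add_left' (f := fun y => f y * u (y, 1)) (hf.mul hu_one.aemeasurable),
          lintegral_const_mul' _ _ hR_top]
        simp_rw [lintegral_const_mul _ (hv_left _)]
    _ = _ := by rw [lintegral_lintegral_swap hfv]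

theorem exists_lintegral_mul_enorm_le_of_cone (hΩ : MeasurableSet Ω) {A : Set E}
    (hA : MeasurableSet A) {c : E} {ρ : ℝ} (hρ : 0 < ρ)
    (hcone : ∀ y ∈ A, ∀ w ∈ Metric.ball c ρ, ∀ t ∈ Ioc (0 : ℝ) 1, y + t • w ∈ Ω) {q : ℝ}
    (hq1 : 1 ≤ q) (hq2 : q ≤ 2) (hq : Module.finrank ℝ E * (1 / q - 1 / 2) < 1) :
    ∃ C ≠ (⊤ : ℝ≥0∞), ∀ s : E → ℝ, ContDiff ℝ ∞ s →
      ∀ f : E → ℝ≥0∞, AEMeasurable f (volume.restrict A) →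
      ∫⁻ x in A, f x * ‖s x‖ₑ ≤ C * ((∫⁻ x in A, f x ^ q) ^ (1 / q) *
        ((∫⁻ x in Ω, ‖s x‖ₑ ^ 2) ^ (1 / 2 : ℝ) +
          (∫⁻ x in Ω, ‖gradient s x‖ₑ ^ 2) ^ (1 / 2 : ℝ))) := by
  set B := Metric.ball c ρ
  have hB_top : volume B ≠ ⊤ := measure_ball_lt_top.ne
  set R := ENNReal.ofReal (‖c‖ + ρ)
  have hR : ∀ w ∈ B, ‖w‖ₑ ≤ R := fun w hw => by
    rw [← ofReal_norm]
    exact ENNReal.ofReal_le_ofReal (norm_lt_of_mem_ball hw).le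
  have hq_inv : 0 ≤ 1 - 1 / q := by rw [sub_nonneg, div_le_one (by linarith)]; exact hq1
  have hq_inv' : 0 ≤ 1 / q - 1 / 2 := sub_nonneg.2 (one_div_le_one_div_of_le (by linarith) hq2)
  set T : ℝ → ℝ≥0∞ := fun t => ENNReal.ofReal (t ^ Module.finrank ℝ E)⁻¹ ^ (1 / q - 1 / 2)
  have hT : Measurable T := by fun_prop
  have hT_int : ∫⁻ t in Ioc (0 : ℝ) 1, T t ≠ ⊤ := (lintegral_ofReal_inv_pow_rpow_lt_top hq).ne
  set b := volume B ^ (1 / q - 1 / 2) * (volume B ^ 2) ^ (1 - 1 / q)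
  refine ⟨(volume B)⁻¹ * (b + R * (b * ∫⁻ t in Ioc (0 : ℝ) 1, T t)), ?_, fun s hs f hf => ?_⟩
  · have := (Metric.measure_ball_pos volume c hρ).ne'
    finiteness
  have average_le {g : E → ℝ≥0∞} (hg : Measurable g) {t : ℝ} (ht : 0 < t) :=
    lintegral_mul_setLIntegral_comp_add_smul_le hf (hg.indicator hΩ) B hq1 hq2 ht
  simp only [lintegral_indicator_pow hΩ _ two_ne_zero] at average_le
  have hDs := (continuous_gradient_of_contDiff hs (by simp)).enorm.measurable
  set I := (∫⁻ x in A, f x ^ q) ^ (1 / q)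
  set U := (∫⁻ x in Ω, ‖s x‖ₑ ^ 2) ^ (1 / 2 : ℝ)
  set D := (∫⁻ x in Ω, ‖gradient s x‖ₑ ^ 2) ^ (1 / 2 : ℝ)
  rw [mul_assoc, ← ENNReal.mul_le_iff_le_inv (Metric.measure_ball_pos volume c hρ).ne' hB_top]
  calc volume B * ∫⁻ y in A, f y * ‖s y‖ₑ
      ≤ b * T 1 * (I * U) + R * ∫⁻ t in Ioc (0 : ℝ) 1, b * T t * (I * D) := by
        refine (volume_mul_lintegral_mul_enorm_le_of_cone hΩ hA hs (by simp) measurableSet_ball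
          hB_top ENNReal.ofReal_ne_top hR hcone hf).trans (add_le_add
          (average_le hs.continuous.enorm.measurable one_pos) (mul_le_mul_right ?_ _))
        exact setLIntegral_mono' measurableSet_Ioc fun t ht => average_le hDs ht.1
    _ = b * (I * U) + R * (b * (∫⁻ t in Ioc (0 : ℝ) 1, T t) * (I * D)) := by
        rw [lintegral_mul_const _ (by fun_prop), lintegral_const_mul _ hT]
        simp [T]
    _ ≤ b * (I * (U + D)) + R * (b * (∫⁻ t in Ioc (0 : ℝ) 1, T t) * (I * (U + D))) := by
        gcongr
        exacts [le_self_add, le_add_self]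
    _ = _ := by ring

theorem HasConeProperty.exists_lintegral_mul_enorm_le (hcone : HasConeProperty Ω)
    (hΩ : MeasurableSet Ω) (hΩb : Bornology.IsBounded Ω) {q : ℝ} (hq1 : 1 ≤ q) (hq2 : q ≤ 2)
    (hq : Module.finrank ℝ E * (1 / q - 1 / 2) < 1) :
    ∃ C ≠ (⊤ : ℝ≥0∞), ∀ s : E → ℝ, ContDiff ℝ ∞ s →
      ∀ f : E → ℝ≥0∞, AEMeasurable f (volume.restrict Ω) →
      ∫⁻ x in Ω, f x * ‖s x‖ₑ ≤ C * ((∫⁻ x in Ω, f x ^ q) ^ (1 / q) *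
        ((∫⁻ x in Ω, ‖s x‖ₑ ^ 2) ^ (1 / 2 : ℝ) +
          (∫⁻ x in Ω, ‖gradient s x‖ₑ ^ 2) ^ (1 / 2 : ℝ))) := by
  suffices ∃ C ≠ (⊤ : ℝ≥0∞), ∀ s : E → ℝ, ContDiff ℝ ∞ s →
      ∀ f : E → ℝ≥0∞, AEMeasurable f (volume.restrict Ω) →
      ∫⁻ x in closure Ω ∩ Ω, f x * ‖s x‖ₑ ≤ C * ((∫⁻ x in Ω, f x ^ q) ^ (1 / q) *
        ((∫⁻ x in Ω, ‖s x‖ₑ ^ 2) ^ (1 / 2 : ℝ) +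
          (∫⁻ x in Ω, ‖gradient s x‖ₑ ^ 2) ^ (1 / 2 : ℝ))) by
    rwa [inter_eq_right.2 subset_closure] at this
  refine hΩb.isCompact_closure.induction_on ⟨0, by simp, by simp⟩ ?_ ?_ fun x hx => ?_
  · rintro S S' hSS' ⟨C, hC_top, hC⟩
    exact ⟨C, hC_top, fun s hs f hf =>
      (lintegral_mono_set (inter_subset_inter_left _ hSS')).trans (hC s hs f hf)⟩
  · rintro S S' ⟨C, hC_top, hC⟩ ⟨C', hC'_top, hC'⟩
    refine ⟨C + C', by finiteness, fun s hs f hf => ?_⟩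
    rw [union_inter_distrib_right, add_mul]
    exact (lintegral_union_le _ _ _).trans (add_le_add (hC s hs f hf) (hC' s hs f hf))
  · obtain ⟨N, hN, c, ρ, hρ, hNc⟩ := hcone x hx
    obtain ⟨δ, hδ, hδN⟩ := Metric.mem_nhds_iff.1 hN
    refine ⟨Metric.ball x δ, mem_nhdsWithin_of_mem_nhds (Metric.ball_mem_nhds x hδ), ?_⟩
    obtain ⟨C, hC_top, hC⟩ := exists_lintegral_mul_enorm_le_of_cone hΩ
      (measurableSet_ball.inter hΩ) hρ (fun z hz => hNc z ⟨hδN hz.1, subset_closure hz.2⟩)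
      hq1 hq2 hq
    refine ⟨C, hC_top, fun s hs f hf =>
      (hC s hs f (hf.mono_set inter_subset_right)).trans ?_⟩
    gcongr
    exact inter_subset_right

theorem eLpNorm_two_eq {F α : Type*} [NormedAddCommGroup F] [MeasurableSpace α] {μ : Measure α}
    (u : α → F) : eLpNorm u 2 μ = (∫⁻ x, ‖u x‖ₑ ^ 2 ∂μ) ^ (1 / 2 : ℝ) := by
  rw [eLpNorm_eq_lintegral_rpow_enorm_toReal (by norm_num) (by norm_num)]
  norm_num

theorem exists_exponent_le_of_half_lt {n : ℕ} {p : ℝ≥0∞} (hp : 1 ≤ p) (hnp : (n : ℝ≥0∞) / 2 < p) :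
    ∃ q : ℝ, 1 ≤ q ∧ q ≤ 2 ∧ ENNReal.ofReal q ≤ p ∧ n * (1 / q - 1 / 2) < 1 := by
  rcases le_total 2 p with h | h
  · exact ⟨2, by norm_num, le_rfl, by simpa using h, by norm_num⟩
  · have hp_top : p ≠ ⊤ := (h.trans_lt (by simp)).ne
    lift p to ℝ≥0 using hp_top
    have hp1 : 1 ≤ (p : ℝ) := mod_cast hp
    have hnp' : (n : ℝ) / 2 < p := by
      have := (ENNReal.toReal_lt_toReal (hnp.trans_le le_top).ne ENNReal.coe_ne_top).2 hnp
      simpa using this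
    refine ⟨p, hp1, mod_cast h, by simp, ?_⟩
    rw [div_sub_div _ _ (by positivity) two_ne_zero, ← mul_div_assoc, div_lt_one (by positivity)]
    nlinarith [n.cast_nonneg (α := ℝ)]

theorem HasConeProperty.exists_lintegral_mul_enorm_le_eLpNorm (hcone : HasConeProperty Ω)
    (hΩ : MeasurableSet Ω) (hΩb : Bornology.IsBounded Ω) {p : ℝ≥0∞} (hp1 : 1 ≤ p)
    (hp : (Module.finrank ℝ E : ℝ≥0∞) / 2 < p) :
    ∃ C ≠ (⊤ : ℝ≥0∞), ∀ s : E → ℝ, ContDiff ℝ ∞ s →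
      ∀ f : E → ℝ, AEStronglyMeasurable f (volume.restrict Ω) →
      ∫⁻ x in Ω, ‖f x‖ₑ * ‖s x‖ₑ ≤ C * eLpNorm f p (volume.restrict Ω) *
        (eLpNorm s 2 (volume.restrict Ω) + eLpNorm (gradient s) 2 (volume.restrict Ω)) := by
  obtain ⟨q, hq1, hq2, hqp, hq⟩ := exists_exponent_le_of_half_lt hp1 hp
  have hq0 : 0 < q := by linarith
  obtain ⟨C, hC_top, hC⟩ := hcone.exists_lintegral_mul_enorm_le hΩ hΩb hq1 hq2 hq
  have := isFiniteMeasure_restrict_of_isBounded hΩb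
  set κ := volume.restrict Ω univ ^ (1 / q - 1 / p.toReal)
  have hκ_top : κ ≠ ⊤ := by
    refine ENNReal.rpow_ne_top_of_nonneg ?_ (measure_ne_top _ _)
    rcases eq_or_ne p ⊤ with rfl | hp_top
    · simpa using hq0.le
    · have := ENNReal.toReal_mono hp_top hqp
      rw [ENNReal.toReal_ofReal hq0.le] at this
      exact sub_nonneg.2 (one_div_le_one_div_of_le hq0 this)
  refine ⟨C * κ, by finiteness, fun s hs f hf => (hC s hs _ hf.enorm).trans ?_⟩
  have eLpNorm_le : (∫⁻ x in Ω, ‖f x‖ₑ ^ q) ^ (1 / q) ≤ κ * eLpNorm f p (volume.restrict Ω) := by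
    have := eLpNorm_le_eLpNorm_mul_rpow_measure_univ hqp hf
    rwa [mul_comm, eLpNorm_eq_lintegral_rpow_enorm_toReal (by simpa using hq0) (by simp),
      ENNReal.toReal_ofReal hq0.le] at this
  rw [← eLpNorm_two_eq, ← eLpNorm_two_eq, mul_assoc C, mul_assoc C]
  gcongr

end ConeAverages

section DirichletSpace

theorem eventually_memLp_of_tendsto_eLpNorm_sub {α F ι : Type*} [MeasurableSpace α]
    [NormedAddCommGroup F] {ν : Measure α} {p : ℝ≥0∞} {l : Filter ι} {t : ι → α → F} {u : α → F}
    (ht : ∀ i, AEStronglyMeasurable (t i) ν) (hu : MemLp u p ν)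
    (h : Tendsto (fun i => eLpNorm (fun x => t i x - u x) p ν) l (𝓝 0)) :
    ∀ᶠ i in l, MemLp (t i) p ν := by
  filter_upwards [h.eventually_lt_const ENNReal.zero_lt_top] with i hi
  have memLp_sub : MemLp (t i - u) p ν := ⟨(ht i).sub hu.1, hi⟩
  simpa using memLp_sub.add hu

theorem tendsto_toLp_iff {α F ι : Type*} [MeasurableSpace α] [NormedAddCommGroup F]
    {ν : Measure α} {p : ℝ≥0∞} [Fact (1 ≤ p)] {l : Filter ι} {t : ι → α → F} {u : Lp F p ν}
    (ht : ∀ i, MemLp (t i) p ν) :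
    Tendsto (fun i => (ht i).toLp (t i)) l (𝓝 u) ↔
      Tendsto (fun i => eLpNorm (fun x => t i x - u x) p ν) l (𝓝 0) := by
  conv_lhs => rw [← Lp.toLp_coeFn u (Lp.memLp u)]
  exact Lp.tendsto_Lp_iff_tendsto_eLpNorm'' _ ht _ _

section Gradient

variable {E : Type*} [NormedAddCommGroup E] [InnerProductSpace ℝ E] [CompleteSpace E]

theorem gradient_add {s s' : E → ℝ} {x : E} (hs : DifferentiableAt ℝ s x)
    (hs' : DifferentiableAt ℝ s' x) : gradient (s + s') x = gradient s x + gradient s' x := by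
  simp only [gradient, fderiv_add hs hs', map_add]

theorem gradient_const_smul {s : E → ℝ} {x : E} (hs : DifferentiableAt ℝ s x) (c : ℝ) :
    gradient (c • s) x = c • gradient s x := by
  simp [gradient, fderiv_const_smul hs]

end Gradient

section SmoothTraceGraph

variable {E : Type*} [NormedAddCommGroup E] [InnerProductSpace ℝ E] [FiniteDimensional ℝ E]
  [MeasurableSpace E] [BorelSpace E] {Ω : Set E} {μ : Measure E}

variable (Ω μ) in
/-- The triples `(s, ∇s, s)` in `L²(Ω) × L²(Ω) × L²(μ)` for smooth `s`. When `μ` is the surface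
measure of a part of the boundary of `Ω`, its closure is the graph of the trace operator on
`H¹(Ω)`. -/
def smoothTraceGraph :
    Submodule ℝ (Lp ℝ 2 (volume.restrict Ω) × Lp E 2 (volume.restrict Ω) × Lp ℝ 2 μ) where
  carrier := {w | ∃ s : E → ℝ, ContDiff ℝ ∞ s ∧ w.1 =ᵐ[volume.restrict Ω] s ∧
    w.2.1 =ᵐ[volume.restrict Ω] gradient s ∧ w.2.2 =ᵐ[μ] s}
  zero_mem' := by
    have gradient_zero : gradient (0 : E → ℝ) = 0 := by ext1 x; simp [gradient]
    exact ⟨0, contDiff_const, Lp.coeFn_zero _ _ _,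
      by rw [gradient_zero]; exact Lp.coeFn_zero _ _ _, Lp.coeFn_zero _ _ _⟩
  add_mem' := by
    rintro w w' ⟨s, hs, h₁, h₂, h₃⟩ ⟨s', hs', h₁', h₂', h₃'⟩
    have gradient_add : gradient (s + s') = gradient s + gradient s' := by
      ext1 x
      exact gradient_add (hs.differentiable (by simp) x) (hs'.differentiable (by simp) x)
    exact ⟨s + s', hs.add hs', (Lp.coeFn_add _ _).trans (h₁.add h₁'),
      by rw [gradient_add]; exact (Lp.coeFn_add _ _).trans (h₂.add h₂'),
      (Lp.coeFn_add _ _).trans (h₃.add h₃')⟩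
  smul_mem' := by
    rintro c w ⟨s, hs, h₁, h₂, h₃⟩
    have gradient_smul : gradient (c • s) = c • gradient s := by
      ext1 x
      exact gradient_const_smul (hs.differentiable (by simp) x) c
    exact ⟨c • s, contDiff_const.smul hs, (Lp.coeFn_smul _ _).trans (h₁.const_smul c),
      by rw [gradient_smul]; exact (Lp.coeFn_smul _ _).trans (h₂.const_smul c),
      (Lp.coeFn_smul _ _).trans (h₃.const_smul c)⟩

theorem toLp_mem_smoothTraceGraph {s : E → ℝ} (hs : ContDiff ℝ ∞ s)
    (h₁ : MemLp s 2 (volume.restrict Ω)) (h₂ : MemLp (gradient s) 2 (volume.restrict Ω))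
    (h₃ : MemLp s 2 μ) :
    (h₁.toLp s, h₂.toLp (gradient s), h₃.toLp s) ∈ smoothTraceGraph Ω μ :=
  ⟨s, hs, h₁.coeFn_toLp, h₂.coeFn_toLp, h₃.coeFn_toLp⟩

theorem mem_closure_smoothTraceGraph_iff
    {w : Lp ℝ 2 (volume.restrict Ω) × Lp E 2 (volume.restrict Ω) × Lp ℝ 2 μ} :
    w ∈ (smoothTraceGraph Ω μ).topologicalClosure ↔
      ∃ s : ℕ → E → ℝ, (∀ n, ContDiff ℝ ∞ (s n)) ∧
        Tendsto (fun n => eLpNorm (fun x => s n x - w.1 x) 2 (volume.restrict Ω)) atTop (𝓝 0) ∧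
        Tendsto (fun n => eLpNorm (fun x => gradient (s n) x - w.2.1 x) 2 (volume.restrict Ω))
          atTop (𝓝 0) ∧
        Tendsto (fun n => eLpNorm (fun x => s n x - w.2.2 x) 2 μ) atTop (𝓝 0) := by
  constructor
  · rw [← SetLike.mem_coe, Submodule.topologicalClosure_coe, mem_closure_iff_seq_limit]
    rintro ⟨wₙ, hwₙ, lim⟩
    choose s hs h₁ h₂ h₃ using hwₙ
    refine ⟨s, hs, ?_, ?_, ?_⟩
    · exact ((Lp.tendsto_Lp_iff_tendsto_eLpNorm' _ _).1 lim.fst_nhds).congr fun n =>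
        eLpNorm_congr_ae ((h₁ n).sub EventuallyEq.rfl)
    · exact ((Lp.tendsto_Lp_iff_tendsto_eLpNorm' _ _).1 lim.snd_nhds.fst_nhds).congr fun n =>
        eLpNorm_congr_ae ((h₂ n).sub EventuallyEq.rfl)
    · exact ((Lp.tendsto_Lp_iff_tendsto_eLpNorm' _ _).1 lim.snd_nhds.snd_nhds).congr fun n =>
        eLpNorm_congr_ae ((h₃ n).sub EventuallyEq.rfl)
  · rintro ⟨s, hs, lim₁, lim₂, lim₃⟩
    have h₁ := eventually_memLp_of_tendsto_eLpNorm_sub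
      (fun n => (hs n).continuous.aestronglyMeasurable) (Lp.memLp _) lim₁
    have h₂ := eventually_memLp_of_tendsto_eLpNorm_sub (fun n =>
      (continuous_gradient_of_contDiff (hs n) (by simp)).aestronglyMeasurable) (Lp.memLp _) lim₂
    have h₃ := eventually_memLp_of_tendsto_eLpNorm_sub
      (fun n => (hs n).continuous.aestronglyMeasurable) (Lp.memLp _) lim₃
    obtain ⟨N, hN⟩ := eventually_atTop.1 (h₁.and (h₂.and h₃))
    have memLp (n : ℕ) := hN (n + N) (by simp)
    refine mem_closure_of_tendsto (b := atTop) (f := fun n =>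
      ((memLp n).1.toLp, (memLp n).2.1.toLp, (memLp n).2.2.toLp)) ?_
      (Eventually.of_forall fun n => toLp_mem_smoothTraceGraph (hs _) _ _ _)
    refine .prodMk_nhds ?_ (.prodMk_nhds ?_ ?_)
    · exact (tendsto_toLp_iff _).2 (lim₁.comp (tendsto_add_atTop_nat N))
    · exact (tendsto_toLp_iff _).2 (lim₂.comp (tendsto_add_atTop_nat N))
    · exact (tendsto_toLp_iff _).2 (lim₃.comp (tendsto_add_atTop_nat N))

end SmoothTraceGraph

variable {d : ℕ} {Ω ΓD : Set (EuclideanSpace ℝ (Fin d))}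

variable (Ω ΓD) in
/-- The space `H¹_D(Ω)`, realized by the pairs `(u, ∇u)` in `L²(Ω) × L²(Ω)`. -/
noncomputable def dirichletSpace :
    Submodule ℝ (Lp ℝ 2 (volume.restrict Ω) ×
      Lp (EuclideanSpace ℝ (Fin d)) 2 (volume.restrict Ω)) :=
  (smoothTraceGraph Ω ((surfaceMeasure d).restrict ΓD)).topologicalClosure.comap
    (LinearMap.prodMap .id (.inl ℝ _ _))

theorem mem_dirichletSpace
    {w : Lp ℝ 2 (volume.restrict Ω) × Lp (EuclideanSpace ℝ (Fin d)) 2 (volume.restrict Ω)} :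
    w ∈ dirichletSpace Ω ΓD ↔ (w.1, w.2, 0) ∈
      (smoothTraceGraph Ω ((surfaceMeasure d).restrict ΓD)).topologicalClosure :=
  Iff.rfl

theorem isClosed_dirichletSpace : IsClosed (dirichletSpace Ω ΓD : Set (Lp ℝ 2 (volume.restrict Ω) ×
    Lp (EuclideanSpace ℝ (Fin d)) 2 (volume.restrict Ω))) :=
  (Submodule.isClosed_topologicalClosure _).preimage
    (continuous_fst.prodMk (continuous_snd.prodMk continuous_const))

theorem toLp_mem_dirichletSpace_iff {u : EuclideanSpace ℝ (Fin d) → ℝ}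
    {G : EuclideanSpace ℝ (Fin d) → EuclideanSpace ℝ (Fin d)}
    (hu : MemLp u 2 (volume.restrict Ω)) (hG : MemLp G 2 (volume.restrict Ω)) :
    (hu.toLp, hG.toLp) ∈ dirichletSpace Ω ΓD ↔
      ∃ s : ℕ → EuclideanSpace ℝ (Fin d) → ℝ, (∀ n, ContDiff ℝ ∞ (s n)) ∧
        Tendsto (fun n => eLpNorm (fun x => s n x - u x) 2 (volume.restrict Ω)) atTop (𝓝 0) ∧
        Tendsto (fun n => eLpNorm (fun x => gradient (s n) x - G x) 2 (volume.restrict Ω))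
          atTop (𝓝 0) ∧
        Tendsto (fun n => eLpNorm (fun x => s n x - (0 : EuclideanSpace ℝ (Fin d) → ℝ) x) 2
          ((surfaceMeasure d).restrict ΓD)) atTop (𝓝 0) := by
  rw [mem_dirichletSpace, mem_closure_smoothTraceGraph_iff]
  exact exists_congr fun s => and_congr_right' <| and_congr
    (tendsto_congr fun n => eLpNorm_congr_ae (EventuallyEq.rfl.sub hu.coeFn_toLp)) <| and_congr
    (tendsto_congr fun n => eLpNorm_congr_ae (EventuallyEq.rfl.sub hG.coeFn_toLp))
    (tendsto_congr fun n => eLpNorm_congr_ae (EventuallyEq.rfl.sub (Lp.coeFn_zero _ _ _)))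

theorem MemH1D.toLp_mem {φ : EuclideanSpace ℝ (Fin d) → ℝ} (h : MemH1D Ω ΓD φ) :
    (h.1.1.toLp φ, h.1.memLp_weakGrad.toLp (weakGrad Ω φ)) ∈ dirichletSpace Ω ΓD :=
  (toLp_mem_dirichletSpace_iff _ _).2 h.2

theorem memH1D_of_toLp_mem (hΩ : IsOpen Ω) (hΩb : Bornology.IsBounded Ω)
    {u : EuclideanSpace ℝ (Fin d) → ℝ} {G : EuclideanSpace ℝ (Fin d) → EuclideanSpace ℝ (Fin d)}
    (hu : MemLp u 2 (volume.restrict Ω)) (hG : MemLp G 2 (volume.restrict Ω))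
    (h : (hu.toLp, hG.toLp) ∈ dirichletSpace Ω ΓD) :
    MemH1D Ω ΓD u ∧ weakGrad Ω u =ᵐ[volume.restrict Ω] G := by
  obtain ⟨s, hs, lim, lim_grad, -⟩ := (toLp_mem_dirichletSpace_iff hu hG).1 h
  have isWeakGradient : IsWeakGradient Ω u G :=
    .of_tendsto (fun n => isWeakGradient_gradient (hs n)) hu hG
      (fun n => memLp_restrict_of_continuous_of_isBounded (hs n).continuous hΩb 2)
      (fun n => memLp_restrict_of_continuous_of_isBounded
        (continuous_gradient_of_contDiff (hs n) (by simp)) hΩb 2) lim lim_grad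
  have weakGrad_ae_eq := isWeakGradient.weakGrad_ae_eq hΩ hu hG
  have memH1 : MemH1 Ω u := ⟨hu, G, hG, isWeakGradient⟩
  refine ⟨⟨memH1, (toLp_mem_dirichletSpace_iff hu memH1.memLp_weakGrad).1 ?_⟩, weakGrad_ae_eq⟩
  rwa [MemLp.toLp_congr memH1.memLp_weakGrad hG weakGrad_ae_eq]

theorem IsBoundedLipschitzDomain.exists_norm_fst_le (hΩ : IsBoundedLipschitzDomain Ω)
    (hΓ : ΓD ⊆ frontier Ω) (hΓpos : surfaceMeasure d ΓD ≠ 0) :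
    ∃ C : ℝ≥0, ∀ w ∈ dirichletSpace Ω ΓD, ‖w.1‖ ≤ C * ‖w.2‖ := by
  obtain ⟨C, hC_top, hC⟩ := hΩ.exists_lintegral_enorm_sq_le hΓ hΓpos
  lift C to ℝ≥0 using hC_top
  refine ⟨NNReal.sqrt C, fun w hw => ?_⟩
  obtain ⟨wₙ, hwₙ, lim⟩ := mem_closure_iff_seq_limit.1 (mem_dirichletSpace.1 hw)
  have bound (n : ℕ) : ‖(wₙ n).1‖ ^ 2 ≤ C * (‖(wₙ n).2.1‖ ^ 2 + ‖(wₙ n).2.2‖ ^ 2) := by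
    obtain ⟨s, hs, h₁, h₂, h₃⟩ := hwₙ n
    have bound_enorm : ‖(wₙ n).1‖ₑ ^ 2 ≤ C * (‖(wₙ n).2.1‖ₑ ^ 2 + ‖(wₙ n).2.2‖ₑ ^ 2) := by
      simp_rw [Lp.enorm_def, eLpNorm_congr_ae h₁, eLpNorm_congr_ae h₂, eLpNorm_congr_ae h₃]
      simpa [eLpNorm_two_eq, ← ENNReal.rpow_mul_natCast] using hC s hs
    simp_rw [enorm_eq_nnnorm] at bound_enorm
    exact_mod_cast bound_enorm
  have norm_sq_le : ‖w.1‖ ^ 2 ≤ C * (‖w.2‖ ^ 2 + ‖(0 : Lp ℝ 2 _)‖ ^ 2) :=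
    le_of_tendsto_of_tendsto' (lim.fst_nhds.norm.pow 2) (((lim.snd_nhds.fst_nhds.norm.pow 2).add
      (lim.snd_nhds.snd_nhds.norm.pow 2)).const_mul _) bound
  rw [Real.coe_sqrt, ← Real.sqrt_sq (norm_nonneg w.2), ← Real.sqrt_mul C.coe_nonneg]
  exact Real.le_sqrt_of_sq_le (by simpa using norm_sq_le)

theorem lintegral_mul_enorm_le_of_tendsto_Lp {α : Type*} [MeasurableSpace α] {μ : Measure α}
    {p : ℝ≥0∞} [Fact (1 ≤ p)] {f : α → ℝ} (hf : AEStronglyMeasurable f μ) {u : ℕ → Lp ℝ p μ}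
    {v : Lp ℝ p μ} (huv : Tendsto u atTop (𝓝 v)) {b : ℕ → ℝ≥0∞} {B : ℝ≥0∞}
    (hb : ∀ n, ∫⁻ x, ‖f x‖ₑ * ‖u n x‖ₑ ∂μ ≤ b n) (hbB : Tendsto b atTop (𝓝 B)) :
    ∫⁻ x, ‖f x‖ₑ * ‖v x‖ₑ ∂μ ≤ B := by
  obtain ⟨k, hk, ae_tendsto⟩ := (tendstoInMeasure_of_tendsto_Lp huv).exists_seq_tendsto_ae
  have liminf_eq : ∀ᵐ x ∂μ, ‖f x‖ₑ * ‖v x‖ₑ = liminf (fun n => ‖f x‖ₑ * ‖u (k n) x‖ₑ) atTop := by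
    filter_upwards [ae_tendsto] with x hx
    exact (ENNReal.Tendsto.const_mul hx.enorm (Or.inr enorm_ne_top)).liminf_eq.symm
  calc ∫⁻ x, ‖f x‖ₑ * ‖v x‖ₑ ∂μ
      = ∫⁻ x, liminf (fun n => ‖f x‖ₑ * ‖u (k n) x‖ₑ) atTop ∂μ := lintegral_congr_ae liminf_eq
    _ ≤ liminf (fun n => ∫⁻ x, ‖f x‖ₑ * ‖u (k n) x‖ₑ ∂μ) atTop :=
        lintegral_liminf_le' fun n => hf.enorm.mul (Lp.aestronglyMeasurable _).enorm
    _ ≤ liminf (fun n => b (k n)) atTop := liminf_le_liminf (Eventually.of_forall fun n => hb _)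
    _ = B := (hbB.comp hk.tendsto_atTop).liminf_eq

theorem IsBoundedLipschitzDomain.exists_lintegral_mul_enorm_fst_le
    (hΩ : IsBoundedLipschitzDomain Ω) {p : ℝ≥0∞} (hp1 : 1 ≤ p) (hpd : (d : ℝ≥0∞) / 2 < p) :
    ∃ C : ℝ≥0, ∀ f : EuclideanSpace ℝ (Fin d) → ℝ, MemLp f p (volume.restrict Ω) →
      ∀ w ∈ dirichletSpace Ω ΓD,
      ∫⁻ x in Ω, ‖f x‖ₑ * ‖w.1 x‖ₑ ≤
        C * eLpNorm f p (volume.restrict Ω) * (‖w.1‖ₑ + ‖w.2‖ₑ) := by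
  obtain ⟨C, hC_top, hC⟩ := hΩ.hasConeProperty.exists_lintegral_mul_enorm_le_eLpNorm
    hΩ.isOpen.measurableSet hΩ.isBounded hp1 (by simpa using hpd)
  lift C to ℝ≥0 using hC_top
  refine ⟨C, fun f hf w hw => ?_⟩
  obtain ⟨wₙ, hwₙ, lim⟩ := mem_closure_iff_seq_limit.1 (mem_dirichletSpace.1 hw)
  have bound (n : ℕ) : ∫⁻ x in Ω, ‖f x‖ₑ * ‖(wₙ n).1 x‖ₑ ≤
      C * eLpNorm f p (volume.restrict Ω) * (‖(wₙ n).1‖ₑ + ‖(wₙ n).2.1‖ₑ) := by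
    obtain ⟨s, hs, h₁, h₂, -⟩ := hwₙ n
    have lintegral_eq : ∫⁻ x in Ω, ‖f x‖ₑ * ‖(wₙ n).1 x‖ₑ = ∫⁻ x in Ω, ‖f x‖ₑ * ‖s x‖ₑ :=
      lintegral_congr_ae (by filter_upwards [h₁] with x hx; rw [hx])
    rw [lintegral_eq, Lp.enorm_def, Lp.enorm_def, eLpNorm_congr_ae h₁, eLpNorm_congr_ae h₂]
    exact hC s hs f hf.1
  refine lintegral_mul_enorm_le_of_tendsto_Lp hf.1 lim.fst_nhds bound ?_
  exact ENNReal.Tendsto.const_mul (lim.fst_nhds.enorm.add lim.snd_nhds.fst_nhds.enorm)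
    (Or.inr (ENNReal.mul_ne_top ENNReal.coe_ne_top hf.2.ne))

theorem IsBoundedLipschitzDomain.exists_abs_integral_mul_fst_le
    (hΩ : IsBoundedLipschitzDomain Ω) {p : ℝ≥0∞} (hp1 : 1 ≤ p) (hpd : (d : ℝ≥0∞) / 2 < p) :
    ∃ C : ℝ≥0, ∀ f : EuclideanSpace ℝ (Fin d) → ℝ, MemLp f p (volume.restrict Ω) →
      ∀ w ∈ dirichletSpace Ω ΓD,
      Integrable (fun x => f x * w.1 x) (volume.restrict Ω) ∧
        |∫ x in Ω, f x * w.1 x| ≤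
          C * (eLpNorm f p (volume.restrict Ω)).toReal * (‖w.1‖ + ‖w.2‖) := by
  obtain ⟨C, hC⟩ := hΩ.exists_lintegral_mul_enorm_fst_le (ΓD := ΓD) hp1 hpd
  refine ⟨C, fun f hf w hw => ?_⟩
  have bound := hC f hf w hw
  simp_rw [← enorm_mul] at bound
  have bound_ne_top : C * eLpNorm f p (volume.restrict Ω) * (‖w.1‖ₑ + ‖w.2‖ₑ) ≠ ⊤ :=
    ENNReal.mul_ne_top (ENNReal.mul_ne_top ENNReal.coe_ne_top hf.2.ne) (by finiteness)
  refine ⟨⟨hf.1.mul (Lp.aestronglyMeasurable w.1), bound.trans_lt bound_ne_top.lt_top⟩, ?_⟩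
  have := ENNReal.toReal_mono bound_ne_top ((enorm_integral_le_lintegral_enorm _).trans bound)
  simpa [ENNReal.toReal_add] using this

end DirichletSpace

section Minimization

variable {E X : Type*} [NormedAddCommGroup E] [NormedSpace ℝ E] [ProperSpace E]
  [NormedAddCommGroup X] [NormedSpace ℝ X] [CompleteSpace X]

theorem exists_forall_le_of_uniformlyMidpointConvex {J : E × X → ℝ} (hJ : Continuous J)
    {δ B c : ℝ} (hδ : 0 < δ) (hc : 0 < c) (hcoer : ∀ p, δ * ‖p.1‖ - B ≤ J p)
    (hconv : ∀ p q, J ((1 / 2 : ℝ) • (p + q)) + c * ‖p.2 - q.2‖ ^ 2 ≤ (J p + J q) / 2) :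
    ∃ p, ∀ q, J p ≤ J q := by
  have bddBelow : BddBelow (range J) := by
    refine ⟨-B, ?_⟩
    rintro _ ⟨p, rfl⟩
    linarith [hcoer p, mul_nonneg hδ.le (norm_nonneg p.1)]
  have inf_le (q : E × X) : sInf (range J) ≤ J q := csInf_le bddBelow (mem_range_self q)
  obtain ⟨values, antitone_values, tendsto_values, mem_range⟩ :=
    exists_seq_tendsto_sInf (range_nonempty J) bddBelow
  choose p hp using mem_range
  have dist_le (n m k : ℕ) (hn : k ≤ n) (hm : k ≤ m) :
      dist (p n).2 (p m).2 ≤ Real.sqrt ((values k - sInf (range J)) / c) := by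
    refine Real.le_sqrt_of_sq_le ?_
    rw [le_div_iff₀ hc, dist_eq_norm]
    have midpoint_gap := hconv (p n) (p m)
    rw [hp, hp] at midpoint_gap
    linarith [antitone_values hn, antitone_values hm, inf_le ((1 / 2 : ℝ) • (p n + p m))]
  have cauchySeq_snd : CauchySeq fun n => (p n).2 := by
    refine cauchySeq_of_le_tendsto_0 _ dist_le ?_
    simpa using ((tendsto_values.sub_const (sInf (range J))).div_const c).sqrt
  obtain ⟨x, hx⟩ := cauchySeq_tendsto_of_complete cauchySeq_snd
  have fst_mem (n : ℕ) : (p n).1 ∈ Metric.closedBall (0 : E) ((values 0 + B) / δ) := by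
    rw [mem_closedBall_zero_iff, le_div_iff₀ hδ]
    linarith [hcoer (p n), hp n, antitone_values n.zero_le]
  obtain ⟨v, -, subseq, hsubseq, hv⟩ :=
    (isCompact_closedBall (0 : E) _).tendsto_subseq fst_mem
  have tendsto_p : Tendsto (fun n => p (subseq n)) atTop (𝓝 (v, x)) :=
    hv.prodMk_nhds (hx.comp hsubseq.tendsto_atTop)
  have J_eq : J (v, x) = sInf (range J) := by
    refine tendsto_nhds_unique ((hJ.tendsto _).comp tendsto_p) ?_
    simpa only [Function.comp_def, hp] using tendsto_values.comp hsubseq.tendsto_atTop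
  exact ⟨(v, x), fun q => J_eq.le.trans (inf_le q)⟩

theorem eq_zero_of_forall_mul_add_sq_nonneg {a b : ℝ} (h : ∀ t : ℝ, 0 ≤ t * a + t ^ 2 * b) :
    a = 0 := by
  have hasDerivAt : HasDerivAt (fun t : ℝ => t * a + t ^ 2 * b) a 0 := by
    simpa [Pi.add_def] using ((hasDerivAt_id' (0 : ℝ)).mul_const a).fun_add
      ((hasDerivAt_pow 2 (0 : ℝ)).mul_const b)
  exact IsLocalMin.hasDerivAt_eq_zero (.of_forall fun t => by simpa using h t) hasDerivAt

theorem norm_half_smul_add_sq {Y : Type*} [NormedAddCommGroup Y] [InnerProductSpace ℝ Y]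
    (x y : Y) :
    ‖(1 / 2 : ℝ) • (x + y)‖ ^ 2 = (‖x‖ ^ 2 + ‖y‖ ^ 2) / 2 - ‖x - y‖ ^ 2 / 4 := by
  have parallelogram := parallelogram_law_with_norm ℝ x y
  have norm_half : ‖(1 / 2 : ℝ)‖ = 1 / 2 := by norm_num
  rw [norm_smul, norm_half]
  linear_combination parallelogram / 4

end Minimization

theorem norm_le_max_mul_norm_snd {X Y : Type*} [NormedAddCommGroup X] [NormedSpace ℝ X]
    [NormedAddCommGroup Y] [NormedSpace ℝ Y] {V : Submodule ℝ (X × Y)} {C : ℝ≥0}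
    (hV : ∀ w ∈ V, ‖w.1‖ ≤ C * ‖w.2‖) (w : V) : ‖w‖ ≤ (max C 1 : ℝ≥0) * ‖w.1.2‖ := by
  refine max_le ((hV w.1 w.2).trans ?_) ?_
  · gcongr
    exact le_max_left _ _
  · exact le_mul_of_one_le_left (norm_nonneg _) (by exact_mod_cast le_max_right C 1)

theorem sq_le_mul_sq_of_le_mul {σ x y : ℝ} (hσ : σ ∈ Icc (0 : ℝ) 1) (hx : 0 ≤ x)
    (hxy : x ≤ σ * y) : x ^ 2 ≤ σ * y ^ 2 := by
  calc x ^ 2 ≤ (σ * y) ^ 2 := by gcongr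
    _ = σ * (σ * y ^ 2) := by ring
    _ ≤ σ * y ^ 2 :=
        mul_le_mul_of_nonneg_left (mul_le_of_le_one_left (sq_nonneg y) hσ.2) hσ.1

section ConvexPotential

variable {H Y : Type*} [NormedAddCommGroup H] [InnerProductSpace ℝ H]
  [NormedAddCommGroup Y] [InnerProductSpace ℝ Y]

/-- `Ψ` is a convex potential, normalized at zero, whose gradient `N` is bounded by `R`,
`L`-Lipschitz and strictly monotone, and `v ↦ Ψ (v • e - k) - M v` is coercive with a constant that
grows at most linearly in `k`. Convexity is encoded by the tangent inequality, which also says that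
`N` is a subgradient. -/
structure IsCoercivePotential (e : H) (M : ℝ) (Ψ : H → ℝ) (N : H → H) (L : ℝ≥0) (R δ A : ℝ) :
    Prop where
  apply_zero : Ψ 0 = 0
  tangent_le : ∀ h k, Ψ h + inner ℝ (N h) (k - h) ≤ Ψ k
  lipschitz : LipschitzWith L N
  norm_le : ∀ h, ‖N h‖ ≤ R
  eq_of_inner_sub_eq_zero : ∀ h k, inner ℝ (N h - N k) (h - k) = (0 : ℝ) → h = k
  nonneg : 0 ≤ A
  pos : 0 < δ
  coercive : ∀ v k, δ * |v| - A * (1 + ‖k‖) ≤ Ψ (v • e - k) - M * v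

/-- The pair `(v, w)` solves the abstract form of the constrained Poisson problem on the subspace
`V` of `H × Y`. The two components of an element of `H × Y` play the roles of a function and of its
gradient, `(h₀, g₀)` is the extension of the boundary data, so that `(h₀, g₀) + w` is the
potential, and `v • e - z • (h₀ + w.1)` is the argument of the statistics function. -/
structure IsConstrainedSolution (V : Submodule ℝ (H × Y)) (e : H) (M : ℝ) (N : H → H)
    (lam σ z : ℝ) (h₀ : H) (g₀ : Y) (ℓ : V → ℝ) (v : ℝ) (w : V) : Prop where
  mass : inner ℝ (N (v • e - z • (h₀ + w.1.1))) e = M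
  equation : ∀ φ : V, lam ^ 2 * inner ℝ (w.1.2 + g₀) φ.1.2 =
    ℓ φ + σ * (z * inner ℝ (N (v • e - z • (h₀ + w.1.1))) φ.1.1)

/-- The energy whose critical points `(v, w)` are the solutions of the constrained problem; the
Lagrange multiplier `v` of the mass constraint is an additional variable. -/
noncomputable def constrainedEnergy {V : Submodule ℝ (H × Y)} (e : H) (M : ℝ) (Ψ : H → ℝ)
    (lam σ z : ℝ) (h₀ : H) (g₀ : Y) (ℓ : V →L[ℝ] ℝ) (p : ℝ × V) : ℝ :=
  lam ^ 2 / 2 * ‖p.2.1.2 + g₀‖ ^ 2 - ℓ p.2 + σ * (Ψ (p.1 • e - z • (h₀ + p.2.1.1)) - M * p.1)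

namespace IsCoercivePotential

variable {e : H} {M : ℝ} {Ψ : H → ℝ} {N : H → H} {L : ℝ≥0} {R δ A : ℝ}

theorem apply_half_smul_add_le (hΨ : IsCoercivePotential e M Ψ N L R δ A) (h k : H) :
    Ψ ((1 / 2 : ℝ) • (h + k)) ≤ (Ψ h + Ψ k) / 2 := by
  set m := (1 / 2 : ℝ) • (h + k) with hm
  have inner_add_inner : inner ℝ (N m) (h - m) + inner ℝ (N m) (k - m) = (0 : ℝ) := by
    rw [← inner_add_right, show h - m + (k - m) = 0 by rw [hm]; module, inner_zero_right]
  linarith [hΨ.tangent_le m h, hΨ.tangent_le m k]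

theorem continuous (hΨ : IsCoercivePotential e M Ψ N L R δ A) : Continuous Ψ := by
  refine (LipschitzWith.of_le_add_mul R.toNNReal fun h k => ?_).continuous
  have R_nonneg : 0 ≤ R := (norm_nonneg _).trans (hΨ.norm_le 0)
  have inner_le : inner ℝ (N h) (h - k) ≤ R * ‖h - k‖ :=
    (real_inner_le_norm _ _).trans (by gcongr; exact hΨ.norm_le h)
  have tangent := hΨ.tangent_le h k
  rw [← neg_sub h k, inner_neg_right] at tangent
  rw [dist_eq_norm, Real.coe_toNNReal _ R_nonneg]
  linarith

theorem apply_add_le (hΨ : IsCoercivePotential e M Ψ N L R δ A) (h k : H) :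
    Ψ (h + k) ≤ Ψ h + inner ℝ (N h) k + L * ‖k‖ ^ 2 := by
  have tangent := hΨ.tangent_le (h + k) h
  rw [sub_add_cancel_left, inner_neg_right] at tangent
  have inner_le : inner ℝ (N (h + k) - N h) k ≤ L * ‖k‖ ^ 2 := by
    have norm_sub_le := hΨ.lipschitz.norm_sub_le (h + k) h
    rw [add_sub_cancel_left] at norm_sub_le
    calc inner ℝ (N (h + k) - N h) k ≤ ‖N (h + k) - N h‖ * ‖k‖ := real_inner_le_norm _ _
      _ ≤ L * ‖k‖ * ‖k‖ := by gcongr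
      _ = L * ‖k‖ ^ 2 := by ring
  rw [inner_sub_left] at inner_le
  linarith

theorem inner_sub_nonneg (hΨ : IsCoercivePotential e M Ψ N L R δ A) (h k : H) :
    0 ≤ inner ℝ (N h - N k) (h - k) := by
  have tangent := hΨ.tangent_le h k
  rw [← neg_sub h k, inner_neg_right] at tangent
  rw [inner_sub_left]
  linarith [hΨ.tangent_le k h]

theorem mul_abs_le_of_inner_eq (hΨ : IsCoercivePotential e M Ψ N L R δ A) {v : ℝ} {k : H}
    (mass : inner ℝ (N (v • e - k)) e = M) : δ * |v| ≤ (A + R) * (1 + ‖k‖) := by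
  have tangent := hΨ.tangent_le (v • e - k) 0
  rw [hΨ.apply_zero, zero_sub, inner_neg_right, inner_sub_right, inner_smul_right, mass]
    at tangent
  have neg_le_inner : -(R * ‖k‖) ≤ inner ℝ (N (v • e - k)) k := by
    refine (neg_le_neg ?_).trans (_root_.abs_le.1 (abs_real_inner_le_norm _ _)).1
    gcongr
    exact hΨ.norm_le _
  have R_nonneg : 0 ≤ R := (norm_nonneg _).trans (hΨ.norm_le 0)
  linarith [hΨ.coercive v k]

section Solutions

variable {V : Submodule ℝ (H × Y)} {C : ℝ≥0} {lam σ z : ℝ}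

theorem constrainedEnergy_half_smul_add_le (hΨ : IsCoercivePotential e M Ψ N L R δ A)
    (hV : ∀ w ∈ V, ‖w.1‖ ≤ C * ‖w.2‖) (hσ : 0 ≤ σ) (h₀ : H) (g₀ : Y) (ℓ : V →L[ℝ] ℝ)
    (p q : ℝ × V) :
    constrainedEnergy e M Ψ lam σ z h₀ g₀ ℓ ((1 / 2 : ℝ) • (p + q)) +
        lam ^ 2 / (8 * (max C 1 : ℝ≥0) ^ 2) * ‖p.2 - q.2‖ ^ 2 ≤
      (constrainedEnergy e M Ψ lam σ z h₀ g₀ ℓ p + constrainedEnergy e M Ψ lam σ z h₀ g₀ ℓ q) / 2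
    := by
  have norm_sub_sq_le : lam ^ 2 / (8 * (max C 1 : ℝ≥0) ^ 2) * ‖p.2 - q.2‖ ^ 2 ≤
      lam ^ 2 / 8 * ‖p.2.1.2 - q.2.1.2‖ ^ 2 := by
    calc _ ≤ lam ^ 2 / (8 * (max C 1 : ℝ≥0) ^ 2) *
          ((max C 1 : ℝ≥0) * ‖p.2.1.2 - q.2.1.2‖) ^ 2 := by
          gcongr
          exact norm_le_max_mul_norm_snd hV (p.2 - q.2)
      _ = _ := by field_simp
  have quadratic_eq := norm_half_smul_add_sq (p.2.1.2 + g₀) (q.2.1.2 + g₀)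
  rw [add_sub_add_right_eq_sub] at quadratic_eq
  have potential_le := mul_le_mul_of_nonneg_left (hΨ.apply_half_smul_add_le
    (p.1 • e - z • (h₀ + p.2.1.1)) (q.1 • e - z • (h₀ + q.2.1.1))) hσ
  have gradient_midpoint : ((1 / 2 : ℝ) • (p + q)).2.1.2 + g₀ =
      (1 / 2 : ℝ) • (p.2.1.2 + g₀ + (q.2.1.2 + g₀)) := by
    simp only [Prod.smul_snd, Prod.snd_add, Submodule.coe_smul, Submodule.coe_add]
    module
  have argument_midpoint : ((1 / 2 : ℝ) • (p + q)).1 • e -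
      z • (h₀ + ((1 / 2 : ℝ) • (p + q)).2.1.1) = (1 / 2 : ℝ) •
        (p.1 • e - z • (h₀ + p.2.1.1) + (q.1 • e - z • (h₀ + q.2.1.1))) := by
    simp only [Prod.smul_fst, Prod.fst_add, Prod.smul_snd, Prod.snd_add, Submodule.coe_smul,
      Submodule.coe_add, smul_eq_mul]
    module
  simp only [constrainedEnergy, gradient_midpoint, argument_midpoint, quadratic_eq]
  simp only [Prod.smul_fst, Prod.fst_add, Prod.smul_snd, Prod.snd_add, map_smul, map_add,
    smul_eq_mul]
  linarith

theorem exists_sub_le_constrainedEnergy (hΨ : IsCoercivePotential e M Ψ N L R δ A)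
    (hV : ∀ w ∈ V, ‖w.1‖ ≤ C * ‖w.2‖) (hlam : 0 < lam) (hσ : 0 ≤ σ) (h₀ : H) (g₀ : Y)
    (ℓ : V →L[ℝ] ℝ) :
    ∃ B, ∀ p, σ * δ * ‖p.1‖ - B ≤ constrainedEnergy e M Ψ lam σ z h₀ g₀ ℓ p := by
  set b := (‖ℓ‖ + σ * A * |z|) * (max C 1 : ℝ≥0) with hb
  have slope_nonneg : 0 ≤ ‖ℓ‖ + σ * A * |z| := by
    have := hΨ.nonneg
    positivity
  refine ⟨σ * A * (1 + |z| * ‖h₀‖) + b * ‖g₀‖ + b ^ 2 / (2 * lam ^ 2), fun ⟨v, w⟩ => ?_⟩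
  have norm_shift_le : ‖z • (h₀ + w.1.1)‖ ≤ |z| * (‖h₀‖ + ‖w‖) := by
    rw [norm_smul, Real.norm_eq_abs]
    gcongr
    exact (norm_add_le _ _).trans (by gcongr; exact norm_fst_le w.1)
  have potential_ge := mul_le_mul_of_nonneg_left (hΨ.coercive v (z • (h₀ + w.1.1))) hσ
  have shift_le := mul_le_mul_of_nonneg_left norm_shift_le (mul_nonneg hσ hΨ.nonneg)
  have load_le := (le_abs_self _).trans (ℓ.le_opNorm w)
  have norm_w_le : (‖ℓ‖ + σ * A * |z|) * ‖w‖ ≤ b * (‖w.1.2 + g₀‖ + ‖g₀‖) := by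
    have norm_snd_le : ‖w.1.2‖ ≤ ‖w.1.2 + g₀‖ + ‖g₀‖ := by
      simpa using norm_sub_le (w.1.2 + g₀) g₀
    calc _ ≤ (‖ℓ‖ + σ * A * |z|) * ((max C 1 : ℝ≥0) * (‖w.1.2 + g₀‖ + ‖g₀‖)) := by
          gcongr
          exact (norm_le_max_mul_norm_snd hV w).trans (by gcongr)
      _ = _ := by rw [hb]; ring
  have completed_square :
      0 ≤ lam ^ 2 / 2 * ‖w.1.2 + g₀‖ ^ 2 - b * ‖w.1.2 + g₀‖ + b ^ 2 / (2 * lam ^ 2) := by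
    calc (0 : ℝ) ≤ lam ^ 2 / 2 * (‖w.1.2 + g₀‖ - b / lam ^ 2) ^ 2 := by positivity
      _ = _ := by field_simp; ring
  simp only [constrainedEnergy, Real.norm_eq_abs]
  linarith

theorem eulerLagrange_of_forall_le (hΨ : IsCoercivePotential e M Ψ N L R δ A) (hσ : 0 ≤ σ)
    {h₀ : H} {g₀ : Y} {ℓ : V →L[ℝ] ℝ} {v : ℝ} {w : V}
    (hmin : ∀ q, constrainedEnergy e M Ψ lam σ z h₀ g₀ ℓ (v, w) ≤
      constrainedEnergy e M Ψ lam σ z h₀ g₀ ℓ q) (τ : ℝ) (φ : V) :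
    lam ^ 2 * inner ℝ (w.1.2 + g₀) φ.1.2 - ℓ φ +
      σ * (inner ℝ (N (v • e - z • (h₀ + w.1.1))) (τ • e - z • φ.1.1) - M * τ) = 0 := by
  set h := v • e - z • (h₀ + w.1.1) with hh
  set k := τ • e - z • φ.1.1 with hk
  refine eq_zero_of_forall_mul_add_sq_nonneg
    (b := lam ^ 2 / 2 * ‖φ.1.2‖ ^ 2 + σ * (L * ‖k‖ ^ 2)) fun t => ?_
  have energy_le := hmin (v + t * τ, w + t • φ)
  have argument_eq : (v + t * τ) • e - z • (h₀ + (w + t • φ).1.1) = h + t • k := by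
    simp only [hh, hk, Submodule.coe_add, Submodule.coe_smul, Prod.fst_add, Prod.smul_fst]
    module
  have gradient_eq : (w + t • φ).1.2 + g₀ = w.1.2 + g₀ + t • φ.1.2 := by
    simp only [Submodule.coe_add, Submodule.coe_smul, Prod.snd_add, Prod.smul_snd]
    abel
  simp only [constrainedEnergy, argument_eq, gradient_eq, ← hh, map_add, map_smul, smul_eq_mul,
    norm_add_sq_real (w.1.2 + g₀) (t • φ.1.2), inner_smul_right, norm_smul, mul_pow,
    Real.norm_eq_abs, sq_abs] at energy_le
  have potential_le := mul_le_mul_of_nonneg_left (hΨ.apply_add_le h (t • k)) hσ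
  rw [inner_smul_right, norm_smul, mul_pow, Real.norm_eq_abs, sq_abs] at potential_le
  linarith

theorem exists_isConstrainedSolution_of_pos [CompleteSpace H] [CompleteSpace Y]
    (hΨ : IsCoercivePotential e M Ψ N L R δ A) (hVc : IsClosed (V : Set (H × Y)))
    (hV : ∀ w ∈ V, ‖w.1‖ ≤ C * ‖w.2‖) (hlam : 0 < lam) (hσ : 0 < σ) (h₀ : H) (g₀ : Y)
    (ℓ : V →L[ℝ] ℝ) : ∃ v w, IsConstrainedSolution V e M N lam σ z h₀ g₀ ℓ v w := by
  have : CompleteSpace V := hVc.completeSpace_coe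
  have continuous_potential := hΨ.continuous
  have continuous_energy : Continuous (constrainedEnergy e M Ψ lam σ z h₀ g₀ ℓ) := by
    unfold constrainedEnergy
    fun_prop
  obtain ⟨B, coercive⟩ := hΨ.exists_sub_le_constrainedEnergy (z := z) hV hlam hσ.le h₀ g₀ ℓ
  obtain ⟨⟨v, w⟩, hmin⟩ := exists_forall_le_of_uniformlyMidpointConvex continuous_energy
    (mul_pos hσ hΨ.pos) (by positivity) coercive
    (hΨ.constrainedEnergy_half_smul_add_le hV hσ.le h₀ g₀ ℓ)
  have eulerLagrange := hΨ.eulerLagrange_of_forall_le hσ.le hmin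
  refine ⟨v, w, ?_, fun φ => ?_⟩
  · simpa [hσ.ne', sub_eq_zero] using eulerLagrange 1 0
  · have equation := eulerLagrange 0 φ
    rw [zero_smul, zero_sub, inner_neg_right, inner_smul_right] at equation
    linarith

theorem exists_isConstrainedSolution_smul [CompleteSpace H] [CompleteSpace Y]
    (hΨ : IsCoercivePotential e M Ψ N L R δ A) (hVc : IsClosed (V : Set (H × Y)))
    (hV : ∀ w ∈ V, ‖w.1‖ ≤ C * ‖w.2‖) (hlam : 0 < lam) (hσ : 0 ≤ σ) (h₀ : H) (g₀ : Y)
    (ℓ : V →L[ℝ] ℝ) :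
    ∃ v w, IsConstrainedSolution V e M N lam σ z (σ • h₀) (σ • g₀) (σ • ℓ) v w := by
  rcases hσ.eq_or_lt with rfl | hσ
  · obtain ⟨v, w, solution⟩ :=
      hΨ.exists_isConstrainedSolution_of_pos hVc hV (z := 0) hlam one_pos h₀ g₀ ℓ
    exact ⟨v, 0, by simpa using solution.mass, fun φ => by simp⟩
  · exact hΨ.exists_isConstrainedSolution_of_pos hVc hV hlam hσ (σ • h₀) (σ • g₀) (σ • ℓ)

theorem snd_eq (hΨ : IsCoercivePotential e M Ψ N L R δ A) (hlam : 0 < lam)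
    (hσ : 0 ≤ σ) {h₀ : H} {g₀ : Y} {ℓ : V → ℝ} {v v' : ℝ} {w w' : V}
    (hw : IsConstrainedSolution V e M N lam σ z h₀ g₀ ℓ v w)
    (hw' : IsConstrainedSolution V e M N lam σ z h₀ g₀ ℓ v' w') : w.1.2 = w'.1.2 := by
  set h := v • e - z • (h₀ + w.1.1) with hh
  set h' := v' • e - z • (h₀ + w'.1.1) with hh'
  have inner_sub_eq : inner ℝ (N h - N h') (h - h') =
      -(z * inner ℝ (N h - N h') (w.1.1 - w'.1.1)) := by
    have sub_eq : h - h' = (v - v') • e - z • (w.1.1 - w'.1.1) := by rw [hh, hh']; module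
    rw [sub_eq, inner_sub_right, inner_smul_right, inner_smul_right, inner_sub_left _ _ e,
      hw.mass, hw'.mass]
    ring
  have energy_eq : lam ^ 2 * ‖w.1.2 - w'.1.2‖ ^ 2 =
      -(σ * inner ℝ (N h - N h') (h - h')) := by
    have difference : lam ^ 2 * inner ℝ (w.1.2 + g₀ - (w'.1.2 + g₀)) (w.1.2 - w'.1.2) =
        σ * (z * inner ℝ (N h - N h') (w.1.1 - w'.1.1)) := by
      rw [inner_sub_left, inner_sub_left]
      linear_combination hw.equation (w - w') - hw'.equation (w - w')
    rw [inner_sub_eq, ← real_inner_self_eq_norm_sq]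
    rw [add_sub_add_right_eq_sub] at difference
    linear_combination difference
  have energy_nonpos : lam ^ 2 * ‖w.1.2 - w'.1.2‖ ^ 2 ≤ 0 :=
    energy_eq.trans_le (neg_nonpos.2 (mul_nonneg hσ (hΨ.inner_sub_nonneg h h')))
  rw [← sub_eq_zero, ← norm_eq_zero, ← sq_eq_zero_iff]
  exact le_antisymm (nonpos_of_mul_nonpos_right energy_nonpos (by positivity)) (by positivity)

theorem isConstrainedSolution_unique (hΨ : IsCoercivePotential e M Ψ N L R δ A) (he : e ≠ 0)
    (hV : ∀ w ∈ V, ‖w.1‖ ≤ C * ‖w.2‖) (hlam : 0 < lam) (hσ : 0 ≤ σ) {h₀ : H} {g₀ : Y}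
    {ℓ : V → ℝ} {v v' : ℝ} {w w' : V}
    (hw : IsConstrainedSolution V e M N lam σ z h₀ g₀ ℓ v w)
    (hw' : IsConstrainedSolution V e M N lam σ z h₀ g₀ ℓ v' w') : v = v' ∧ w = w' := by
  have snd_eq := hΨ.snd_eq hlam hσ hw hw'
  have fst_eq : w.1.1 = w'.1.1 := by
    have norm_le := hV (w - w').1 (w - w').2
    rw [show (w - w').1.2 = 0 from sub_eq_zero.2 snd_eq, norm_zero, mul_zero] at norm_le
    exact sub_eq_zero.1 (norm_le_zero_iff.1 norm_le)
  have argument_eq : v • e - z • (h₀ + w.1.1) = v' • e - z • (h₀ + w'.1.1) := by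
    refine hΨ.eq_of_inner_sub_eq_zero _ _ ?_
    rw [fst_eq, sub_sub_sub_cancel_right, ← sub_smul, inner_smul_right, inner_sub_left]
    have mass := hw.mass
    rw [fst_eq] at mass
    rw [mass, hw'.mass, sub_self, mul_zero]
  rw [fst_eq, sub_left_inj] at argument_eq
  exact ⟨smul_left_injective ℝ he argument_eq, Subtype.ext (Prod.ext fst_eq snd_eq)⟩

theorem norm_snd_le (hΨ : IsCoercivePotential e M Ψ N L R δ A)
    (hV : ∀ w ∈ V, ‖w.1‖ ≤ C * ‖w.2‖) (hlam : 0 < lam) (hσ : 0 ≤ σ) {h₀ : H} {g₀ : Y}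
    {ℓ : V →L[ℝ] ℝ} {b v : ℝ} {w : V} (hb : 0 ≤ b) (hℓ : |ℓ w| ≤ b * ‖w.1.2‖)
    (hw : IsConstrainedSolution V e M N lam σ z (σ • h₀) (σ • g₀) (σ • ℓ) v w) :
    ‖w.1.2‖ ≤ σ * (‖g₀‖ + (lam ^ 2)⁻¹ * (b + |z| * R * C)) := by
  have R_nonneg : 0 ≤ R := (norm_nonneg _).trans (hΨ.norm_le 0)
  set h := v • e - z • (σ • h₀ + w.1.1)
  have charge_le : z * inner ℝ (N h) w.1.1 ≤ |z| * R * C * ‖w.1.2‖ := by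
    calc z * inner ℝ (N h) w.1.1 ≤ |z| * |inner ℝ (N h) w.1.1| :=
          (le_abs_self _).trans (abs_mul _ _).le
      _ ≤ |z| * (R * (C * ‖w.1.2‖)) := by
          gcongr
          refine (abs_real_inner_le_norm _ _).trans ?_
          gcongr
          exacts [hΨ.norm_le h, hV w.1 w.2]
      _ = _ := by ring
  have boundary_le : -inner ℝ g₀ w.1.2 ≤ ‖g₀‖ * ‖w.1.2‖ :=
    (neg_le_abs _).trans (abs_real_inner_le_norm _ _)
  have tested : lam ^ 2 * (‖w.1.2‖ ^ 2 + σ * inner ℝ g₀ w.1.2) =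
      σ * (ℓ w + z * inner ℝ (N h) w.1.1) := by
    have equation := hw.equation w
    rw [inner_add_left, real_inner_self_eq_norm_sq, real_inner_smul_left] at equation
    rw [equation, mul_add]
    rfl
  have sq_le : ‖w.1.2‖ ^ 2 ≤ σ * (‖g₀‖ + (lam ^ 2)⁻¹ * (b + |z| * R * C)) * ‖w.1.2‖ := by
    calc ‖w.1.2‖ ^ 2 = (lam ^ 2)⁻¹ * (lam ^ 2 * (‖w.1.2‖ ^ 2 + σ * inner ℝ g₀ w.1.2)) +
          σ * -inner ℝ g₀ w.1.2 := by field_simp; ring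
      _ ≤ (lam ^ 2)⁻¹ * (σ * (b * ‖w.1.2‖ + |z| * R * C * ‖w.1.2‖)) +
          σ * (‖g₀‖ * ‖w.1.2‖) := by
          rw [tested]
          gcongr
          exact (le_abs_self _).trans hℓ
      _ = _ := by ring
  rcases (norm_nonneg w.1.2).eq_or_lt with norm_eq | norm_pos
  · rw [← norm_eq]
    positivity
  · exact le_of_mul_le_mul_right ((sq _).symm.trans_le sq_le) norm_pos

theorem norm_snd_le_mul (hΨ : IsCoercivePotential e M Ψ N L R δ A)
    (hV : ∀ w ∈ V, ‖w.1‖ ≤ C * ‖w.2‖) (hlam : 0 < lam) (hσ : 0 ≤ σ) {D ζ : ℝ≥0} (hz : |z| ≤ ζ)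
    {h₀ : H} {g₀ : Y} {ℓ : V →L[ℝ] ℝ} {n q v : ℝ} {w : V} (hn : 0 ≤ n)
    (hℓ : |ℓ w| ≤ D * n * (‖w.1.1‖ + ‖w.1.2‖)) (hq : 1 ≤ q) (hg₀q : ‖g₀‖ ≤ q) (hnq : n ≤ q)
    (hw : IsConstrainedSolution V e M N lam σ z (σ • h₀) (σ • g₀) (σ • ℓ) v w) :
    ‖w.1.2‖ ≤ σ * ((1 + (lam ^ 2)⁻¹ * (D * (C + 1) + ζ * R * C)) * q) := by
  have R_nonneg : 0 ≤ R := (norm_nonneg _).trans (hΨ.norm_le 0)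
  have load_le : |ℓ w| ≤ D * n * (C + 1) * ‖w.1.2‖ := by
    calc |ℓ w| ≤ D * n * (‖w.1.1‖ + ‖w.1.2‖) := hℓ
      _ ≤ D * n * (C * ‖w.1.2‖ + ‖w.1.2‖) := by gcongr; exact hV w.1 w.2
      _ = _ := by ring
  have charge_le : |z| * R * C ≤ ζ * R * C * q := by
    calc |z| * R * C ≤ ζ * R * C := by gcongr
      _ ≤ ζ * R * C * q := le_mul_of_one_le_right (by positivity) hq
  calc ‖w.1.2‖ ≤ σ * (‖g₀‖ + (lam ^ 2)⁻¹ * (D * n * (C + 1) + |z| * R * C)) :=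
        hΨ.norm_snd_le hV hlam hσ (by positivity) load_le hw
    _ ≤ σ * (q + (lam ^ 2)⁻¹ * (D * q * (C + 1) + ζ * R * C * q)) := by
        gcongr σ * (?_ + (lam ^ 2)⁻¹ * (?_ + ?_))
        gcongr
    _ = _ := by ring

theorem mul_abs_add_norm_sq_le (hΨ : IsCoercivePotential e M Ψ N L R δ A)
    (hV : ∀ w ∈ V, ‖w.1‖ ≤ C * ‖w.2‖) (hσ : σ ∈ Icc (0 : ℝ) 1) {ζ : ℝ≥0} (hz : |z| ≤ ζ)
    {h₀ : H} {g₀ : Y} {ℓ : V → ℝ} {B q v : ℝ} {w : V} (hB : 0 ≤ B) (hq : 1 ≤ q)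
    (hh₀q : ‖h₀‖ ≤ q) (hg₀q : ‖g₀‖ ≤ q) (hwq : ‖w.1.2‖ ≤ σ * (B * q))
    (hw : IsConstrainedSolution V e M N lam σ z (σ • h₀) (σ • g₀) ℓ v w) :
    σ * |v| + (‖σ • h₀ + w.1.1‖ ^ 2 + ‖w.1.2 + σ • g₀‖ ^ 2) ≤
      σ * ((A + R) * (1 + ζ * (1 + C * B)) / δ + (1 + C * B) ^ 2 + (1 + B) ^ 2) * q ^ 2 := by
  have R_nonneg : 0 ≤ R := (norm_nonneg _).trans (hΨ.norm_le 0)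
  have A_nonneg := hΨ.nonneg
  have hσ0 := hσ.1
  have hσ1 := hσ.2
  have fst_le : ‖σ • h₀ + w.1.1‖ ≤ σ * ((1 + C * B) * q) := by
    calc ‖σ • h₀ + w.1.1‖ ≤ ‖σ • h₀‖ + ‖w.1.1‖ := norm_add_le _ _
      _ ≤ σ * q + C * (σ * (B * q)) := by
          rw [norm_smul, Real.norm_of_nonneg hσ0]
          gcongr
          exact (hV w.1 w.2).trans (by gcongr)
      _ = _ := by ring
  have snd_le : ‖w.1.2 + σ • g₀‖ ≤ σ * ((1 + B) * q) := by
    calc ‖w.1.2 + σ • g₀‖ ≤ ‖w.1.2‖ + ‖σ • g₀‖ := norm_add_le _ _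
      _ ≤ σ * (B * q) + σ * q := by rw [norm_smul, Real.norm_of_nonneg hσ0]; gcongr
      _ = _ := by ring
  have abs_le : |v| ≤ (A + R) * (1 + ζ * (1 + C * B)) / δ * q ^ 2 := by
    rw [div_mul_eq_mul_div, le_div_iff₀' hΨ.pos]
    calc δ * |v| ≤ (A + R) * (1 + |z| * ‖σ • h₀ + w.1.1‖) := by
          simpa only [norm_smul, Real.norm_eq_abs] using hΨ.mul_abs_le_of_inner_eq hw.mass
      _ ≤ (A + R) * (q + ζ * (1 * ((1 + C * B) * q))) := by
          gcongr
          exact fst_le.trans (by gcongr)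
      _ = (A + R) * (1 + ζ * (1 + C * B)) * q := by ring
      _ ≤ (A + R) * (1 + ζ * (1 + C * B)) * q ^ 2 := by
          gcongr
          exact le_self_pow₀ hq two_ne_zero
  calc _ ≤ σ * ((A + R) * (1 + ζ * (1 + C * B)) / δ * q ^ 2) +
        (σ * ((1 + C * B) * q) ^ 2 + σ * ((1 + B) * q) ^ 2) := by
        gcongr
        exacts [sq_le_mul_sq_of_le_mul hσ (norm_nonneg _) fst_le,
          sq_le_mul_sq_of_le_mul hσ (norm_nonneg _) snd_le]
    _ = _ := by ring

theorem exists_mul_abs_add_norm_sq_le (hΨ : IsCoercivePotential e M Ψ N L R δ A)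
    (hV : ∀ w ∈ V, ‖w.1‖ ≤ C * ‖w.2‖) (hlam : 0 < lam) (D ζ : ℝ≥0) :
    ∃ K > 0, ∀ σ ∈ Icc (0 : ℝ) 1, ∀ z : ℝ, |z| ≤ ζ → ∀ (h₀ : H) (g₀ : Y) (ℓ : V →L[ℝ] ℝ),
      ∀ n ≥ 0, (∀ w, |ℓ w| ≤ D * n * (‖w.1.1‖ + ‖w.1.2‖)) → ∀ v w,
      IsConstrainedSolution V e M N lam σ z (σ • h₀) (σ • g₀) (σ • ℓ) v w →
        σ * |v| + (‖σ • h₀ + w.1.1‖ ^ 2 + ‖w.1.2 + σ • g₀‖ ^ 2) ≤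
          σ * K * (1 + (‖h₀‖ ^ 2 + ‖g₀‖ ^ 2) + n ^ 2) := by
  have R_nonneg : 0 ≤ R := (norm_nonneg _).trans (hΨ.norm_le 0)
  have A_nonneg := hΨ.nonneg
  have δ_pos := hΨ.pos
  set B := 1 + (lam ^ 2)⁻¹ * (D * (C + 1) + ζ * R * C)
  refine ⟨(A + R) * (1 + ζ * (1 + C * B)) / δ + (1 + C * B) ^ 2 + (1 + B) ^ 2, by positivity,
    fun σ hσ z hz h₀ g₀ ℓ n hn hℓ v w hw => ?_⟩
  set Q := 1 + (‖h₀‖ ^ 2 + ‖g₀‖ ^ 2) + n ^ 2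
  have le_sqrt {x : ℝ} (hx : x ^ 2 ≤ Q) : x ≤ √Q := Real.le_sqrt_of_sq_le hx
  have one_le : 1 ≤ √Q :=
    le_sqrt (by linarith [sq_nonneg ‖h₀‖, sq_nonneg ‖g₀‖, sq_nonneg n])
  have h₀_le : ‖h₀‖ ≤ √Q := le_sqrt (by linarith [sq_nonneg ‖g₀‖, sq_nonneg n])
  have g₀_le : ‖g₀‖ ≤ √Q := le_sqrt (by linarith [sq_nonneg ‖h₀‖, sq_nonneg n])
  have n_le : n ≤ √Q := le_sqrt (by linarith [sq_nonneg ‖h₀‖, sq_nonneg ‖g₀‖])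
  have snd_le := hΨ.norm_snd_le_mul hV hlam hσ.1 hz hn (hℓ w) one_le g₀_le n_le hw
  have estimate := hΨ.mul_abs_add_norm_sq_le hV hσ hz (by positivity) one_le h₀_le g₀_le snd_le hw
  rwa [Real.sq_sqrt (by positivity)] at estimate

end Solutions

end IsCoercivePotential

end ConvexPotential

section StatisticsPotential

/-- The primitive of a statistics function `F` that vanishes at zero. -/
noncomputable def ionPotential (F : ℝ → ℝ) (s : ℝ) : ℝ := ∫ t in (0 : ℝ)..s, F t

variable {F : ℝ → ℝ}

theorem hasDerivAt_ionPotential (hF : Continuous F) (s : ℝ) :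
    HasDerivAt (ionPotential F) (F s) s :=
  intervalIntegral.integral_hasDerivAt_right (hF.intervalIntegrable _ _)
    (hF.stronglyMeasurableAtFilter _ _) hF.continuousAt

theorem continuous_ionPotential (hF : Continuous F) : Continuous (ionPotential F) :=
  continuous_iff_continuousAt.2 fun s => (hasDerivAt_ionPotential hF s).continuousAt

theorem ionPotential_add_mul_sub_le (hF : Continuous F) (hmono : Monotone F) (a b : ℝ) :
    ionPotential F a + F a * (b - a) ≤ ionPotential F b := by
  have deriv_eq : deriv (ionPotential F) = F :=
    funext fun s => (hasDerivAt_ionPotential hF s).deriv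
  have convexOn : ConvexOn ℝ univ (ionPotential F) :=
    Monotone.convexOn_univ_of_deriv
      (fun s => (hasDerivAt_ionPotential hF s).differentiableAt) (deriv_eq.symm ▸ hmono)
  rcases lt_trichotomy a b with hab | rfl | hba
  · have slope_ge := convexOn.le_slope_of_hasDerivAt (mem_univ a) (mem_univ b) hab
      (hasDerivAt_ionPotential hF a)
    rw [slope_def_field, le_div_iff₀ (sub_pos.2 hab)] at slope_ge
    linarith
  · simp
  · have slope_le := convexOn.slope_le_of_hasDerivAt (mem_univ b) (mem_univ a) hba
      (hasDerivAt_ionPotential hF a)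
    rw [slope_def_field, div_le_iff₀ (sub_pos.2 hba)] at slope_le
    linarith

theorem abs_ionPotential_le {S : ℝ} (hS : ∀ t, |F t| ≤ S) (a : ℝ) :
    |ionPotential F a| ≤ S * |a| := by
  simpa [ionPotential] using
    intervalIntegral.norm_integral_le_of_norm_le_const (a := 0) (b := a) (f := F) fun t _ => hS t

end StatisticsPotential

section Constants

variable {α : Type*} [MeasurableSpace α] {μ : Measure α} [IsFiniteMeasure μ]

theorem smul_const_one (v : ℝ) : v • Lp.const 2 μ (1 : ℝ) = Lp.const 2 μ v := by
  simpa using ((Lp.constₗ 2 μ ℝ : ℝ →ₗ[ℝ] Lp ℝ 2 μ).map_smul v 1).symm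

theorem inner_const_one (h : Lp ℝ 2 μ) :
    inner ℝ h (Lp.const 2 μ (1 : ℝ)) = ∫ x, h x ∂μ := by
  rw [L2.inner_def]
  refine integral_congr_ae ?_
  filter_upwards [Lp.coeFn_const (1 : ℝ) (p := 2) (μ := μ)] with x hx
  rw [hx, Function.const_apply, RCLike.inner_apply', conj_trivial, mul_one]

theorem norm_const_one_sq : ‖Lp.const 2 μ (1 : ℝ)‖ ^ 2 = μ.real univ := by
  rw [← real_inner_self_eq_norm_sq, inner_const_one,
    integral_congr_ae (Lp.coeFn_const (1 : ℝ) (p := 2) (μ := μ))]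
  simp

end Constants

/-- A strictly increasing Lipschitz statistics function `F` with range `(0, S)`: the properties of
an ion statistics that the existence and uniqueness theory relies on. -/
structure IsSaturatingStatistics (F : ℝ → ℝ) (S : ℝ) (L : ℝ≥0) : Prop where
  strictMono : StrictMono F
  range_eq : range F = Ioo 0 S
  lipschitz : LipschitzWith L F

namespace IsSaturatingStatistics

variable {F : ℝ → ℝ} {S : ℝ} {L : ℝ≥0}

theorem mem_Ioo (hF : IsSaturatingStatistics F S L) (x : ℝ) : F x ∈ Ioo 0 S :=
  hF.range_eq ▸ mem_range_self x

theorem abs_le (hF : IsSaturatingStatistics F S L) (x : ℝ) : |F x| ≤ S := by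
  rw [abs_of_pos (hF.mem_Ioo x).1]
  exact (hF.mem_Ioo x).2.le

theorem mul_sub_nonneg (hF : IsSaturatingStatistics F S L) (a b : ℝ) :
    0 ≤ (F a - F b) * (a - b) := by
  rcases le_total a b with hab | hba
  · exact mul_nonneg_of_nonpos_of_nonpos (sub_nonpos.2 (hF.strictMono.monotone hab))
      (sub_nonpos.2 hab)
  · exact mul_nonneg (sub_nonneg.2 (hF.strictMono.monotone hba)) (sub_nonneg.2 hba)

variable {α : Type*} [MeasurableSpace α] {μ : Measure α} [IsFiniteMeasure μ]

/-- The superposition operator `h ↦ F ∘ h` on `L²`. -/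
noncomputable def superposition (hF : IsSaturatingStatistics F S L) (h : Lp ℝ 2 μ) : Lp ℝ 2 μ :=
  MemLp.toLp (fun x => F (h x)) <| .of_bound
    (hF.lipschitz.continuous.comp_aestronglyMeasurable (Lp.aestronglyMeasurable h)) S
    (.of_forall fun x => hF.abs_le (h x))

theorem coeFn_superposition (hF : IsSaturatingStatistics F S L) (h : Lp ℝ 2 μ) :
    hF.superposition h =ᵐ[μ] fun x => F (h x) := MemLp.coeFn_toLp _

theorem coeFn_superposition_sub (hF : IsSaturatingStatistics F S L) (h k : Lp ℝ 2 μ) :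
    ⇑(hF.superposition h - hF.superposition k) =ᵐ[μ] fun x => F (h x) - F (k x) :=
  (Lp.coeFn_sub _ _).trans ((hF.coeFn_superposition h).sub (hF.coeFn_superposition k))

theorem superposition_const (hF : IsSaturatingStatistics F S L) (s : ℝ) :
    hF.superposition (Lp.const 2 μ s) = Lp.const 2 μ (F s) := by
  refine Lp.ext ?_
  filter_upwards [hF.coeFn_superposition (Lp.const 2 μ s), Lp.coeFn_const s (p := 2) (μ := μ),
    Lp.coeFn_const (F s) (p := 2) (μ := μ)] with x apply_superposition apply_const apply_image
  rw [apply_superposition, apply_const, apply_image, Function.const_apply, Function.const_apply]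

theorem lipschitzWith_superposition (hF : IsSaturatingStatistics F S L) :
    LipschitzWith L (hF.superposition (μ := μ)) := by
  refine .of_dist_le_mul fun h k => ?_
  rw [dist_eq_norm, dist_eq_norm]
  refine Lp.norm_le_mul_norm_of_ae_le_mul ?_
  filter_upwards [hF.coeFn_superposition_sub h k, Lp.coeFn_sub h k] with x apply_left apply_right
  rw [apply_left, apply_right]
  exact hF.lipschitz.norm_sub_le _ _

theorem norm_superposition_le (hF : IsSaturatingStatistics F S L) (h : Lp ℝ 2 μ) :
    ‖hF.superposition h‖ ≤ S * ‖Lp.const 2 μ (1 : ℝ)‖ := by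
  refine Lp.norm_le_mul_norm_of_ae_le_mul ?_
  filter_upwards [hF.coeFn_superposition h, Lp.coeFn_const (1 : ℝ) (p := 2) (μ := μ)]
    with x apply_left apply_one
  rw [apply_left, apply_one, Function.const_apply, norm_one, mul_one]
  exact hF.abs_le _

theorem eq_of_inner_superposition_sub_eq_zero (hF : IsSaturatingStatistics F S L)
    (h k : Lp ℝ 2 μ) (hhk : inner ℝ (hF.superposition h - hF.superposition k) (h - k) = (0 : ℝ)) :
    h = k := by
  have inner_ae_eq : (fun x => inner ℝ ((hF.superposition h - hF.superposition k) x) ((h - k) x))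
      =ᵐ[μ] fun x => (F (h x) - F (k x)) * (h x - k x) := by
    filter_upwards [hF.coeFn_superposition_sub h k, Lp.coeFn_sub h k] with x apply_left apply_right
    rw [apply_left, apply_right, RCLike.inner_apply', conj_trivial, Pi.sub_apply]
  have integrable : Integrable (fun x => (F (h x) - F (k x)) * (h x - k x)) μ :=
    (L2.integrable_inner (𝕜 := ℝ) _ _).congr inner_ae_eq
  rw [L2.inner_def, integral_congr_ae inner_ae_eq,
    integral_eq_zero_iff_of_nonneg (fun x => hF.mul_sub_nonneg _ _) integrable] at hhk
  refine Lp.ext ?_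
  filter_upwards [hhk] with x mul_eq_zero
  rcases _root_.mul_eq_zero.1 mul_eq_zero with image_eq | eq
  · exact hF.strictMono.injective (sub_eq_zero.1 image_eq)
  · exact sub_eq_zero.1 eq

theorem integrable_ionPotential (hF : IsSaturatingStatistics F S L) (h : Lp ℝ 2 μ) :
    Integrable (fun x => ionPotential F (h x)) μ :=
  (((Lp.memLp h).integrable (by norm_num)).abs.const_mul S).mono'
    ((continuous_ionPotential hF.lipschitz.continuous).comp_aestronglyMeasurable
      (Lp.aestronglyMeasurable h))
    (.of_forall fun x => abs_ionPotential_le hF.abs_le _)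

theorem integral_ionPotential_add_inner_le (hF : IsSaturatingStatistics F S L) (h k : Lp ℝ 2 μ) :
    ∫ x, ionPotential F (h x) ∂μ + inner ℝ (hF.superposition h) (k - h) ≤
      ∫ x, ionPotential F (k x) ∂μ := by
  have integrable_inner : Integrable (fun x => inner ℝ (hF.superposition h x) ((k - h) x)) μ :=
    L2.integrable_inner _ _
  rw [L2.inner_def, ← integral_add (hF.integrable_ionPotential h) integrable_inner]
  refine integral_mono_ae ((hF.integrable_ionPotential h).add integrable_inner)
    (hF.integrable_ionPotential k) ?_
  filter_upwards [hF.coeFn_superposition h, Lp.coeFn_sub k h] with x apply_left apply_right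
  simp only [apply_left, apply_right, Pi.sub_apply, RCLike.inner_apply', conj_trivial]
  exact ionPotential_add_mul_sub_le hF.lipschitz.continuous hF.strictMono.monotone _ _

/-- The tangent inequality at the constant function `s`: choosing `F s` above and below `M / μ univ`
makes the energy coercive in `v`. -/
theorem le_integral_ionPotential (hF : IsSaturatingStatistics F S L) (s v : ℝ) (k : Lp ℝ 2 μ) :
    (ionPotential F s - F s * s) * μ.real univ + F s * μ.real univ * v -
        S * ‖Lp.const 2 μ (1 : ℝ)‖ * ‖k‖ ≤
      ∫ x, ionPotential F ((v • Lp.const 2 μ (1 : ℝ) - k : Lp ℝ 2 μ) x) ∂μ := by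
  have tangent := hF.integral_ionPotential_add_inner_le (Lp.const 2 μ s)
    (v • Lp.const 2 μ (1 : ℝ) - k)
  have integral_const : ∫ x, ionPotential F (Lp.const 2 μ s x) ∂μ =
      ionPotential F s * μ.real univ := by
    refine (integral_congr_ae ((Lp.coeFn_const s (p := 2) (μ := μ)).fun_comp
      (ionPotential F))).trans ?_
    simp [mul_comm]
  have sub_eq : v • Lp.const 2 μ (1 : ℝ) - k - Lp.const 2 μ s =
      (v - s) • Lp.const 2 μ (1 : ℝ) - k := by
    rw [← smul_const_one s]
    module
  rw [hF.superposition_const, integral_const, sub_eq, ← smul_const_one (F s), inner_sub_right,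
    real_inner_smul_left, real_inner_smul_left, inner_smul_right, real_inner_self_eq_norm_sq,
    norm_const_one_sq] at tangent
  have inner_le : F s * inner ℝ (Lp.const 2 μ (1 : ℝ)) k ≤ S * (‖Lp.const 2 μ (1 : ℝ)‖ * ‖k‖) :=
    (mul_le_mul_of_nonneg_left (real_inner_le_norm _ _) (hF.mem_Ioo s).1.le).trans
      (mul_le_mul_of_nonneg_right (hF.mem_Ioo s).2.le (by positivity))
  linarith

theorem exists_coercive (hF : IsSaturatingStatistics F S L) {M : ℝ} (hM : 0 < M)
    (hMS : M < μ.real univ * S) :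
    ∃ δ > 0, ∃ A ≥ 0, ∀ (v : ℝ) (k : Lp ℝ 2 μ), δ * |v| - A * (1 + ‖k‖) ≤
      ∫ x, ionPotential F ((v • Lp.const 2 μ (1 : ℝ) - k : Lp ℝ 2 μ) x) ∂μ - M * v := by
  have hm : 0 < μ.real univ := measureReal_nonneg.lt_of_ne' fun h => by
    rw [h, zero_mul] at hMS
    exact hMS.not_gt hM
  have div_lt : M / μ.real univ < S := (div_lt_iff₀' hm).2 hMS
  obtain ⟨a, F_a_pos, F_a_lt⟩ := exists_between (div_pos hM hm)
  obtain ⟨b, lt_F_b, F_b_lt⟩ := exists_between div_lt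
  obtain ⟨a, rfl⟩ : a ∈ range F := hF.range_eq ▸ ⟨F_a_pos, F_a_lt.trans div_lt⟩
  obtain ⟨b, rfl⟩ : b ∈ range F := hF.range_eq ▸ ⟨F_a_pos.trans (F_a_lt.trans lt_F_b), F_b_lt⟩
  rw [lt_div_iff₀ hm] at F_a_lt
  rw [div_lt_iff₀ hm] at lt_F_b
  set c : ℝ → ℝ := fun s => (ionPotential F s - F s * s) * μ.real univ
  set R := S * ‖Lp.const 2 μ (1 : ℝ)‖
  have hR : 0 ≤ R := (norm_nonneg _).trans (hF.norm_superposition_le 0)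
  refine ⟨min (M - F a * μ.real univ) (F b * μ.real univ - M),
    lt_min (sub_pos.2 F_a_lt) (sub_pos.2 lt_F_b), |c a| + |c b| + R, by positivity, fun v k => ?_⟩
  have remainder_nonneg : 0 ≤ (|c a| + |c b|) * ‖k‖ := by positivity
  rcases le_total 0 v with hv | hv
  · rw [abs_of_nonneg hv]
    have growth := mul_le_mul_of_nonneg_right
      (min_le_right (M - F a * μ.real univ) (F b * μ.real univ - M)) hv
    linarith [hF.le_integral_ionPotential b v k, neg_abs_le (c b), abs_nonneg (c a)]
  · rw [abs_of_nonpos hv]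
    have growth := mul_le_mul_of_nonneg_right
      (min_le_left (M - F a * μ.real univ) (F b * μ.real univ - M)) (neg_nonneg.2 hv)
    linarith [hF.le_integral_ionPotential a v k, neg_abs_le (c a), abs_nonneg (c b)]

theorem exists_isCoercivePotential (hF : IsSaturatingStatistics F S L) {M : ℝ} (hM : 0 < M)
    (hMS : M < μ.real univ * S) :
    ∃ δ A : ℝ, IsCoercivePotential (Lp.const 2 μ (1 : ℝ)) M
      (fun h => ∫ x, ionPotential F (h x) ∂μ) hF.superposition L
      (S * ‖Lp.const 2 μ (1 : ℝ)‖) δ A := by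
  obtain ⟨δ, hδ, A, hA, coercive⟩ := hF.exists_coercive (μ := μ) hM hMS
  refine ⟨δ, A, ?_, hF.integral_ionPotential_add_inner_le, hF.lipschitzWith_superposition,
    hF.norm_superposition_le, hF.eq_of_inner_superposition_sub_eq_zero, hA, hδ, coercive⟩
  refine (integral_congr_ae ((Lp.coeFn_zero ℝ 2 μ).fun_comp (ionPotential F))).trans ?_
  simp [ionPotential]

end IsSaturatingStatistics

section Integrals

variable {α : Type*} [MeasurableSpace α] {μ : Measure α}

theorem integral_mul_coeFn_add {f : α → ℝ} {u u' : Lp ℝ 2 μ}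
    (h : Integrable (fun x => f x * u x) μ) (h' : Integrable (fun x => f x * u' x) μ) :
    ∫ x, f x * (u + u' : Lp ℝ 2 μ) x ∂μ = ∫ x, f x * u x ∂μ + ∫ x, f x * u' x ∂μ := by
  rw [← integral_add h h']
  refine integral_congr_ae ?_
  filter_upwards [Lp.coeFn_add u u'] with x apply_add
  rw [apply_add, Pi.add_apply, mul_add]

theorem integral_mul_coeFn_smul (f : α → ℝ) (c : ℝ) (u : Lp ℝ 2 μ) :
    ∫ x, f x * (c • u : Lp ℝ 2 μ) x ∂μ = c * ∫ x, f x * u x ∂μ := by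
  rw [← integral_const_mul]
  refine integral_congr_ae ?_
  filter_upwards [Lp.coeFn_smul c u] with x apply_smul
  rw [apply_smul, Pi.smul_apply, smul_eq_mul, mul_left_comm]

theorem integral_inner_congr {E : Type*} [NormedAddCommGroup E] [InnerProductSpace ℝ E]
    {a b : α → E} {a' b' : Lp E 2 μ} (ha : a =ᵐ[μ] a') (hb : b =ᵐ[μ] b') :
    ∫ x, inner ℝ (a x) (b x) ∂μ = inner ℝ a' b' := by
  rw [L2.inner_def]
  refine integral_congr_ae ?_
  filter_upwards [ha, hb] with x ha hb
  rw [ha, hb]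

theorem add_mul_mul_ae_eq {f g φ : α → ℝ} {N k : Lp ℝ 2 μ} (hg : g =ᵐ[μ] N) (hφ : φ =ᵐ[μ] k)
    (c : ℝ) : (fun x => (f x + c * g x) * φ x) =ᵐ[μ]
      fun x => f x * k x + c * inner ℝ (N x) (k x) := by
  filter_upwards [hg, hφ] with x hg hφ
  rw [hg, hφ, RCLike.inner_apply', conj_trivial]
  ring

theorem integrable_add_mul_mul {f g φ : α → ℝ} {N k : Lp ℝ 2 μ} (hg : g =ᵐ[μ] N)
    (hφ : φ =ᵐ[μ] k) (hf : Integrable (fun x => f x * k x) μ) (c : ℝ) :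
    Integrable (fun x => (f x + c * g x) * φ x) μ :=
  (hf.add ((L2.integrable_inner (𝕜 := ℝ) N k).const_mul c)).congr
    (add_mul_mul_ae_eq hg hφ c).symm

theorem integral_add_mul_mul {f g φ : α → ℝ} {N k : Lp ℝ 2 μ} (hg : g =ᵐ[μ] N)
    (hφ : φ =ᵐ[μ] k) (hf : Integrable (fun x => f x * k x) μ) (c : ℝ) :
    ∫ x, (f x + c * g x) * φ x ∂μ = ∫ x, f x * k x ∂μ + c * inner ℝ N k := by
  rw [integral_congr_ae (add_mul_mul_ae_eq hg hφ c),
    integral_add hf ((L2.integrable_inner (𝕜 := ℝ) N k).const_mul c), integral_const_mul,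
    L2.inner_def]

theorem IsSaturatingStatistics.comp_ae_eq_superposition [IsFiniteMeasure μ] {F : ℝ → ℝ} {S : ℝ}
    {L : ℝ≥0} (hF : IsSaturatingStatistics F S L) (v z : ℝ) {u : α → ℝ} {k : Lp ℝ 2 μ}
    (hk : u =ᵐ[μ] k) : (fun x => F (v - z * u x)) =ᵐ[μ]
      hF.superposition (v • Lp.const 2 μ (1 : ℝ) - z • k) := by
  rw [smul_const_one]
  filter_upwards [hF.coeFn_superposition (Lp.const 2 μ v - z • k), hk,
    Lp.coeFn_const v (p := 2) (μ := μ), Lp.coeFn_sub (Lp.const 2 μ v) (z • k), Lp.coeFn_smul z k]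
    with x apply_superposition apply_k apply_const apply_sub apply_smul
  rw [apply_superposition, apply_sub, Pi.sub_apply, apply_const, Function.const_apply, apply_smul,
    Pi.smul_apply, apply_k, smul_eq_mul]

end Integrals

section PoissonProblem

variable {d : ℕ} {Ω ΓD : Set (EuclideanSpace ℝ (Fin d))}

theorem IsBoundedLipschitzDomain.exists_loadFunctional (hΩ : IsBoundedLipschitzDomain Ω)
    {p : ℝ≥0∞} (hp1 : 1 ≤ p) (hpd : (d : ℝ≥0∞) / 2 < p) :
    ∃ C : ℝ≥0, ∀ f : EuclideanSpace ℝ (Fin d) → ℝ, MemLp f p (volume.restrict Ω) →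
      ∃ ℓ : dirichletSpace Ω ΓD →L[ℝ] ℝ, ∀ w : dirichletSpace Ω ΓD,
        Integrable (fun x => f x * w.1.1 x) (volume.restrict Ω) ∧
        ℓ w = ∫ x in Ω, f x * w.1.1 x ∧
        |ℓ w| ≤ C * (eLpNorm f p (volume.restrict Ω)).toReal * (‖w.1.1‖ + ‖w.1.2‖) := by
  obtain ⟨C, hC⟩ := hΩ.exists_abs_integral_mul_fst_le (ΓD := ΓD) hp1 hpd
  refine ⟨C, fun f hf => ?_⟩
  let ℓ : dirichletSpace Ω ΓD →ₗ[ℝ] ℝ :=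
    { toFun := fun w => ∫ x in Ω, f x * w.1.1 x
      map_add' := fun w w' => integral_mul_coeFn_add (hC f hf w.1 w.2).1 (hC f hf w'.1 w'.2).1
      map_smul' := fun c w => integral_mul_coeFn_smul f c w.1.1 }
  refine ⟨ℓ.mkContinuous (C * (eLpNorm f p (volume.restrict Ω)).toReal * 2) fun w => ?_,
    fun w => ⟨(hC f hf w.1 w.2).1, rfl, (hC f hf w.1 w.2).2⟩⟩
  refine (hC f hf w.1 w.2).2.trans ?_
  rw [mul_assoc _ (2 : ℝ), two_mul]
  gcongr
  exacts [norm_fst_le w.1, norm_snd_le w.1]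

theorem h1Norm_sq {u : EuclideanSpace ℝ (Fin d) → ℝ} {a : Lp ℝ 2 (volume.restrict Ω)}
    {b : Lp (EuclideanSpace ℝ (Fin d)) 2 (volume.restrict Ω)}
    (ha : u =ᵐ[volume.restrict Ω] a) (hb : weakGrad Ω u =ᵐ[volume.restrict Ω] b) :
    h1Norm Ω u ^ 2 = ‖a‖ ^ 2 + ‖b‖ ^ 2 := by
  rw [h1Norm, Real.sq_sqrt (by positivity), eLpNorm_congr_ae ha, eLpNorm_congr_ae hb, Lp.norm_def,
    Lp.norm_def]

theorem MemH1D.exists_ae_eq {φ : EuclideanSpace ℝ (Fin d) → ℝ} (h : MemH1D Ω ΓD φ) :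
    ∃ w : dirichletSpace Ω ΓD,
      φ =ᵐ[volume.restrict Ω] w.1.1 ∧ weakGrad Ω φ =ᵐ[volume.restrict Ω] w.1.2 :=
  ⟨⟨_, h.toLp_mem⟩, h.1.1.coeFn_toLp.symm, h.1.memLp_weakGrad.coeFn_toLp.symm⟩

theorem memH1D_of_ae_eq (hΩ : IsOpen Ω) (hΩb : Bornology.IsBounded Ω)
    (w : dirichletSpace Ω ΓD) {u : EuclideanSpace ℝ (Fin d) → ℝ}
    (hu : u =ᵐ[volume.restrict Ω] w.1.1) :
    MemH1D Ω ΓD u ∧ weakGrad Ω u =ᵐ[volume.restrict Ω] w.1.2 := by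
  refine memH1D_of_toLp_mem hΩ hΩb ((memLp_congr_ae hu).2 (Lp.memLp w.1.1)) (Lp.memLp w.1.2) ?_
  rw [Lp.toLp_coeFn, MemLp.toLp_congr _ (Lp.memLp w.1.1) hu, Lp.toLp_coeFn]
  exact w.2

variable {σ : ℝ} {ψD ψ : EuclideanSpace ℝ (Fin d) → ℝ} {h₀ : Lp ℝ 2 (volume.restrict Ω)}
  {g₀ : Lp (EuclideanSpace ℝ (Fin d)) 2 (volume.restrict Ω)} {w : dirichletSpace Ω ΓD}

theorem ae_eq_smul_add (hh₀ : ψD =ᵐ[volume.restrict Ω] h₀)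
    (hw : (fun x => ψ x - σ * ψD x) =ᵐ[volume.restrict Ω] w.1.1) :
    ψ =ᵐ[volume.restrict Ω] (σ • h₀ + w.1.1 : Lp ℝ 2 (volume.restrict Ω)) := by
  filter_upwards [hw, hh₀, Lp.coeFn_add (σ • h₀) w.1.1, Lp.coeFn_smul σ h₀]
    with x apply_w apply_h₀ apply_add apply_smul
  rw [apply_add, Pi.add_apply, apply_smul, Pi.smul_apply, ← apply_w, ← apply_h₀, smul_eq_mul]
  ring

theorem memH1_and_weakGrad_ae_eq (hΩ : IsOpen Ω) (hΩb : Bornology.IsBounded Ω)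
    (hψD : MemH1 Ω ψD) (hg₀ : weakGrad Ω ψD =ᵐ[volume.restrict Ω] g₀)
    (hw : (fun x => ψ x - σ * ψD x) =ᵐ[volume.restrict Ω] w.1.1) :
    MemH1 Ω ψ ∧ weakGrad Ω ψ =ᵐ[volume.restrict Ω]
      (w.1.2 + σ • g₀ : Lp (EuclideanSpace ℝ (Fin d)) 2 (volume.restrict Ω)) := by
  obtain ⟨memH1D, weakGrad_sub⟩ := memH1D_of_ae_eq hΩ hΩb w hw
  have ψ_eq : ψ = fun x => 1 * (ψ x - σ * ψD x) + σ * ψD x := by ext x; ring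
  have weakGrad_ψ := memH1D.1.weakGrad_linear_comb hΩ hψD 1 σ
  rw [← ψ_eq] at weakGrad_ψ
  refine ⟨ψ_eq ▸ memH1D.1.linear_comb hψD 1 σ, ?_⟩
  filter_upwards [weakGrad_ψ, weakGrad_sub, hg₀, Lp.coeFn_add w.1.2 (σ • g₀), Lp.coeFn_smul σ g₀]
    with x apply_ψ apply_sub apply_g₀ apply_add apply_smul
  rw [apply_ψ, apply_sub, apply_add, Pi.add_apply, apply_smul, Pi.smul_apply, apply_g₀, one_smul]

variable {lam : ℝ} {z : ℤ} {F : ℝ → ℝ} {S : ℝ} {L : ℝ≥0}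
  {M v : ℝ} {f : EuclideanSpace ℝ (Fin d) → ℝ} {ℓ : dirichletSpace Ω ΓD →L[ℝ] ℝ}

theorem poissonEquation_iff {G : Lp (EuclideanSpace ℝ (Fin d)) 2 (volume.restrict Ω)}
    {N : Lp ℝ 2 (volume.restrict Ω)} (hG : weakGrad Ω ψ =ᵐ[volume.restrict Ω] G)
    (hN : (fun x => F (v - z * ψ x)) =ᵐ[volume.restrict Ω] N)
    {φ : EuclideanSpace ℝ (Fin d) → ℝ} {k : dirichletSpace Ω ΓD}
    (hℓ : Integrable (fun x => f x * k.1.1 x) (volume.restrict Ω) ∧ ℓ k = ∫ x in Ω, f x * k.1.1 x)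
    (hφ : φ =ᵐ[volume.restrict Ω] k.1.1) (hk : weakGrad Ω φ =ᵐ[volume.restrict Ω] k.1.2) :
    lam ^ 2 * ∫ x in Ω, inner ℝ (weakGrad Ω ψ x) (weakGrad Ω φ x) =
        σ * ∫ x in Ω, (f x + z * F (v - z * ψ x)) * φ x ↔
      lam ^ 2 * inner ℝ G k.1.2 = (σ • ℓ) k + σ * (z * inner ℝ N k.1.1) := by
  rw [integral_inner_congr hG hk, integral_add_mul_mul hN hφ hℓ.1 z, ← hℓ.2]
  exact Eq.congr_right (mul_add _ _ _)

theorem isPoissonWeakSolution_iff [IsFiniteMeasure (volume.restrict Ω)] (hΩ : IsOpen Ω)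
    (hΩb : Bornology.IsBounded Ω) (hF : IsSaturatingStatistics F S L) (hψD : MemH1 Ω ψD)
    (hh₀ : ψD =ᵐ[volume.restrict Ω] h₀) (hg₀ : weakGrad Ω ψD =ᵐ[volume.restrict Ω] g₀)
    (hℓ : ∀ φ : dirichletSpace Ω ΓD, Integrable (fun x => f x * φ.1.1 x) (volume.restrict Ω) ∧
      ℓ φ = ∫ x in Ω, f x * φ.1.1 x)
    (hw : (fun x => ψ x - σ * ψD x) =ᵐ[volume.restrict Ω] w.1.1) :
    IsPoissonWeakSolution Ω ΓD lam z F M σ ψD f v ψ ↔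
      IsConstrainedSolution (dirichletSpace Ω ΓD) (Lp.const 2 (volume.restrict Ω) 1) M
        hF.superposition lam σ z (σ • h₀) (σ • g₀) (σ • ℓ) v w := by
  obtain ⟨memH1, weakGrad_ψ⟩ := memH1_and_weakGrad_ae_eq hΩ hΩb hψD hg₀ hw
  have density := hF.comp_ae_eq_superposition v z (ae_eq_smul_add hh₀ hw)
  have mass_eq := (integral_congr_ae density).trans (inner_const_one _).symm
  constructor
  · intro solution
    refine ⟨mass_eq.symm.trans solution.mass, fun k => ?_⟩
    obtain ⟨memH1D, weakGrad_k⟩ := memH1D_of_ae_eq hΩ hΩb k (u := k.1.1) .rfl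
    exact (poissonEquation_iff weakGrad_ψ density (hℓ k) (φ := k.1.1) .rfl weakGrad_k).1
      (solution.equation _ memH1D)
  · intro solution
    refine ⟨memH1, (memH1D_of_ae_eq hΩ hΩb w hw).1, fun φ hφ => ?_, fun φ hφ => ?_,
      mass_eq.trans solution.mass⟩ <;> obtain ⟨k, φ_eq, weakGrad_φ⟩ := hφ.exists_ae_eq
    · exact integrable_add_mul_mul density φ_eq (hℓ k).1 _
    · exact (poissonEquation_iff weakGrad_ψ density (hℓ k) φ_eq weakGrad_φ).2 (solution.equation k)

end PoissonProblem

theorem const_one_ne_zero {α : Type*} [MeasurableSpace α] {μ : Measure α} [IsFiniteMeasure μ]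
    (hμ : μ ≠ 0) : Lp.const 2 μ (1 : ℝ) ≠ 0 := fun h => by
  have norm_sq := norm_const_one_sq (μ := μ)
  rw [h, norm_zero, zero_pow two_ne_zero, eq_comm, measureReal_eq_zero_iff] at norm_sq
  exact hμ (Measure.measure_univ_eq_zero.1 norm_sq)

theorem IsIonStatistics.isSaturatingStatistics {F : ℝ → ℝ} {S : ℝ} (hF : IsIonStatistics F S) :
    IsSaturatingStatistics F S S.toNNReal where
  strictMono := strictMono_of_deriv_pos hF.deriv_pos
  range_eq := image_univ ▸ hF.bijOn.image_eq
  lipschitz := by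
    refine lipschitzWith_of_nnnorm_deriv_le (hF.contDiff.differentiable one_ne_zero) fun η => ?_
    rw [← NNReal.coe_le_coe, coe_nnnorm, Real.norm_of_nonneg (hF.deriv_pos η).le]
    exact (hF.deriv_le η).trans ((hF.bijOn.mapsTo (mem_univ η)).2.le.trans (Real.le_coe_toNNReal S))

theorem mainTheorem6_general {d : ℕ} {Ω ΓD : Set (EuclideanSpace ℝ (Fin d))}
    (hΩ : IsBoundedLipschitzDomain Ω) (hΓ : ΓD ⊆ frontier Ω) (hΓpos : surfaceMeasure d ΓD ≠ 0)
    {lam : ℝ} (hlam : 0 < lam) {F : ℝ → ℝ} {S : ℝ} {L : ℝ≥0} (hF : IsSaturatingStatistics F S L)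
    {M : ℝ} (hM : 0 < M) (hMS : M < (volume Ω).toReal * S)
    {p : ℝ≥0∞} (hp1 : 1 ≤ p) (hpd : (d : ℝ≥0∞) / 2 < p) (zabs : ℕ) :
    ∃ K : ℝ, 0 < K ∧
      ∀ z : ℤ, z.natAbs ≤ zabs →
      ∀ ψD : EuclideanSpace ℝ (Fin d) → ℝ, MemH1 Ω ψD →
      ∀ f : EuclideanSpace ℝ (Fin d) → ℝ, MemLp f p (volume.restrict Ω) →
      ∀ σ ∈ Icc (0 : ℝ) 1,
        ∃ (v : ℝ) (ψ : EuclideanSpace ℝ (Fin d) → ℝ),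
          IsPoissonWeakSolution Ω ΓD lam z F M σ ψD f v ψ ∧
          (∀ (v' : ℝ) (ψ' : EuclideanSpace ℝ (Fin d) → ℝ),
            IsPoissonWeakSolution Ω ΓD lam z F M σ ψD f v' ψ' →
              v' = v ∧ ψ' =ᵐ[volume.restrict Ω] ψ) ∧
          σ * |v| + h1Norm Ω ψ ^ 2 ≤
            σ * K * (1 + h1Norm Ω ψD ^ 2 + (eLpNorm f p (volume.restrict Ω)).toReal ^ 2) := by
  have := isFiniteMeasure_restrict_of_isBounded hΩ.isBounded
  have hμ : volume.restrict Ω ≠ 0 :=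
    Measure.restrict_eq_zero.not.2 (hΩ.isOpen.measure_pos volume hΩ.isConnected.nonempty).ne'
  obtain ⟨P, hP⟩ := hΩ.exists_norm_fst_le hΓ hΓpos
  obtain ⟨D, hD⟩ := hΩ.exists_loadFunctional (ΓD := ΓD) hp1 hpd
  obtain ⟨δ, A, hΨ⟩ := hF.exists_isCoercivePotential (μ := volume.restrict Ω) hM
    (by simpa [Measure.real] using hMS)
  obtain ⟨K, hK, hK_bound⟩ := hΨ.exists_mul_abs_add_norm_sq_le hP hlam D zabs
  refine ⟨K, hK, fun z hz ψD hψD f hf σ hσ => ?_⟩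
  obtain ⟨ℓ, hℓ⟩ := hD f hf
  have hh₀ := hψD.1.coeFn_toLp.symm
  have hg₀ := hψD.memLp_weakGrad.coeFn_toLp.symm
  have solution_iff {v : ℝ} {ψ : EuclideanSpace ℝ (Fin d) → ℝ} {w : dirichletSpace Ω ΓD}
      (hw : (fun x => ψ x - σ * ψD x) =ᵐ[volume.restrict Ω] w.1.1) :=
    isPoissonWeakSolution_iff (lam := lam) (z := z) (M := M) (v := v) hΩ.isOpen hΩ.isBounded hF
      hψD hh₀ hg₀ (fun φ => ⟨(hℓ φ).1, (hℓ φ).2.1⟩) hw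
  obtain ⟨v, w, hw⟩ := hΨ.exists_isConstrainedSolution_smul (z := z) isClosed_dirichletSpace hP
    hlam hσ.1 hψD.1.toLp hψD.memLp_weakGrad.toLp ℓ
  have ψ_sub : (fun x => σ * ψD x + w.1.1 x - σ * ψD x) =ᵐ[volume.restrict Ω] w.1.1 :=
    .of_forall fun x => add_sub_cancel_left _ _
  refine ⟨v, fun x => σ * ψD x + w.1.1 x, (solution_iff ψ_sub).2 hw, fun v' ψ' h' => ?_, ?_⟩
  · obtain ⟨w', hw', -⟩ := h'.boundary.exists_ae_eq
    obtain ⟨rfl, rfl⟩ := hΨ.isConstrainedSolution_unique (const_one_ne_zero hμ) hP hlam hσ.1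
      ((solution_iff hw').1 h') hw
    exact ⟨rfl, hw'.mono fun x hx => by linarith⟩
  · rw [h1Norm_sq (ae_eq_smul_add hh₀ ψ_sub)
      (memH1_and_weakGrad_ae_eq hΩ.isOpen hΩ.isBounded hψD hg₀ ψ_sub).2, h1Norm_sq hh₀ hg₀]
    refine hK_bound σ hσ z ?_ _ _ ℓ _ ENNReal.toReal_nonneg (fun w => (hℓ w).2.2) v w hw
    rw [← Int.cast_abs, ← Nat.cast_natAbs]
    exact_mod_cast hz

/-- The constant `K` depends only on `Ω`, `ΓD`, `p`, `lam`, `F`, `M` and `zabs = |z|`, and not on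
`σ`, `ψD`, `f`. -/
theorem mainTheorem6 (d : ℕ) (hd : 1 ≤ d) (Ω ΓD ΓN : Set (EuclideanSpace ℝ (Fin d)))
    (hΩ : IsBoundedLipschitzDomain Ω) (hΓ : IsBoundarySplitting Ω ΓD ΓN)
    (lam : ℝ) (hlam : 0 < lam) (F : ℝ → ℝ) (S : ℝ) (hF : IsIonStatistics F S)
    (M : ℝ) (hM : 0 < M) (hMS : M < (volume Ω).toReal * S)
    (p : ℝ≥0∞) (hp1 : 1 ≤ p) (hpd : (d : ℝ≥0∞) / 2 < p) (zabs : ℕ) :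
    ∃ K : ℝ, 0 < K ∧
      ∀ z : ℤ, z.natAbs = zabs →
      ∀ ψD : EuclideanSpace ℝ (Fin d) → ℝ, MemH1 Ω ψD → MemLp ψD ∞ (volume.restrict Ω) →
      ∀ f : EuclideanSpace ℝ (Fin d) → ℝ, MemLp f p (volume.restrict Ω) →
      ∀ σ ∈ Icc (0 : ℝ) 1,
        ∃ (v : ℝ) (ψ : EuclideanSpace ℝ (Fin d) → ℝ),
          IsPoissonWeakSolution Ω ΓD lam z F M σ ψD f v ψ ∧
          (∀ (v' : ℝ) (ψ' : EuclideanSpace ℝ (Fin d) → ℝ),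
            IsPoissonWeakSolution Ω ΓD lam z F M σ ψD f v' ψ' →
              v' = v ∧ ψ' =ᵐ[volume.restrict Ω] ψ) ∧
          σ * |v| + h1Norm Ω ψ ^ 2 ≤
            σ * K * (1 + h1Norm Ω ψD ^ 2 + (eLpNorm f p (volume.restrict Ω)).toReal ^ 2) := by
  have ΓD_subset : ΓD ⊆ frontier Ω :=
    subset_union_left.trans (subset_closure.trans hΓ.closure_union.subset)
  obtain ⟨K, hK, hK_solution⟩ := mainTheorem6_general hΩ ΓD_subset hΓ.dirichlet_pos.ne' hlam
    hF.isSaturatingStatistics hM hMS hp1 hpd zabs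
  exact ⟨K, hK, fun z hz ψD hψD _ => hK_solution z hz.le ψD hψD⟩
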